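/- Let $n\ge 1$ and let $\mathbb D^n$ be the unit polydisc in $\mathbb C^n$, $\mathbb T^n$ its distinguished boundary with normalized Lebesgue measure $d\xi$, and $I=[0,1)$. Products of vectors are coordinatewise, $z^k=z_1^{k_1}\cdots z_n^{k_n}$, and $(1-r)^\gamma=\prod_{j=1}^n(1-r_j)^\gamma$ for $r\in I^n$, $\gamma\in\mathbb R$. For $f$ holomorphic in $\mathbb D^n$ with expansion $f(z)=\sum_{k\in\mathbb Z_+^n}a_kz^k$, $r\in I^n$ and $b>-1$, put $$M_p(f,r)=\Big(\int_{\mathbb T^n}|f(r\xi)|^p\,d\xi\Big)^{1/p},\qquad D^{b}f(z)=\sum_{k\in\mathbb Z_+^n}\Big(\prod_{j=1}^n\frac{\Gamma(k_j+b+1)}{\Gamma(b+1)\Gamma(k_j+1)}\Big)a_kz^k .$$ For $0<p,q<\infty$ and $\alpha>0$ let $A^{p,q}_\alpha(\mathbb D^n)$ be the space of all holomorphic $f$ in $\mathbb D^n$ with $$\int_{I^n}M_p^q(f,R)(1-R)^{\alpha q-1}\,dR<\infty ,$$ and $F^{p,q}_\alpha(\mathbb D^n)$ the space of all holomorphic $f$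 in $\mathbb D^n$ with $$\int_{\mathbb T^n}\Big(\int_{I^n}|f(R\xi)|^q(1-R)^{\alpha q-1}\,dR\Big)^{p/q}d\xi<\infty .$$ A sequence $\{c_k\}_{k\in\mathbb Z_+^n}$ is a (coefficient) multiplier from $X$ to $Y$ if for every $f(z)=\sum_k a_kz^k$ in $X$ the function $h(z)=\sum_k c_ka_kz^k$ is (defined in $\mathbb D^n$ and) in $Y$. **Theorem 1.** Let $g(z)=\sum_{k\in\mathbb Z_+^n}c_kz^k$ be holomorphic in $\mathbb D^n$. Let $p,q,\alpha,\beta>0$, $t\le 1$, $\frac t2<s\le t$, $\max(p,q)\le s$, $\beta+\frac1t<\alpha+\frac1p<\frac2t$, and let $m\in\mathbb N$ satisfy $m>\frac2t-1$. $1^\circ$. $\{c_k\}$ is a multiplier from $F^{p,q}_\alpha(\mathbb D^n)$ to $A^{t,s}_\beta(\mathbb D^n)$ if and only if $$\sup_{r\in I^n}M_t(D^mg,r)\,(1-r)^{m+1-\frac1p+\beta-\alpha}<\infty .$$ $2^\circ$. $\{c_k\}$ is a multiplier from $A^{p,q}_\alpha(\mathbb D^n)$ to $A^{t,s}_\beta(\mathbb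 D^n)$ if and only if the same condition holds. -/

import Mathlib

open MeasureTheory Set
open scoped ENNReal

noncomputable section

namespace Polydisc

/-- The unit polydisc `D^n` in `ℂ^n`. -/
def polydisc (n : ℕ) : Set (Fin n → ℂ) := {z | ∀ i, ‖z i‖ < 1}

/-- The cube `I^n`, where `I = [0, 1)`. -/
def cube (n : ℕ) : Set (Fin n → ℝ) := {r | ∀ i, r i ∈ Ico (0 : ℝ) 1}

/-- `H(D^n)`, the functions holomorphic in the polydisc. -/
def Hol (n : ℕ) : Set ((Fin n → ℂ) → ℂ) := {f | DifferentiableOn ℂ f (polydisc n)}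

/-- The monomial `z^k = z₁^{k₁} ⋯ zₙ^{kₙ}`. -/
def monom {n : ℕ} (k : Fin n → ℕ) (z : Fin n → ℂ) : ℂ := ∏ i, z i ^ k i

/-- `f(z) = ∑ₖ aₖ z^k` in the polydisc. -/
def HasExpansion {n : ℕ} (f : (Fin n → ℂ) → ℂ) (a : (Fin n → ℕ) → ℂ) : Prop :=
  ∀ z ∈ polydisc n, HasSum (fun k => a k * monom k z) (f z)

/-- The normalized Lebesgue measure `dξ` of the distinguished boundary `𝕋^n`. The latter is
parametrized by `θ ∈ (ℝ/ℤ)^n` through `ξⱼ = exp(2πiθⱼ)`. -/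
def torusMeasure (n : ℕ) : Measure (UnitAddTorus (Fin n)) :=
  Measure.pi (fun _ => AddCircle.haarAddCircle)

/-- The point `Rξ = (R₁ξ₁, …, Rₙξₙ)`, where `ξⱼ = exp(2πiθⱼ)`. -/
def torusPoint {n : ℕ} (R : Fin n → ℝ) (θ : UnitAddTorus (Fin n)) : Fin n → ℂ :=
  fun i => (R i : ℂ) * (AddCircle.toCircle (θ i) : ℂ)

/-- The `k`-th Taylor coefficient at the origin of a function `f ∈ H(D^n)`, given by Cauchy's
formula on the torus of radius `1/2`. -/
def taylorCoeff {n : ℕ} (f : (Fin n → ℂ) → ℂ) (k : Fin n → ℕ) : ℂ :=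
  2 ^ (∑ i, k i) *
    UnitAddTorus.mFourierCoeff (fun θ => f (torusPoint (fun _ => 1 / 2) θ)) (fun i => (k i : ℤ))

/-- The weight `(1-R)^γ = (1-R₁)^γ ⋯ (1-Rₙ)^γ`, for `R ∈ I^n`. -/
def weight {n : ℕ} (γ : ℝ) (R : Fin n → ℝ) : ℝ≥0∞ :=
  ENNReal.ofReal (∏ i, (1 - R i) ^ γ)

/-- The operator of fractional differentiation `D^b`, `b > -1`. -/
def fracDeriv {n : ℕ} (b : ℝ) (f : (Fin n → ℂ) → ℂ) (z : Fin n → ℂ) : ℂ :=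
  ∑' k : Fin n → ℕ,
    ((∏ i, Real.Gamma (k i + b + 1) / (Real.Gamma (b + 1) * Real.Gamma (k i + 1)) : ℝ) : ℂ) *
      taylorCoeff f k * monom k z

/-- The integral mean `M_p(f, r)`, `0 < p < ∞`. -/
def intMean {n : ℕ} (p : ℝ) (f : (Fin n → ℂ) → ℂ) (r : Fin n → ℝ) : ℝ≥0∞ :=
  (∫⁻ θ, ‖f (torusPoint r θ)‖ₑ ^ p ∂torusMeasure n) ^ (1 / p)

/-- The mixed-norm space `A^{p,q}_α(D^n)`, `0 < p, q < ∞`. -/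
def mixedSpace (n : ℕ) (p q α : ℝ) : Set ((Fin n → ℂ) → ℂ) :=
  {f | f ∈ Hol n ∧ ∫⁻ R in cube n, intMean p f R ^ q * weight (α * q - 1) R < ∞}

/-- The Lizorkin–Triebel space `F^{p,q}_α(D^n)`, `0 < p, q < ∞`. -/
def lizorkinTriebelSpace (n : ℕ) (p q α : ℝ) : Set ((Fin n → ℂ) → ℂ) :=
  {f | f ∈ Hol n ∧
    ∫⁻ θ,
      (∫⁻ R in cube n, ‖f (torusPoint R θ)‖ₑ ^ q * weight (α * q - 1) R) ^ (p / q)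
        ∂torusMeasure n < ∞}

/-- `M_T(X, Y)`, the coefficient multipliers from `X` to `Y`. -/
def coeffMultipliers {n : ℕ} (X Y : Set ((Fin n → ℂ) → ℂ)) : Set ((Fin n → ℕ) → ℂ) :=
  {c | ∀ f ∈ X, ∀ a, HasExpansion f a → ∃ h ∈ Y, HasExpansion h (fun k => c k * a k)}

end Polydisc

end

/-!
The condition on `g` says that the functions `D^m g(r ·)` are bounded by `(1 - r)^{α+1/p-(m+1)}` in
`A^{t,s}_β`, and `D^m g(r ·)` is the image under the multiplier of the test function
`f_r(z) = ∏ⱼ (1 - rⱼ zⱼ)^{-(m+1)}`, whose norms in `A^{p,q}_α` and `F^{p,q}_α` are bounded by this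
very power. So necessity is the boundedness of the multiplier on the functions `f_r`, and
sufficiency says that for `t ≤ 1` these functions decide.

Everything rests on the sub-mean value property of `|f|^p` for all `p > 0`, with respect to products
of Poisson kernels (`enorm_rpow_le_lintegral_polyMeasure`). It makes the means `M_p(f, R)`
increasing and bounds their growth, and so gives the embedding `A^{p,q}_α ⊆ A^{t,s}_{α+1/p-1/t}` for
`p ≤ t`, `q ≤ s` (`mixedIntegral_le`). Harnack's inequality for the kernels and Minkowski's
inequality give `F^{p,q}_α ⊆ A^{p,max(p,q)}_α` (`lizorkinTriebelSpace_subset_mixedSpace`). Both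
spaces of the theorem are therefore contained in `A^{t,s}_{α+1/p-1/t}`.

*Sufficiency.* The function `h = ∑ cₖ aₖ z^k` has the integral representation
`h(Rξ) = ∫∫ D^m g(Rρη) f(ρξη̄) dη K(ρ) dρ` with `|K(ρ)| ≲ (1 - ρ)^{m-1}`
(`enorm_le_lintegral_convolution`). The integrand has the modulus of a holomorphic function of `ρη`,
so the embedding of `A^{t,t}` into `A^{1,1}` bounds the integral by one of `t`-th powers, `t ≤ 1`;
integration in `ξ` gives `M_t(h, R)^t ≲ ∫ M_t(D^m g, Rρ)^t M_t(f, ρ)^t (1 - ρ)^{(m+1)t-2} dρ`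
(`exists_powMean_le_convolution`). With the hypothesis on `D^m g`, the power `s / t ≤ 1` may be
moved inside the integral (`lintegral_rpow_le_of_quasi_mono`), and integration in `R` leaves the
norm of `f` in `A^{t,s}_{α+1/p-1/t}` (`mixedIntegral_ne_top_of_bounded`).

*Necessity.* A multiplier is only assumed to map one space into the other. A gliding hump replaces
the closed graph theorem: if the condition fails, there are radii `rⱼ` along which the normalized
images of `f_{rⱼ}` grow like `4^j`. All the sums `∑ⱼ εⱼ 2^{-j} (1 - rⱼ)^{m+1-α-1/p} f_{rⱼ}`,
`ε ∈ {0, 1}^ℕ`, lie in the space, and Baire's theorem on the Cantor space contradicts the growth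
(`exists_intMean_bound_of_multiplier`).
-/

namespace Polydisc

open AddCircle

/-! ### The Poisson kernel of the disc -/

/-- The point `exp (2πiθ)` of the unit circle. -/
noncomputable def circlePoint (θ : UnitAddCircle) : ℂ := (AddCircle.toCircle θ : ℂ)

@[simp] lemma norm_circlePoint (θ : UnitAddCircle) : ‖circlePoint θ‖ = 1 :=
  Circle.norm_coe _

lemma continuous_circlePoint : Continuous circlePoint :=
  continuous_subtype_val.comp AddCircle.continuous_toCircle

lemma circlePoint_add (θ η : UnitAddCircle) :
    circlePoint (θ + η) = circlePoint θ * circlePoint η := by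
  simp [circlePoint, AddCircle.toCircle_add]

lemma circlePoint_neg (θ : UnitAddCircle) :
    circlePoint (-θ) = (starRingEnd ℂ) (circlePoint θ) := by
  rw [circlePoint, AddCircle.toCircle_neg, Circle.coe_inv_eq_conj]; rfl

lemma integral_haar_circlePoint {E : Type*} [NormedAddCommGroup E] [NormedSpace ℝ E]
    (F : ℂ → E) :
    ∫ θ, F (circlePoint θ) ∂(haarAddCircle : Measure UnitAddCircle)
      = Real.circleAverage F 0 1 := by
  have hv : (haarAddCircle : Measure UnitAddCircle) = volume := by
    rw [AddCircle.volume_eq_smul_haarAddCircle]; simp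
  rw [hv, ← AddCircle.intervalIntegral_preimage 1 0, Real.circleAverage]
  have h := intervalIntegral.smul_integral_comp_mul_left (a := 0) (b := 1)
    (fun x => F (circleMap 0 1 x)) (2 * Real.pi)
  simp only [mul_zero, mul_one] at h
  rw [← h, smul_smul, inv_mul_cancel₀ (by positivity), one_smul, zero_add]
  refine intervalIntegral.integral_congr fun x _ => ?_
  simp [circlePoint, AddCircle.toCircle_apply_mk, circleMap, Circle.coe_exp]

/-- Every continuous real function on the circle is uniformly close to the real part of an entire
function, because trigonometric polynomials are dense. -/
lemma exists_entire_re_near (φ : UnitAddCircle → ℝ) (hφ : Continuous φ) {ε : ℝ} (hε : 0 < ε) :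
    ∃ G : ℂ → ℂ, Differentiable ℂ G ∧ ∀ θ, |(G (circlePoint θ)).re - φ θ| < ε := by
  let Φ : C(UnitAddCircle, ℂ) := ⟨fun θ => (φ θ : ℂ), by fun_prop⟩
  have hmem : Φ ∈ (Submodule.span ℂ (Set.range (@fourier 1))).topologicalClosure := by
    rw [span_fourier_closure_eq_top]; trivial
  rw [← SetLike.mem_coe, Submodule.topologicalClosure_coe, Metric.mem_closure_iff] at hmem
  obtain ⟨P, hP, hd⟩ := hmem ε hε
  -- a trigonometric polynomial is `G + conj H` on the circle, with the same real part as `G + H`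
  have key : ∃ G H : ℂ → ℂ, Differentiable ℂ G ∧ Differentiable ℂ H ∧
      ∀ θ, P θ = G (circlePoint θ) + (starRingEnd ℂ) (H (circlePoint θ)) := by
    clear hd
    induction hP using Submodule.span_induction with
    | mem x h =>
      obtain ⟨k, rfl⟩ := h
      obtain ⟨j, rfl | rfl⟩ := k.eq_nat_or_neg
      · refine ⟨fun z => z ^ j, fun _ => 0, by fun_prop, by fun_prop, fun θ => ?_⟩
        simp [circlePoint, fourier_apply, AddCircle.toCircle_nsmul]
      · refine ⟨fun _ => 0, fun z => z ^ j, by fun_prop, by fun_prop, fun θ => ?_⟩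
        have h := circlePoint_neg θ
        simp only [circlePoint] at h
        simp [circlePoint, fourier_apply, AddCircle.toCircle_nsmul, ← h,
          AddCircle.toCircle_neg]
    | zero => exact ⟨fun _ => 0, fun _ => 0, by fun_prop, by fun_prop, by simp⟩
    | add x y _ _ hx hy =>
      obtain ⟨G, H, hG, hH, h⟩ := hx
      obtain ⟨G', H', hG', hH', h'⟩ := hy
      refine ⟨fun z => G z + G' z, fun z => H z + H' z, by fun_prop, by fun_prop, fun θ => ?_⟩
      simp [h, h']; ring
    | smul a x _ hx =>
      obtain ⟨G, H, hG, hH, h⟩ := hx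
      refine ⟨fun z => a * G z, fun z => (starRingEnd ℂ) a * H z, by fun_prop, by fun_prop,
        fun θ => ?_⟩
      simp [h]; ring
  obtain ⟨G, H, hG, hH, h⟩ := key
  refine ⟨fun z => G z + H z, by fun_prop, fun θ => ?_⟩
  have h1 : dist (Φ θ) (P θ) < ε := lt_of_le_of_lt (ContinuousMap.dist_apply_le_dist θ) hd
  have h2 : ((G (circlePoint θ) + H (circlePoint θ)).re - φ θ) = (P θ - Φ θ).re := by
    simp [h, Φ]
  rw [h2]
  refine lt_of_le_of_lt (Complex.abs_re_le_norm _) ?_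
  rwa [dist_comm, dist_eq_norm] at h1

/-- The Poisson kernel of the unit disc, for the evaluation point `x ∈ [0, 1)`. -/
noncomputable def circleKernel (x : ℝ) (η : UnitAddCircle) : ℝ :=
  (1 - x ^ 2) / ‖1 - x * circlePoint η‖ ^ 2

lemma one_sub_le_norm {x : ℝ} (hx : 0 ≤ x) (η : UnitAddCircle) :
    1 - x ≤ ‖1 - x * circlePoint η‖ := by
  have := norm_sub_norm_le (1 : ℂ) (x * circlePoint η)
  simpa [abs_of_nonneg hx] using this

lemma circleKernel_nonneg {x : ℝ} (h0 : 0 ≤ x) (h1 : x < 1) (η : UnitAddCircle) :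
    0 ≤ circleKernel x η := by
  have : 0 ≤ 1 - x ^ 2 := by nlinarith
  unfold circleKernel; positivity

lemma continuous_circleKernel {x : ℝ} (h0 : 0 ≤ x) (h1 : x < 1) :
    Continuous (circleKernel x) := by
  unfold circleKernel
  have := continuous_circlePoint
  refine Continuous.div (by fun_prop) (by fun_prop) fun η => ?_
  have := one_sub_le_norm h0 η
  have : 0 < ‖1 - x * circlePoint η‖ := by linarith
  positivity

lemma circleKernel_sub_eq_poissonKernel (x : ℝ) (θ η : UnitAddCircle) :
    circleKernel x (θ - η) = poissonKernel 0 (x * circlePoint θ) (circlePoint η) := by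
  have h : circlePoint η * (1 - x * circlePoint (θ - η)) = circlePoint η - x * circlePoint θ := by
    rw [sub_eq_add_neg θ, circlePoint_add, circlePoint_neg]
    have : circlePoint η * (starRingEnd ℂ) (circlePoint η) = 1 := by
      rw [Complex.mul_conj, Complex.normSq_eq_norm_sq]; simp
    linear_combination (-(x : ℂ) * circlePoint θ) * this
  have h2 : ‖1 - x * circlePoint (θ - η)‖ = ‖circlePoint η - x * circlePoint θ‖ := by
    rw [← h]; simp
  simp [circleKernel, poissonKernel, h2]

lemma poisson_integral {G : ℂ → ℂ} (hG : DiffContOnCl ℂ G (Metric.ball 0 1)) {x : ℝ}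
    (h0 : 0 ≤ x) (h1 : x < 1) (θ : UnitAddCircle) :
    ∫ η, (circleKernel x (θ - η) : ℂ) * G (circlePoint η) ∂haarAddCircle
      = G (x * circlePoint θ) := by
  have hw : (x : ℂ) * circlePoint θ ∈ Metric.ball (0 : ℂ) 1 := by simp [abs_of_nonneg h0, h1]
  have := hG.circleAverage_poissonKernel_smul hw
  rw [← integral_haar_circlePoint] at this
  rw [← this]
  simp [circleKernel_sub_eq_poissonKernel]

lemma integrable_of_continuous {E : Type*} [NormedAddCommGroup E] {u : UnitAddCircle → E}
    (hu : Continuous u) : Integrable u haarAddCircle :=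
  hu.integrable_of_hasCompactSupport (HasCompactSupport.of_compactSpace u)

lemma integral_circleKernel_sub {x : ℝ} (h0 : 0 ≤ x) (h1 : x < 1) (θ : UnitAddCircle) :
    ∫ η, circleKernel x (θ - η) ∂haarAddCircle = 1 := by
  have := poisson_integral (G := fun _ => 1) diffContOnCl_const h0 h1 θ
  simp only [mul_one] at this
  rw [integral_complex_ofReal (f := fun η => circleKernel x (θ - η))] at this
  exact_mod_cast this

/-- The Poisson sub-mean value property of `‖F‖ ^ p`, for every `p > 0`: on the circle `‖F‖ ^ p` is
nearly the modulus of `exp G` for an entire function `G`, the maximum modulus principle transfers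
the comparison to the interior, and there `exp G` is given by its Poisson integral. -/
lemma norm_rpow_le_integral {F : ℂ → ℂ} (hF : DiffContOnCl ℂ F (Metric.ball 0 1)) {p : ℝ}
    (hp : 0 < p) {x : ℝ} (h0 : 0 ≤ x) (h1 : x < 1) (θ : UnitAddCircle) :
    ‖F (x * circlePoint θ)‖ ^ p ≤
      ∫ η, circleKernel x (θ - η) * ‖F (circlePoint η)‖ ^ p ∂haarAddCircle := by
  have hcont : Continuous fun η => F (circlePoint η) := by
    have h2 := hF.continuousOn
    rw [closure_ball 0 one_ne_zero] at h2
    exact h2.comp_continuous continuous_circlePoint (by simp)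
  have hK : Continuous fun η => circleKernel x (θ - η) :=
    (continuous_circleKernel h0 h1).comp (by fun_prop)
  have hcp : Continuous fun η => ‖F (circlePoint η)‖ ^ p :=
    hcont.norm.rpow_const fun _ => Or.inr hp.le
  set A := ∫ η, circleKernel x (θ - η) * ‖F (circlePoint η)‖ ^ p ∂haarAddCircle with hA
  have main : ∀ ε : ℝ, 0 < ε → ‖F (x * circlePoint θ)‖ ^ p ≤ Real.exp (2 * ε) * (A + ε) := by
    intro ε hε
    -- `exp G` is a holomorphic function whose modulus on the circle lies between `‖F‖ ^ p` and
    -- `exp (2ε) (‖F‖ ^ p + ε)`; adding `ε` to the logarithm puts the approximation above `‖F‖ ^ p`.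
    have hpos : ∀ η, ‖F (circlePoint η)‖ ^ p + ε ≠ 0 := fun η => by positivity
    obtain ⟨G, hG, hGε⟩ := exists_entire_re_near
      (fun η => Real.log (‖F (circlePoint η)‖ ^ p + ε) + ε)
      ((hcp.add continuous_const).log (fun η => hpos η) |>.add continuous_const) hε
    have hlow : ∀ η, ‖F (circlePoint η)‖ ^ p ≤ Real.exp (G (circlePoint η)).re := by
      intro η
      have h := (abs_lt.1 (hGε η)).1
      calc ‖F (circlePoint η)‖ ^ p ≤ ‖F (circlePoint η)‖ ^ p + ε := by linarith
        _ = Real.exp (Real.log (‖F (circlePoint η)‖ ^ p + ε)) := (Real.exp_log (by positivity)).symm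
        _ ≤ _ := Real.exp_le_exp.2 (by linarith)
    have hup : ∀ η, Real.exp (G (circlePoint η)).re
        ≤ Real.exp (2 * ε) * (‖F (circlePoint η)‖ ^ p + ε) := by
      intro η
      have h := (abs_lt.1 (hGε η)).2
      calc Real.exp (G (circlePoint η)).re
          ≤ Real.exp (2 * ε + Real.log (‖F (circlePoint η)‖ ^ p + ε)) :=
            Real.exp_le_exp.2 (by linarith)
        _ = _ := by rw [Real.exp_add, Real.exp_log (by positivity)]
    -- the maximum modulus principle for the holomorphic function `F * exp (-G / p)`
    have hmax : ‖F (x * circlePoint θ) * Complex.exp (-(G (x * circlePoint θ)) / p)‖ ≤ 1 := by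
      have hd : DiffContOnCl ℂ (fun z => F z * Complex.exp (-(G z) / p)) (Metric.ball 0 1) :=
        DiffContOnCl.smul (𝕜 := ℂ) (𝕜' := ℂ) (c := F) (f := fun z => Complex.exp (-(G z) / p)) hF
          (Differentiable.diffContOnCl (by fun_prop))
      refine Complex.norm_le_of_forall_mem_frontier_norm_le
        (f := fun z => F z * Complex.exp (-(G z) / p)) Metric.isBounded_ball hd ?_
        (subset_closure (by simp [abs_of_nonneg h0, h1]))
      intro z hz
      rw [frontier_ball 0 one_ne_zero, mem_sphere_zero_iff_norm] at hz
      obtain ⟨η, rfl⟩ : ∃ η, circlePoint η = z := by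
        obtain ⟨η, hη⟩ := (AddCircle.homeomorphCircle (T := 1) one_ne_zero).surjective
          ⟨z, mem_sphere_zero_iff_norm.2 hz⟩
        refine ⟨η, ?_⟩
        rw [circlePoint, ← AddCircle.homeomorphCircle_apply one_ne_zero, hη]
      have h3 : (-(G (circlePoint η)) / p : ℂ).re = -((G (circlePoint η)).re / p) := by
        rw [Complex.div_ofReal_re]; simp [neg_div]
      rw [norm_mul, Complex.norm_exp, h3, Real.exp_neg, mul_inv_le_iff₀ (Real.exp_pos _), one_mul]
      rw [← Real.rpow_le_rpow_iff (norm_nonneg _) (Real.exp_pos _).le hp, ← Real.exp_mul,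
        div_mul_cancel₀ _ hp.ne']
      exact hlow η
    have hnorm : ‖F (x * circlePoint θ)‖ ^ p ≤ ‖Complex.exp (G (x * circlePoint θ))‖ := by
      rw [Complex.norm_exp]
      rw [norm_mul, Complex.norm_exp] at hmax
      have h3 : (-(G (x * circlePoint θ)) / p : ℂ).re = -((G (x * circlePoint θ)).re / p) := by
        rw [Complex.div_ofReal_re]; simp [neg_div]
      rw [h3, Real.exp_neg, mul_inv_le_iff₀ (Real.exp_pos _), one_mul] at hmax
      calc ‖F (x * circlePoint θ)‖ ^ p ≤ (Real.exp ((G (x * circlePoint θ)).re / p)) ^ p :=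
            Real.rpow_le_rpow (norm_nonneg _) hmax hp.le
        _ = _ := by rw [← Real.exp_mul, div_mul_cancel₀ _ hp.ne']
    refine hnorm.trans ?_
    -- Poisson's formula for `exp G`
    rw [← poisson_integral (G := fun z => Complex.exp (G z))
      (Differentiable.diffContOnCl (𝕜 := ℂ) (by fun_prop)) h0 h1 θ]
    refine (norm_integral_le_integral_norm _).trans ?_
    have hGc : Continuous fun η => G (circlePoint η) := hG.continuous.comp continuous_circlePoint
    calc ∫ η, ‖(circleKernel x (θ - η) : ℂ) * Complex.exp (G (circlePoint η))‖ ∂haarAddCircle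
        ≤ ∫ η, Real.exp (2 * ε) * (circleKernel x (θ - η) * ‖F (circlePoint η)‖ ^ p
            + circleKernel x (θ - η) * ε) ∂haarAddCircle := by
          refine integral_mono (integrable_of_continuous ?_)
            (integrable_of_continuous (by fun_prop)) fun η => ?_
          · exact ((Complex.continuous_ofReal.comp hK).mul (Complex.continuous_exp.comp hGc)).norm
          have hk := circleKernel_nonneg h0 h1 (θ - η)
          simp only [norm_mul, Complex.norm_real, Real.norm_eq_abs, abs_of_nonneg hk,
            Complex.norm_exp]
          calc _ ≤ circleKernel x (θ - η) *
                (Real.exp (2 * ε) * (‖F (circlePoint η)‖ ^ p + ε)) := by gcongr; exact hup η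
            _ = _ := by ring
      _ = Real.exp (2 * ε) * (A + ε) := by
          rw [integral_const_mul, integral_add (integrable_of_continuous (by fun_prop))
            (integrable_of_continuous (by fun_prop)), integral_mul_const,
            integral_circleKernel_sub h0 h1, one_mul]
  have hlim : Filter.Tendsto (fun ε : ℝ => Real.exp (2 * ε) * (A + ε)) (nhdsWithin 0 (Ioi 0))
      (nhds A) := by
    have : Continuous fun ε : ℝ => Real.exp (2 * ε) * (A + ε) := by fun_prop
    have h := this.tendsto 0
    simp only [mul_zero, Real.exp_zero, one_mul, add_zero] at h
    exact h.mono_left nhdsWithin_le_nhds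
  exact ge_of_tendsto hlim (eventually_nhdsWithin_of_forall main)

/-- The Poisson kernel as a measure, the point mass for `x = 1`: it is the harmonic measure of the
disc of radius `R` at the point `x * R`, in the angular variable. -/
noncomputable def circleMeasure (x : ℝ) : Measure UnitAddCircle :=
  if x < 1 then haarAddCircle.withDensity fun η => ENNReal.ofReal (circleKernel x η)
  else Measure.dirac 0

lemma measurable_circleKernel (x : ℝ) : Measurable (circleKernel x) := by
  have := continuous_circlePoint.measurable
  unfold circleKernel
  fun_prop

instance sigmaFinite_circleMeasure (x : ℝ) : SigmaFinite (circleMeasure x) := by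
  by_cases h : x < 1
  · have h2 : SigmaFinite ((haarAddCircle : Measure UnitAddCircle).withDensity
        fun η => ENNReal.ofReal (circleKernel x η)) :=
      SigmaFinite.withDensity_of_ne_top (Filter.Eventually.of_forall fun _ => ENNReal.ofReal_ne_top)
    rwa [circleMeasure, if_pos h]
  · rw [circleMeasure, if_neg h]; infer_instance

lemma lintegral_circleMeasure {x : ℝ} (h1 : x < 1) (u : UnitAddCircle → ℝ≥0∞)
    (hu : Measurable u) :
    ∫⁻ η, u η ∂circleMeasure x
      = ∫⁻ η, ENNReal.ofReal (circleKernel x η) * u η ∂haarAddCircle := by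
  rw [circleMeasure, if_pos h1, lintegral_withDensity_eq_lintegral_mul _
    (measurable_circleKernel x).ennreal_ofReal hu]
  rfl

lemma isProbabilityMeasure_circleMeasure {x : ℝ} (h0 : 0 ≤ x) :
    IsProbabilityMeasure (circleMeasure x) := by
  by_cases h1 : x < 1
  · constructor
    have h := lintegral_circleMeasure h1 1 measurable_one
    simp only [Pi.one_apply, lintegral_one, mul_one] at h
    rw [h, ← ofReal_integral_eq_lintegral_ofReal
      (integrable_of_continuous (continuous_circleKernel h0 h1))
      (Filter.Eventually.of_forall (circleKernel_nonneg h0 h1))]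
    have h2 := integral_circleKernel_sub h0 h1 0
    rw [integral_sub_left_eq_self (fun η => circleKernel x η) haarAddCircle 0] at h2
    simp [h2]
  · rw [circleMeasure, if_neg h1]; infer_instance

/-- The sub-mean value property of `‖F‖ ^ p` on the disc, for the harmonic measures
`circleMeasure x`, `0 ≤ x ≤ 1`. -/
lemma enorm_rpow_le_lintegral {F : ℂ → ℂ} (hF : DiffContOnCl ℂ F (Metric.ball 0 1)) {p : ℝ}
    (hp : 0 < p) {x : ℝ} (h0 : 0 ≤ x) (h1 : x ≤ 1) (θ : UnitAddCircle) :
    ‖F (x * circlePoint θ)‖ₑ ^ p ≤ ∫⁻ η, ‖F (circlePoint (θ - η))‖ₑ ^ p ∂circleMeasure x := by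
  have hcont : Continuous fun η => F (circlePoint (θ - η)) := by
    have h2 := hF.continuousOn
    rw [closure_ball 0 one_ne_zero] at h2
    exact h2.comp_continuous (continuous_circlePoint.comp (by fun_prop)) (by simp)
  rcases h1.lt_or_eq with h1 | rfl
  · rw [lintegral_circleMeasure h1 _ (hcont.enorm.measurable.pow_const p)]
    have hcp : Continuous fun η => ‖F (circlePoint (θ - η))‖ ^ p :=
      hcont.norm.rpow_const fun _ => Or.inr hp.le
    have hK := continuous_circleKernel h0 h1
    have h := norm_rpow_le_integral hF hp h0 h1 θ
    rw [← integral_sub_left_eq_self _ haarAddCircle θ] at h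
    simp only [sub_sub_cancel] at h
    have h3 := ENNReal.ofReal_le_ofReal h
    rw [ofReal_integral_eq_lintegral_ofReal (integrable_of_continuous (by fun_prop))
      (Filter.Eventually.of_forall fun η => mul_nonneg (circleKernel_nonneg h0 h1 _)
        (by positivity))] at h3
    simp only [ENNReal.ofReal_mul (circleKernel_nonneg h0 h1 _),
      ← ENNReal.ofReal_rpow_of_nonneg (norm_nonneg _) hp.le, ofReal_norm] at h3
    exact h3
  · simp [circleMeasure, lintegral_dirac]

/-- The kernel bound `circleKernel x ≤ 2 / (1 - x)`, as a bound for the measures. -/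
lemma circleMeasure_le {x : ℝ} (h0 : 0 ≤ x) (h1 : x < 1) :
    circleMeasure x ≤ ENNReal.ofReal (2 / (1 - x)) • haarAddCircle := by
  rw [circleMeasure, if_pos h1, ← withDensity_const]
  refine withDensity_mono (Filter.Eventually.of_forall fun η => ?_)
  refine ENNReal.ofReal_le_ofReal ?_
  have h2 := one_sub_le_norm h0 η
  have h3 : 0 < 1 - x := by linarith
  calc circleKernel x η ≤ (1 - x ^ 2) / (1 - x) ^ 2 := by
        unfold circleKernel
        have : 0 ≤ 1 - x ^ 2 := by nlinarith
        gcongr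
    _ = (1 + x) / (1 - x) := by field_simp; ring
    _ ≤ 2 / (1 - x) := by gcongr; linarith

/-- Harnack's inequality for the Poisson kernels, as a bound for the measures. -/
lemma circleMeasure_le_of_le_two_mul {x y : ℝ} (hx : 0 ≤ x) (hx1 : x < 1) (hy : 0 ≤ y) (hy1 : y < 1)
    (hxy : 1 - x ≤ 2 * (1 - y)) (hyx : 1 - y ≤ 2 * (1 - x)) :
    circleMeasure x ≤ (16 : ℝ≥0∞) • circleMeasure y := by
  rw [circleMeasure, circleMeasure, if_pos hx1, if_pos hy1,
    ← withDensity_smul _ (measurable_circleKernel y).ennreal_ofReal]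
  refine withDensity_mono (Filter.Eventually.of_forall fun η => ?_)
  simp only [Pi.smul_apply, smul_eq_mul]
  rw [show (16 : ℝ≥0∞) = ENNReal.ofReal 16 by simp, ← ENNReal.ofReal_mul (by norm_num)]
  refine ENNReal.ofReal_le_ofReal ?_
  have h1 := one_sub_le_norm hx η
  have h2 := one_sub_le_norm hy η
  have h3 : ‖1 - y * circlePoint η‖ ≤ ‖1 - x * circlePoint η‖ + |x - y| := by
    have : 1 - y * circlePoint η = (1 - x * circlePoint η) + ((x - y : ℝ) : ℂ) * circlePoint η := by
      push_cast; ring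
    rw [this]
    refine (norm_add_le _ _).trans ?_
    rw [norm_mul, Complex.norm_real, norm_circlePoint, mul_one, Real.norm_eq_abs]
  have h4 : |x - y| ≤ ‖1 - x * circlePoint η‖ := by
    rw [abs_le]; constructor <;> linarith
  have h5 : ‖1 - y * circlePoint η‖ ^ 2 ≤ 4 * ‖1 - x * circlePoint η‖ ^ 2 := by
    nlinarith [norm_nonneg (1 - y * circlePoint η)]
  unfold circleKernel
  have h6 : 1 - x ^ 2 ≤ 4 * (1 - y ^ 2) := by nlinarith
  have h7 : 0 < ‖1 - x * circlePoint η‖ ^ 2 := by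
    have : 0 < ‖1 - x * circlePoint η‖ := by linarith
    positivity
  have h8 : 0 < ‖1 - y * circlePoint η‖ ^ 2 := by
    have : 0 < ‖1 - y * circlePoint η‖ := by linarith
    positivity
  rw [mul_div_assoc', div_le_div_iff₀ h7 h8]
  have h9 : 0 ≤ 1 - y ^ 2 := by nlinarith
  nlinarith [mul_le_mul h6 h5 h8.le (by linarith)]

/-! ### Sub-mean values on the polydisc -/

lemma pi_mono {ι : Type*} [Fintype ι] {X : ι → Type*} [∀ i, MeasurableSpace (X i)]
    {μ ν : ∀ i, Measure (X i)} [∀ i, SigmaFinite (μ i)] [∀ i, SigmaFinite (ν i)]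
    (h : ∀ i, μ i ≤ ν i) : Measure.pi μ ≤ Measure.pi ν := by
  have h1 : (Measure.pi μ).toOuterMeasure ≤ OuterMeasure.pi fun i => (ν i).toOuterMeasure := by
    rw [OuterMeasure.le_pi]
    intro s _
    rw [Measure.coe_toOuterMeasure, Measure.pi_pi]
    exact Finset.prod_le_prod' fun i _ => h i _
  intro s
  rw [Measure.pi_def ν]
  exact (h1 s).trans (le_toMeasure_apply _ (Measure.pi_caratheodory ν) s)

lemma sigmaFinite_smul {X : Type*} [MeasurableSpace X] {c : ℝ≥0∞} (hc : c ≠ ∞) (ν : Measure X)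
    [SigmaFinite ν] : SigmaFinite (c • ν) := by
  rw [← withDensity_const]
  exact SigmaFinite.withDensity_of_ne_top (Filter.Eventually.of_forall fun _ => hc)

lemma pi_smul {ι : Type*} [Fintype ι] {X : ι → Type*} [∀ i, MeasurableSpace (X i)]
    (c : ι → ℝ≥0∞) (hc : ∀ i, c i ≠ ∞) (ν : ∀ i, Measure (X i)) [∀ i, SigmaFinite (ν i)] :
    Measure.pi (fun i => c i • ν i) = (∏ i, c i) • Measure.pi ν := by
  have : ∀ i, SigmaFinite (c i • ν i) := fun i => sigmaFinite_smul (hc i) _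
  refine (Measure.pi_eq fun s hs => ?_)
  simp [Measure.pi_pi, Finset.prod_mul_distrib]

lemma pi_le_smul_pi {ι : Type*} [Fintype ι] {X : ι → Type*} [∀ i, MeasurableSpace (X i)]
    (c : ι → ℝ≥0∞) (hc : ∀ i, c i ≠ ∞) (μ ν : ∀ i, Measure (X i)) [∀ i, SigmaFinite (μ i)]
    [∀ i, SigmaFinite (ν i)] (h : ∀ i, μ i ≤ c i • ν i) :
    Measure.pi μ ≤ (∏ i, c i) • Measure.pi ν := by
  have : ∀ i, SigmaFinite (c i • ν i) := fun i => sigmaFinite_smul (hc i) _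
  rw [← pi_smul c hc]
  exact pi_mono h

lemma torusPoint_apply {n : ℕ} (R : Fin n → ℝ) (θ : UnitAddTorus (Fin n)) (i : Fin n) :
    torusPoint R θ i = R i * circlePoint (θ i) := rfl

lemma continuous_torusPoint {n : ℕ} :
    Continuous fun a : (Fin n → ℝ) × UnitAddTorus (Fin n) => torusPoint a.1 a.2 := by
  refine continuous_pi fun i => ?_
  simp only [torusPoint_apply]
  have := continuous_circlePoint
  fun_prop

lemma torusPoint_mem_polydisc {n : ℕ} {R : Fin n → ℝ} (hR : R ∈ cube n)
    (θ : UnitAddTorus (Fin n)) : torusPoint R θ ∈ polydisc n := by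
  intro i
  simpa [torusPoint_apply, abs_of_nonneg (hR i).1] using (hR i).2

lemma isOpen_polydisc (n : ℕ) : IsOpen (polydisc n) := by
  simp only [polydisc, ofPred_forall]
  exact isOpen_iInter_of_finite fun i => isOpen_lt (by fun_prop) continuous_const

lemma continuous_comp_torusPoint {n : ℕ} {f : (Fin n → ℂ) → ℂ} (hf : f ∈ Hol n)
    {R : Fin n → ℝ} (hR : R ∈ cube n) : Continuous fun θ => f (torusPoint R θ) :=
  hf.continuousOn.comp_continuous (continuous_torusPoint.comp
    (by fun_prop : Continuous fun θ => (R, θ)))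
    fun θ => torusPoint_mem_polydisc hR θ

instance isProbabilityMeasure_torusMeasure (n : ℕ) : IsProbabilityMeasure (torusMeasure n) := by
  unfold torusMeasure; infer_instance

instance isAddHaarMeasure_torusMeasure (n : ℕ) : (torusMeasure n).IsAddHaarMeasure := by
  unfold torusMeasure; infer_instance

instance isNegInvariant_torusMeasure (n : ℕ) : (torusMeasure n).IsNegInvariant := by
  have : (haarAddCircle : Measure UnitAddCircle).IsNegInvariant := inferInstance
  unfold torusMeasure
  exact Measure.pi.isNegInvariant _

/-- The harmonic measure of a polydisc with radii `R`, at the point `x * R`. -/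
noncomputable def polyMeasure {n : ℕ} (x : Fin n → ℝ) : Measure (UnitAddTorus (Fin n)) :=
  Measure.pi fun i => circleMeasure (x i)

lemma cons_mem_polydisc {n : ℕ} {w : ℂ} {z : Fin n → ℂ} :
    (Fin.cons w z : Fin (n + 1) → ℂ) ∈ polydisc (n + 1) ↔ ‖w‖ < 1 ∧ z ∈ polydisc n := by
  simp [polydisc, Fin.forall_fin_succ]

/-- The sub-mean value property of `‖f‖ ^ p` on the polydisc, by iteration of the one-dimensional
inequality. The value `x i = 1` is allowed, so that single variables can be left alone. -/
lemma enorm_rpow_le_lintegral_polyMeasure {n : ℕ} {f : (Fin n → ℂ) → ℂ} (hf : f ∈ Hol n) {p : ℝ}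
    (hp : 0 < p) {R x : Fin n → ℝ} (hR : R ∈ cube n) (hx : ∀ i, x i ∈ Icc (0 : ℝ) 1)
    (θ : UnitAddTorus (Fin n)) :
    ‖f (torusPoint (x * R) θ)‖ₑ ^ p ≤
      ∫⁻ η, ‖f (torusPoint R (θ - η))‖ₑ ^ p ∂polyMeasure x := by
  induction n with
  | zero =>
    have h1 : polyMeasure x = Measure.dirac 0 := by
      rw [polyMeasure, Measure.pi_of_empty _ 0]
    rw [h1, lintegral_dirac]
    refine le_of_eq ?_
    congr 3
    ext i; exact i.elim0
  | succ n ih =>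
    have hR' : Fin.tail R ∈ cube n := fun i => hR i.succ
    have hsplit : ∀ (S : Fin (n + 1) → ℝ) (φ : UnitAddTorus (Fin (n + 1))), torusPoint S φ =
        Fin.cons (S 0 * circlePoint (φ 0)) (torusPoint (Fin.tail S) (Fin.tail φ)) := by
      intro S φ
      ext i
      refine Fin.cases ?_ (fun j => ?_) i <;> simp [torusPoint_apply, Fin.tail]
    have hxR : Fin.tail x * Fin.tail R ∈ cube n := fun i => by
      have h1 := hx i.succ
      have h2 := hR i.succ
      simp only [Pi.mul_apply, Fin.tail, mem_Ico]
      exact ⟨mul_nonneg h1.1 h2.1, by nlinarith [h1.1, h1.2, h2.1, h2.2]⟩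
    -- the first variable
    set z' := torusPoint (Fin.tail x * Fin.tail R) (Fin.tail θ) with hz'
    have hz'm : z' ∈ polydisc n := torusPoint_mem_polydisc hxR _
    have hF : DiffContOnCl ℂ (fun w : ℂ => f (Fin.cons (R 0 * w) z')) (Metric.ball 0 1) := by
      refine DifferentiableOn.diffContOnCl ?_
      rw [closure_ball 0 one_ne_zero]
      refine DifferentiableOn.comp (t := polydisc (n + 1)) hf ?_ ?_
      · refine Differentiable.differentiableOn ?_
        refine differentiable_pi.2 fun i => ?_
        refine Fin.cases ?_ (fun j => ?_) i
        · simp only [Fin.cons_zero]; fun_prop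
        · simp only [Fin.cons_succ]; fun_prop
      · intro w hw
        rw [cons_mem_polydisc]
        refine ⟨?_, hz'm⟩
        rw [mem_closedBall_zero_iff] at hw
        have := hR 0
        rw [norm_mul, Complex.norm_real, Real.norm_eq_abs, abs_of_nonneg this.1]
        nlinarith [this.1, this.2, norm_nonneg w]
    have h1 := enorm_rpow_le_lintegral hF hp (hx 0).1 (hx 0).2 (θ 0)
    -- the remaining variables
    have h2 : ∀ η₀ : UnitAddCircle, ‖f (Fin.cons (R 0 * circlePoint (θ 0 - η₀)) z')‖ₑ ^ p ≤
        ∫⁻ η, ‖f (Fin.cons (R 0 * circlePoint (θ 0 - η₀))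
          (torusPoint (Fin.tail R) (Fin.tail θ - η)))‖ₑ ^ p ∂polyMeasure (Fin.tail x) := by
      intro η₀
      refine ih (f := fun z => f (Fin.cons (R 0 * circlePoint (θ 0 - η₀)) z)) ?_ hR'
        (fun i => hx i.succ) (Fin.tail θ)
      refine DifferentiableOn.comp (t := polydisc (n + 1)) hf ?_ ?_
      · refine Differentiable.differentiableOn ?_
        refine differentiable_pi.2 fun i => ?_
        refine Fin.cases ?_ (fun j => ?_) i
        · simp only [Fin.cons_zero]; fun_prop
        · simp only [Fin.cons_succ]; fun_prop
      · intro z hz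
        rw [cons_mem_polydisc]
        refine ⟨?_, hz⟩
        have := hR 0
        simpa [abs_of_nonneg this.1] using this.2
    have hmeas : Measurable fun a : UnitAddCircle × UnitAddTorus (Fin n) =>
        ‖f (Fin.cons (R 0 * circlePoint (θ 0 - a.1))
          (torusPoint (Fin.tail R) (Fin.tail θ - a.2)))‖ₑ ^ p := by
      refine Measurable.pow_const (Continuous.measurable (Continuous.enorm ?_)) p
      have h3 : Continuous fun a : UnitAddCircle × UnitAddTorus (Fin n) =>
          f (torusPoint R (θ - Fin.cons a.1 a.2)) := by
        refine (continuous_comp_torusPoint hf hR).comp (Continuous.sub continuous_const ?_)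
        refine continuous_pi fun i => ?_
        refine Fin.cases ?_ (fun j => ?_) i
        · simp only [Fin.cons_zero]; fun_prop
        · simp only [Fin.cons_succ]; fun_prop
      convert h3 using 3 with a
      rw [hsplit]
      congr 1
    have h3 : torusPoint (x * R) θ = Fin.cons (R 0 * (x 0 * circlePoint (θ 0))) z' := by
      rw [hsplit, hz']
      congr 1
      simp; ring
    rw [h3]
    refine h1.trans ((lintegral_mono h2).trans (le_of_eq ?_))
    have hmp := measurePreserving_piFinSuccAbove (fun i => circleMeasure (x i)) 0
    rw [polyMeasure, polyMeasure, ← lintegral_prod _ hmeas.aemeasurable]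
    erw [← hmp.lintegral_comp hmeas]
    refine lintegral_congr fun η => ?_
    rw [hsplit]
    rfl

/-- The integral `∫ ‖f(Rξ)‖ ^ p dξ`, that is, `M_p(f, R) ^ p`. -/
noncomputable def powMean {n : ℕ} (p : ℝ) (f : (Fin n → ℂ) → ℂ) (R : Fin n → ℝ) : ℝ≥0∞ :=
  ∫⁻ θ, ‖f (torusPoint R θ)‖ₑ ^ p ∂torusMeasure n

lemma intMean_eq {n : ℕ} (p : ℝ) (f : (Fin n → ℂ) → ℂ) (R : Fin n → ℝ) :
    intMean p f R = powMean p f R ^ (1 / p) := rfl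

lemma measurable_enorm_comp_torusPoint_rpow {n : ℕ} {f : (Fin n → ℂ) → ℂ} (hf : f ∈ Hol n)
    {R : Fin n → ℝ} (hR : R ∈ cube n) (p : ℝ) :
    Measurable fun θ => ‖f (torusPoint R θ)‖ₑ ^ p :=
  (continuous_comp_torusPoint hf hR).enorm.measurable.pow_const p

lemma isProbabilityMeasure_polyMeasure {n : ℕ} {x : Fin n → ℝ} (hx : ∀ i, 0 ≤ x i) :
    IsProbabilityMeasure (polyMeasure x) := by
  have := fun i => isProbabilityMeasure_circleMeasure (hx i)
  unfold polyMeasure; infer_instance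

/-- The means `M_p(f, R)` increase with `R`: integrate the sub-mean value inequality over the torus.
-/
lemma powMean_mono {n : ℕ} {f : (Fin n → ℂ) → ℂ} (hf : f ∈ Hol n) {p : ℝ}
    (hp : 0 < p) {r R : Fin n → ℝ} (hr : r ∈ cube n) (hR : R ∈ cube n) (hrR : r ≤ R) :
    powMean p f r ≤ powMean p f R := by
  set x : Fin n → ℝ := fun i => r i / R i with hx
  have hx1 : ∀ i, x i ∈ Icc (0 : ℝ) 1 := fun i =>
    ⟨div_nonneg (hr i).1 (hR i).1, div_le_one_of_le₀ (hrR i) (hR i).1⟩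
  -- where `R i = 0`, also `r i = 0`, and the junk value `x i = 0` does no harm
  have hxR : r = x * R := by
    ext i
    rcases (hR i).1.eq_or_lt with h | h
    · have h1 : r i ≤ R i := hrR i
      have h2 := (hr i).1
      simp only [Pi.mul_apply, ← h, mul_zero]; linarith
    · simp only [Pi.mul_apply, hx]; field_simp
  have := isProbabilityMeasure_polyMeasure fun i => (hx1 i).1
  have hmeas : Measurable fun a : UnitAddTorus (Fin n) × UnitAddTorus (Fin n) =>
      ‖f (torusPoint R (a.1 - a.2))‖ₑ ^ p :=
    (((continuous_comp_torusPoint hf hR).comp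
      (continuous_fst.sub continuous_snd)).enorm.measurable).pow_const p
  calc powMean p f r = ∫⁻ θ, ‖f (torusPoint (x * R) θ)‖ₑ ^ p ∂torusMeasure n := by rw [powMean, hxR]
    _ ≤ ∫⁻ θ, ∫⁻ η, ‖f (torusPoint R (θ - η))‖ₑ ^ p ∂polyMeasure x ∂torusMeasure n :=
        lintegral_mono fun θ => enorm_rpow_le_lintegral_polyMeasure hf hp hR hx1 θ
    _ = ∫⁻ η, ∫⁻ θ, ‖f (torusPoint R (θ - η))‖ₑ ^ p ∂torusMeasure n ∂polyMeasure x :=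
        lintegral_lintegral_swap hmeas.aemeasurable
    _ = powMean p f R := by
        simp_rw [lintegral_sub_right_eq_self (μ := torusMeasure n)
          (fun θ => ‖f (torusPoint R θ)‖ₑ ^ p)]
        simp [powMean]

/-- The radii `(1 + R) / 2`, halfway between `R` and `1`. -/
noncomputable def halfway {n : ℕ} (R : Fin n → ℝ) : Fin n → ℝ := fun i => (1 + R i) / 2

lemma halfway_mem {n : ℕ} {R : Fin n → ℝ} (hR : R ∈ cube n) : halfway R ∈ cube n := fun i => by
  have := hR i
  simp only [halfway, mem_Ico] at *
  constructor <;> linarith [this.1, this.2]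

lemma le_halfway {n : ℕ} {R : Fin n → ℝ} (hR : R ∈ cube n) : R ≤ halfway R := fun i => by
  have := (hR i).2
  simp only [halfway]; linarith

/-- The growth of `f` at the point `Rξ` is controlled by the mean over the torus halfway to the
distinguished boundary. -/
lemma enorm_rpow_le_powMean {n : ℕ} {f : (Fin n → ℂ) → ℂ} (hf : f ∈ Hol n) {p : ℝ}
    (hp : 0 < p) {R : Fin n → ℝ} (hR : R ∈ cube n) (θ : UnitAddTorus (Fin n)) :
    ‖f (torusPoint R θ)‖ₑ ^ p ≤
      ENNReal.ofReal (∏ i, 4 / (1 - R i)) * powMean p f (halfway R) := by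
  set x : Fin n → ℝ := fun i => R i / halfway R i with hx
  have hpos : ∀ i, 0 < halfway R i := fun i => by
    have := (hR i).1
    simp only [halfway]; linarith
  have hxR : x * halfway R = R := by
    ext i; simp only [Pi.mul_apply, hx]; rw [div_mul_cancel₀ _ (hpos i).ne']
  have hx0 : ∀ i, 0 ≤ x i := fun i => div_nonneg (hR i).1 (hpos i).le
  have hx1 : ∀ i, x i < 1 := fun i => by
    rw [div_lt_one (hpos i)]
    have := (hR i).2
    simp only [halfway]; linarith
  have hx2 : ∀ i, 2 / (1 - x i) ≤ 4 / (1 - R i) := fun i => by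
    have h1 := hR i
    have h2 : 1 - x i = (1 - R i) / (1 + R i) := by
      have : (1 + R i) ≠ 0 := by linarith [h1.1]
      simp only [hx, halfway]; field_simp; ring
    rw [h2, div_div_eq_mul_div]
    have : 0 < 1 - R i := by linarith [h1.2]
    gcongr
    linarith [h1.2]
  have h1 := enorm_rpow_le_lintegral_polyMeasure hf hp (halfway_mem hR)
    (fun i => ⟨hx0 i, (hx1 i).le⟩) θ
  rw [hxR] at h1
  refine h1.trans ?_
  have h2 : polyMeasure x ≤ ENNReal.ofReal (∏ i, 4 / (1 - R i)) • torusMeasure n := by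
    rw [ENNReal.ofReal_prod_of_nonneg fun i _ => div_nonneg (by norm_num) (by linarith [(hR i).2])]
    refine pi_le_smul_pi _ (fun i => ENNReal.ofReal_ne_top) _ _ fun i => ?_
    refine (circleMeasure_le (hx0 i) (hx1 i)).trans ?_
    intro s
    simp only [Measure.smul_apply, smul_eq_mul]
    gcongr ?_ * _
    exact ENNReal.ofReal_le_ofReal (hx2 i)
  refine (lintegral_mono' h2 le_rfl).trans ?_
  rw [lintegral_smul_measure, smul_eq_mul,
    lintegral_sub_left_eq_self (μ := torusMeasure n)
      (fun θ => ‖f (torusPoint (halfway R) θ)‖ₑ ^ p)]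
  rfl

/-! ### Weights on the cube -/

section Weight

variable {n : ℕ} {R : Fin n → ℝ}

lemma one_sub_pos (hR : R ∈ cube n) (i : Fin n) : 0 < 1 - R i := by linarith [(hR i).2]

lemma weight_eq_prod (hR : R ∈ cube n) (γ : ℝ) :
    weight γ R = ∏ i, ENNReal.ofReal ((1 - R i) ^ γ) :=
  ENNReal.ofReal_prod_of_nonneg fun i _ => Real.rpow_nonneg (one_sub_pos hR i).le _

lemma weight_mul (hR : R ∈ cube n) (γ δ : ℝ) :
    weight γ R * weight δ R = weight (γ + δ) R := by
  rw [weight, weight, weight, ← ENNReal.ofReal_mul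
    (Finset.prod_nonneg fun i _ => Real.rpow_nonneg (one_sub_pos hR i).le _),
    ← Finset.prod_mul_distrib]
  simp_rw [Real.rpow_add (one_sub_pos hR _)]

lemma weight_rpow (hR : R ∈ cube n) (γ s : ℝ) : weight γ R ^ s = weight (γ * s) R := by
  rw [weight, weight, ENNReal.ofReal_rpow_of_pos
    (Finset.prod_pos fun i _ => Real.rpow_pos_of_pos (one_sub_pos hR i) _),
    ← Real.finsetProd_rpow _ _ fun i _ => Real.rpow_nonneg (one_sub_pos hR i).le _]
  simp_rw [Real.rpow_mul (one_sub_pos hR _).le]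

lemma weight_ne_top (γ : ℝ) : weight γ R ≠ ∞ := ENNReal.ofReal_ne_top

@[simp] lemma weight_zero : weight 0 R = 1 := by simp [weight]

lemma measurable_weight (γ : ℝ) : Measurable fun R : Fin n → ℝ => weight γ R := by
  unfold weight; fun_prop

lemma weight_anti {r R : Fin n → ℝ} (hR : R ∈ cube n) (h : r ≤ R) {γ : ℝ}
    (hγ : 0 ≤ γ) : weight γ R ≤ weight γ r := by
  refine ENNReal.ofReal_le_ofReal (Finset.prod_le_prod
    (fun i _ => Real.rpow_nonneg (one_sub_pos hR i).le _) fun i _ => ?_)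
  exact Real.rpow_le_rpow (one_sub_pos hR i).le (by linarith [h i]) hγ

lemma weight_mono {r R : Fin n → ℝ} (hr : r ∈ cube n) (hR : R ∈ cube n) (h : r ≤ R) {γ : ℝ}
    (hγ : γ ≤ 0) : weight γ r ≤ weight γ R := by
  refine ENNReal.ofReal_le_ofReal (Finset.prod_le_prod
    (fun i _ => Real.rpow_nonneg (one_sub_pos hr i).le _) fun i _ => ?_)
  exact Real.rpow_le_rpow_of_nonpos (one_sub_pos hR i) (by linarith [h i]) hγ

/-- Powers of numbers that are comparable up to a factor `4`, whatever the sign of the exponent. -/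
lemma rpow_le_of_comparable {x y : ℝ} (hx : 0 < x) (hy : 0 < y) (h1 : x ≤ 4 * y) (h2 : y ≤ 4 * x)
    (γ : ℝ) : x ^ γ ≤ 4 ^ |γ| * y ^ γ := by
  rcases le_total 0 γ with h | h
  · rw [abs_of_nonneg h, ← Real.mul_rpow (by norm_num) hy.le]
    exact Real.rpow_le_rpow hx.le h1 h
  · rw [abs_of_nonpos h, Real.rpow_neg (by norm_num), ← Real.inv_rpow (by norm_num),
      ← Real.mul_rpow (by norm_num) hy.le]
    exact Real.rpow_le_rpow_of_nonpos (by positivity) (by linarith) h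

/-- Weights at comparable radii are comparable. -/
lemma weight_le_of_comparable {ρ : Fin n → ℝ} (hR : R ∈ cube n) (hρ : ρ ∈ cube n)
    (h1 : ∀ i, 1 - R i ≤ 4 * (1 - ρ i)) (h2 : ∀ i, 1 - ρ i ≤ 4 * (1 - R i)) (γ : ℝ) :
    weight γ R ≤ ENNReal.ofReal ((4 ^ |γ|) ^ n) * weight γ ρ := by
  rw [weight, weight, ← ENNReal.ofReal_mul (by positivity)]
  refine ENNReal.ofReal_le_ofReal ?_
  calc ∏ i, (1 - R i) ^ γ ≤ ∏ i : Fin n, 4 ^ |γ| * (1 - ρ i) ^ γ :=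
        Finset.prod_le_prod (fun i _ => Real.rpow_nonneg (one_sub_pos hR i).le _) fun i _ =>
          rpow_le_of_comparable (one_sub_pos hR i) (one_sub_pos hρ i) (h1 i) (h2 i) γ
    _ = _ := by rw [Finset.prod_mul_distrib]; simp

end Weight

lemma mul_mem_cube {n : ℕ} {r R : Fin n → ℝ} (hr : r ∈ cube n) (hR : R ∈ cube n) :
    r * R ∈ cube n := fun i => by
  have h1 := hr i
  have h2 := hR i
  simp only [Pi.mul_apply, mem_Ico]
  exact ⟨mul_nonneg h1.1 h2.1, by nlinarith [h1.1, h1.2, h2.1, h2.2]⟩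

lemma cube_eq_pi (n : ℕ) : cube n = Set.univ.pi fun _ => Ico (0 : ℝ) 1 := by
  ext; simp [cube]

lemma measurableSet_cube (n : ℕ) : MeasurableSet (cube n) := by
  rw [cube_eq_pi]
  exact MeasurableSet.univ_pi fun _ => measurableSet_Ico

lemma volume_restrict_cube (n : ℕ) : (volume : Measure (Fin n → ℝ)).restrict (cube n)
    = Measure.pi fun _ => (volume : Measure ℝ).restrict (Ico 0 1) := by
  rw [cube_eq_pi, volume_pi, Measure.restrict_pi_pi]

/-- Tonelli's theorem for products of functions of one variable. -/
lemma lintegral_pi_prod {n : ℕ} {X : Type*} [MeasurableSpace X] (μ : Fin n → Measure X)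
    [∀ i, SigmaFinite (μ i)] (φ : Fin n → X → ℝ≥0∞) (hφ : ∀ i, Measurable (φ i)) :
    ∫⁻ x, ∏ i, φ i (x i) ∂Measure.pi μ = ∏ i, ∫⁻ x, φ i x ∂μ i := by
  induction n with
  | zero => simp
  | succ n ih =>
    have hmp := measurePreserving_piFinSuccAbove μ 0
    have h1 : ∀ x : Fin (n + 1) → X, ∏ i, φ i (x i) =
        (fun a : X × (Fin n → X) => φ 0 a.1 * ∏ i, φ (Fin.succ i) (a.2 i))
          (MeasurableEquiv.piFinSuccAbove (fun _ => X) 0 x) := by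
      intro x
      rw [Fin.prod_univ_succ]
      rfl
    have h2 : Measurable fun a : X × (Fin n → X) => φ 0 a.1 * ∏ i, φ (Fin.succ i) (a.2 i) := by
      have := hφ 0
      have := fun i : Fin n => hφ i.succ
      fun_prop
    have h3 : Measurable fun y : Fin n → X => ∏ i, φ (Fin.succ i) (y i) := by
      have := fun i : Fin n => hφ i.succ
      fun_prop
    simp_rw [h1]
    rw [hmp.lintegral_comp h2, lintegral_prod_mul
      (g := fun y : Fin n → X => ∏ i, φ (Fin.succ i) (y i))
      (hφ 0).aemeasurable h3.aemeasurable, Fin.prod_univ_succ]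
    congr 1
    exact ih _ (fun i => φ i.succ) fun i => hφ i.succ

lemma lintegral_cube_prod {n : ℕ} (φ : Fin n → ℝ → ℝ≥0∞) (hφ : ∀ i, Measurable (φ i)) :
    ∫⁻ R in cube n, ∏ i, φ i (R i) = ∏ i, ∫⁻ x in Ico (0 : ℝ) 1, φ i x := by
  rw [volume_restrict_cube, lintegral_pi_prod _ _ hφ]

/-! ### One-dimensional integrals -/

lemma lintegral_Ico_one_sub (g : ℝ → ℝ≥0∞) (r : ℝ) :
    ∫⁻ R in Ico r 1, g (1 - R) = ∫⁻ x in Ioc 0 (1 - r), g x := by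
  rw [← lintegral_indicator measurableSet_Ico, ← lintegral_indicator measurableSet_Ioc,
    ← lintegral_sub_left_eq_self _ (1 : ℝ)]
  refine lintegral_congr fun x => ?_
  by_cases h : x ∈ Ioc 0 (1 - r)
  · rw [indicator_of_mem h, indicator_of_mem
      (show 1 - x ∈ Ico r 1 from ⟨by linarith [h.2], by linarith [h.1]⟩)]
    simp
  · rw [indicator_of_notMem h, indicator_of_notMem]
    exact fun h2 => h ⟨by linarith [h2.2], by linarith [h2.1]⟩

lemma lintegral_Ioc_rpow {b a : ℝ} (hb : 0 < b) (ha : 0 ≤ a) :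
    ∫⁻ x in Ioc 0 a, ENNReal.ofReal (x ^ (b - 1)) = ENNReal.ofReal (a ^ b / b) := by
  have h1 : IntervalIntegrable (fun x : ℝ => x ^ (b - 1)) volume 0 a :=
    intervalIntegral.intervalIntegrable_rpow' (by linarith)
  rw [← ofReal_integral_eq_lintegral_ofReal
    ((intervalIntegrable_iff_integrableOn_Ioc_of_le ha).1 h1),
    ← intervalIntegral.integral_of_le ha, integral_rpow (Or.inl (by linarith))]
  · simp [Real.zero_rpow hb.ne']
  · exact (ae_restrict_iff' measurableSet_Ioc).2
      (Filter.Eventually.of_forall fun x hx => Real.rpow_nonneg hx.1.le _)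

lemma lintegral_Ioi_rpow {b a : ℝ} (hb : 0 < b) (ha : 0 < a) :
    ∫⁻ x in Ioi a, ENNReal.ofReal (x ^ (-b - 1)) = ENNReal.ofReal (a ^ (-b) / b) := by
  rw [← ofReal_integral_eq_lintegral_ofReal
    (integrableOn_Ioi_rpow_of_lt (by linarith) ha), integral_Ioi_rpow_of_lt (by linarith) ha]
  · congr 1; rw [sub_add_cancel]; field_simp
  · exact (ae_restrict_iff' measurableSet_Ioi).2
      (Filter.Eventually.of_forall fun x hx => Real.rpow_nonneg (ha.trans hx).le _)

/-- The integral of `max d y ^ (-A) * y ^ (b - 1)`, split at `y = d`. -/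
lemma lintegral_max_rpow_le {A b d : ℝ} (hb : 0 < b) (hA : b < A) (hd : 0 < d) :
    ∫⁻ x in Ioi (0 : ℝ), ENNReal.ofReal (max d x ^ (-A) * x ^ (b - 1))
      ≤ ENNReal.ofReal (1 / b + 1 / (A - b)) * ENNReal.ofReal (d ^ (b - A)) := by
  rw [← Ioc_union_Ioi_eq_Ioi hd.le]
  refine (lintegral_union_le _ _ _).trans ?_
  have h1 : ∫⁻ x in Ioc 0 d, ENNReal.ofReal (max d x ^ (-A) * x ^ (b - 1))
      = ENNReal.ofReal (1 / b * d ^ (b - A)) := by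
    rw [setLIntegral_congr_fun (g := fun x => ENNReal.ofReal (d ^ (-A)) *
      ENNReal.ofReal (x ^ (b - 1))) measurableSet_Ioc, lintegral_const_mul' _ _ (by simp),
      lintegral_Ioc_rpow hb hd.le, ← ENNReal.ofReal_mul (by positivity)]
    · congr 1
      rw [show b - A = -A + b by ring, Real.rpow_add hd]; ring
    · intro x hx
      simp only
      rw [max_eq_left hx.2, ENNReal.ofReal_mul (by positivity)]
  have h2 : ∫⁻ x in Ioi d, ENNReal.ofReal (max d x ^ (-A) * x ^ (b - 1))
      = ENNReal.ofReal (1 / (A - b) * d ^ (b - A)) := by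
    rw [setLIntegral_congr_fun (g := fun x => ENNReal.ofReal (x ^ (-(A - b) - 1)))
      measurableSet_Ioi, lintegral_Ioi_rpow (by linarith) hd]
    · congr 1
      rw [neg_sub]; ring
    · intro x hx
      have hx' : d < x := hx
      simp only
      rw [max_eq_right hx'.le, ← Real.rpow_add (hd.trans hx')]
      ring_nf
  have h3 : 0 < A - b := by linarith
  rw [h1, h2, ← ENNReal.ofReal_add (by positivity) (by positivity), ← add_mul,
    ENNReal.ofReal_mul (by positivity)]

lemma lintegral_Ico_max_rpow_le {A b d : ℝ} (hb : 0 < b) (hA : b < A) (hd : 0 < d) :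
    ∫⁻ R in Ico (0 : ℝ) 1, ENNReal.ofReal (max d (1 - R) ^ (-A) * (1 - R) ^ (b - 1))
      ≤ ENNReal.ofReal (1 / b + 1 / (A - b)) * ENNReal.ofReal (d ^ (b - A)) := by
  rw [lintegral_Ico_one_sub (fun x => ENNReal.ofReal (max d x ^ (-A) * x ^ (b - 1)))]
  exact (lintegral_mono_set fun x hx => hx.1).trans (lintegral_max_rpow_le hb hA hd)

lemma lintegral_one_sub_mul_rpow_le {A b r : ℝ} (hb : 0 < b) (hA : b < A) (hr : r ∈ Ico (0 : ℝ) 1) :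
    ∫⁻ R in Ico (0 : ℝ) 1, ENNReal.ofReal ((1 - r * R) ^ (-A)) * ENNReal.ofReal ((1 - R) ^ (b - 1))
      ≤ ENNReal.ofReal (1 / b + 1 / (A - b)) * ENNReal.ofReal ((1 - r) ^ (b - A)) := by
  refine le_trans (setLIntegral_mono' measurableSet_Ico fun R hR => ?_)
    (lintegral_Ico_max_rpow_le hb hA (by linarith [hr.2] : 0 < 1 - r))
  have h1 : 0 < max (1 - r) (1 - R) := lt_max_of_lt_left (by linarith [hr.2])
  have h2 : max (1 - r) (1 - R) ≤ 1 - r * R :=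
    max_le (by nlinarith [hr.1, hr.2, hR.1, hR.2]) (by nlinarith [hr.1, hr.2, hR.1, hR.2])
  have h3 : 0 ≤ 1 - R := by linarith [hR.2]
  rw [← ENNReal.ofReal_mul (Real.rpow_nonneg (h1.le.trans h2) _)]
  refine ENNReal.ofReal_le_ofReal ?_
  gcongr ?_ * _
  exact Real.rpow_le_rpow_of_nonpos h1 h2 (by linarith)

/-- The basic weight estimate: `∫ (1 - rR) ^ (-A) (1 - R) ^ (b - 1) dR ≲ (1 - r) ^ (b - A)`
for `A > b > 0`. -/
lemma lintegral_weight_mul_le {n : ℕ} {A b : ℝ} (hb : 0 < b) (hA : b < A) {r : Fin n → ℝ}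
    (hr : r ∈ cube n) :
    ∫⁻ R in cube n, weight (-A) (r * R) * weight (b - 1) R
      ≤ ENNReal.ofReal (1 / b + 1 / (A - b)) ^ n * weight (b - A) r := by
  have h := lintegral_cube_prod (fun i x => ENNReal.ofReal ((1 - r i * x) ^ (-A))
    * ENNReal.ofReal ((1 - x) ^ (b - 1))) (fun i => by fun_prop)
  rw [setLIntegral_congr_fun (measurableSet_cube n), h, weight_eq_prod hr]
  · refine (Finset.prod_le_prod' fun i _ => lintegral_one_sub_mul_rpow_le hb hA (hr i)).trans ?_
    rw [Finset.prod_mul_distrib]; simp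
  · intro R hR
    simp only
    rw [weight_eq_prod (mul_mem_cube hr hR), weight_eq_prod hR, ← Finset.prod_mul_distrib]
    rfl

/-- The case `A = 2` of `exists_lintegral_norm_rpow_le`, by the mass of the Poisson kernel. -/
lemma lintegral_norm_sq_le {x : ℝ} (h0 : 0 ≤ x) (h1 : x < 1) :
    ∫⁻ θ, ENNReal.ofReal (‖1 - x * circlePoint θ‖ ^ (-2 : ℝ)) ∂haarAddCircle
      ≤ ENNReal.ofReal ((1 - x) ^ (-1 : ℝ)) := by
  have h2 := (isProbabilityMeasure_circleMeasure h0).measure_univ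
  have h3 : circleMeasure x univ = ∫⁻ θ, ENNReal.ofReal (circleKernel x θ) ∂haarAddCircle := by
    simpa using lintegral_circleMeasure h1 (fun _ => 1) measurable_const
  have h4 : 0 < 1 - x := by linarith
  calc ∫⁻ θ, ENNReal.ofReal (‖1 - x * circlePoint θ‖ ^ (-2 : ℝ)) ∂haarAddCircle
      ≤ ∫⁻ θ, ENNReal.ofReal ((1 - x) ^ (-1 : ℝ)) * ENNReal.ofReal (circleKernel x θ)
          ∂haarAddCircle := by
        refine lintegral_mono fun θ => ?_
        rw [← ENNReal.ofReal_mul (by positivity)]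
        refine ENNReal.ofReal_le_ofReal ?_
        rw [Real.rpow_neg_one, Real.rpow_neg (norm_nonneg _), Real.rpow_two, circleKernel,
          div_eq_mul_inv, ← mul_assoc]
        refine le_mul_of_one_le_left (by positivity) ?_
        rw [show 1 - x ^ 2 = (1 - x) * (1 + x) by ring, ← mul_assoc, inv_mul_cancel₀ h4.ne']
        linarith
    _ = _ := by
      rw [lintegral_const_mul' _ _ (by simp), ← h3, h2, mul_one]

/-- The integral means of `(1 - z) ^ (-A)`, `A > 1`. -/
lemma exists_lintegral_norm_rpow_le {A : ℝ} (hA : 1 < A) :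
    ∃ C : ℝ≥0∞, C ≠ ∞ ∧ ∀ x ∈ Ico (0 : ℝ) 1,
      ∫⁻ θ, ENNReal.ofReal (‖1 - x * circlePoint θ‖ ^ (-A)) ∂haarAddCircle
        ≤ C * ENNReal.ofReal ((1 - x) ^ (1 - A)) := by
  rcases le_or_gt 2 A with h2 | h2
  · refine ⟨1, by simp, fun x hx => ?_⟩
    have h4 : 0 < 1 - x := by linarith [hx.2]
    calc ∫⁻ θ, ENNReal.ofReal (‖1 - x * circlePoint θ‖ ^ (-A)) ∂haarAddCircle
        ≤ ∫⁻ θ, ENNReal.ofReal ((1 - x) ^ (2 - A)) *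
            ENNReal.ofReal (‖1 - x * circlePoint θ‖ ^ (-2 : ℝ)) ∂haarAddCircle := by
          refine lintegral_mono fun θ => ?_
          rw [← ENNReal.ofReal_mul (by positivity)]
          refine ENNReal.ofReal_le_ofReal ?_
          have h5 := one_sub_le_norm hx.1 θ
          have h6 : 0 < ‖1 - x * circlePoint θ‖ := by linarith
          rw [show -A = (2 - A) + (-2) by ring, Real.rpow_add h6]
          gcongr ?_ * _
          exact Real.rpow_le_rpow_of_nonpos h4 h5 (by linarith)
      _ ≤ ENNReal.ofReal ((1 - x) ^ (2 - A)) * ENNReal.ofReal ((1 - x) ^ (-1 : ℝ)) := by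
          rw [lintegral_const_mul' _ _ (by simp)]
          gcongr
          exact lintegral_norm_sq_le hx.1 hx.2
      _ = _ := by
          rw [← ENNReal.ofReal_mul (by positivity), ← Real.rpow_add h4, one_mul]
          ring_nf
  · -- the case `1 < A < 2` follows from `A = 2`, since `|1 - z| ^ (-A)` is dominated by
    -- `∫ |1 - Rz| ^ (-2) (1 - R) ^ (1 - A) dR`
    set b := 2 - A with hb
    have hb0 : 0 < b := by linarith
    set c : ℝ := 4 * b * 2 ^ b with hc
    have hc0 : 0 < c := by positivity
    refine ⟨ENNReal.ofReal c * ENNReal.ofReal (1 / b + 1 / (1 - b)), by finiteness, fun x hx => ?_⟩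
    have key : ∀ θ, ENNReal.ofReal (‖1 - x * circlePoint θ‖ ^ (-A)) ≤
        ENNReal.ofReal c * ∫⁻ R in Ico (0 : ℝ) 1, ENNReal.ofReal ((1 - R) ^ (b - 1)) *
          ENNReal.ofReal (‖1 - (x * R : ℝ) * circlePoint θ‖ ^ (-2 : ℝ)) := by
      intro θ
      set d := ‖1 - x * circlePoint θ‖ with hd
      have hd0 : 0 < d := by
        have := one_sub_le_norm hx.1 θ
        linarith [hx.2]
      have hd2 : d ≤ 2 := by
        refine (norm_sub_le _ _).trans ?_
        simp only [norm_one, norm_mul, Complex.norm_real, norm_circlePoint, Real.norm_eq_abs,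
          abs_of_nonneg hx.1]
        linarith [hx.2]
      have h5 : ∀ R ∈ Ico (1 - d / 2) 1, ENNReal.ofReal ((2 * d) ^ (-2 : ℝ)) *
          ENNReal.ofReal ((1 - R) ^ (b - 1)) ≤ ENNReal.ofReal ((1 - R) ^ (b - 1)) *
          ENNReal.ofReal (‖1 - (x * R : ℝ) * circlePoint θ‖ ^ (-2 : ℝ)) := by
        intro R hR
        rw [mul_comm]
        have hR0 : 0 ≤ R := by linarith [hR.1]
        have h6 : ‖1 - (x * R : ℝ) * circlePoint θ‖ ≤ 2 * d := by
          have h7 : 1 - (x * R : ℝ) * circlePoint θ = (1 - x * circlePoint θ)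
              + ((x * (1 - R) : ℝ) : ℂ) * circlePoint θ := by push_cast; ring
          rw [h7]
          refine (norm_add_le _ _).trans ?_
          rw [norm_mul, Complex.norm_real, norm_circlePoint, mul_one, Real.norm_eq_abs,
            abs_of_nonneg (mul_nonneg hx.1 (by linarith [hR.2]))]
          nlinarith [hx.1, hx.2, hR.1, hR.2]
        have h8 : 0 < ‖1 - (x * R : ℝ) * circlePoint θ‖ := by
          have := one_sub_le_norm (mul_nonneg hx.1 hR0) θ
          nlinarith [hx.1, hx.2, hR.1, hR.2]
        gcongr _ * ENNReal.ofReal ?_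
        exact Real.rpow_le_rpow_of_nonpos h8 h6 (by norm_num)
      have h6 : Ico (1 - d / 2) 1 ⊆ Ico 0 1 := Ico_subset_Ico_left (by linarith)
      have h7 := (setLIntegral_mono' (μ := volume) measurableSet_Ico h5).trans
        (lintegral_mono_set h6)
      rw [lintegral_const_mul' _ _ (by simp),
        lintegral_Ico_one_sub (fun y => ENNReal.ofReal (y ^ (b - 1))), sub_sub_cancel,
        lintegral_Ioc_rpow hb0 (by positivity), ← ENNReal.ofReal_mul (by positivity)] at h7
      refine le_trans (le_of_eq ?_) (mul_le_mul' le_rfl h7)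
      rw [← ENNReal.ofReal_mul hc0.le]
      congr 1
      rw [Real.mul_rpow (by norm_num) hd0.le, Real.div_rpow hd0.le (by norm_num), hc,
        show -A = -2 + b by rw [hb]; ring, Real.rpow_add hd0]
      have : (2 : ℝ) ^ (-2 : ℝ) = 1 / 4 := by
        rw [Real.rpow_neg (by norm_num), Real.rpow_two]; norm_num
      rw [this]
      have h2b : (2 : ℝ) ^ b ≠ 0 := by positivity
      field_simp
    have hmeas : Measurable fun a : UnitAddCircle × ℝ => ENNReal.ofReal ((1 - a.2) ^ (b - 1)) *
          ENNReal.ofReal (‖1 - (x * a.2 : ℝ) * circlePoint a.1‖ ^ (-2 : ℝ)) := by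
      have := continuous_circlePoint.measurable
      fun_prop
    calc ∫⁻ θ, ENNReal.ofReal (‖1 - x * circlePoint θ‖ ^ (-A)) ∂haarAddCircle
        ≤ ENNReal.ofReal c * ∫⁻ θ, ∫⁻ R in Ico (0 : ℝ) 1, ENNReal.ofReal ((1 - R) ^ (b - 1)) *
          ENNReal.ofReal (‖1 - (x * R : ℝ) * circlePoint θ‖ ^ (-2 : ℝ)) ∂volume ∂haarAddCircle := by
          rw [← lintegral_const_mul' _ _ (by simp)]
          exact lintegral_mono key
      _ = ENNReal.ofReal c * ∫⁻ R in Ico (0 : ℝ) 1, ENNReal.ofReal ((1 - R) ^ (b - 1)) *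
          ∫⁻ θ, ENNReal.ofReal (‖1 - (x * R : ℝ) * circlePoint θ‖ ^ (-2 : ℝ)) ∂haarAddCircle := by
          rw [lintegral_lintegral_swap hmeas.aemeasurable]
          simp_rw [lintegral_const_mul' _ _ ENNReal.ofReal_ne_top]
      _ ≤ ENNReal.ofReal c * ∫⁻ R in Ico (0 : ℝ) 1, ENNReal.ofReal ((1 - x * R) ^ (-1 : ℝ)) *
            ENNReal.ofReal ((1 - R) ^ (b - 1)) := by
          refine mul_le_mul' le_rfl (setLIntegral_mono' measurableSet_Ico fun R hR => ?_)
          rw [mul_comm (ENNReal.ofReal ((1 - x * R) ^ (-1 : ℝ)))]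
          gcongr
          exact lintegral_norm_sq_le (mul_nonneg hx.1 hR.1)
            (by nlinarith [hx.1, hx.2, hR.1, hR.2])
      _ ≤ ENNReal.ofReal c * (ENNReal.ofReal (1 / b + 1 / (1 - b)) *
            ENNReal.ofReal ((1 - x) ^ (b - 1))) := by
          gcongr
          exact lintegral_one_sub_mul_rpow_le hb0 (by linarith) hx
      _ = _ := by rw [mul_assoc, show b - 1 = 1 - A by rw [hb]; ring]

/-- The radial integrals of `|1 - z| ^ (-B)`, `B > b > 0`. -/
lemma lintegral_radial_norm_rpow_le {B b x : ℝ} (hb : 0 < b) (hB : b < B) (hx : x ∈ Ico (0 : ℝ) 1)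
    (θ : UnitAddCircle) :
    ∫⁻ R in Ico (0 : ℝ) 1, ENNReal.ofReal (‖1 - (x * R : ℝ) * circlePoint θ‖ ^ (-B)) *
        ENNReal.ofReal ((1 - R) ^ (b - 1))
      ≤ ENNReal.ofReal (1 / b + 1 / (B - b)) *
        ENNReal.ofReal ((‖1 - x * circlePoint θ‖ / 2) ^ (b - B)) := by
  have hd0 : 0 < ‖1 - x * circlePoint θ‖ := by
    have := one_sub_le_norm hx.1 θ
    linarith [hx.2]
  refine le_trans (setLIntegral_mono' measurableSet_Ico fun R hR => ?_)
    (lintegral_Ico_max_rpow_le hb hB (by positivity : 0 < ‖1 - x * circlePoint θ‖ / 2))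
  have h1 : 0 < max (‖1 - x * circlePoint θ‖ / 2) (1 - R) := lt_max_of_lt_left (by positivity)
  have h4 : 1 - x * R ≤ ‖1 - (x * R : ℝ) * circlePoint θ‖ :=
    one_sub_le_norm (mul_nonneg hx.1 hR.1) θ
  have h3 : 0 ≤ 1 - R := by linarith [hR.2]
  have h5 : 1 - R ≤ ‖1 - (x * R : ℝ) * circlePoint θ‖ := by nlinarith [hx.1, hx.2, hR.1, hR.2]
  have h6 : ‖1 - x * circlePoint θ‖ ≤ ‖1 - (x * R : ℝ) * circlePoint θ‖ + (1 - R) := by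
    have h7 : 1 - x * circlePoint θ = (1 - (x * R : ℝ) * circlePoint θ)
        - ((x * (1 - R) : ℝ) : ℂ) * circlePoint θ := by push_cast; ring
    rw [h7]
    refine (norm_sub_le _ _).trans ?_
    rw [norm_mul, Complex.norm_real, norm_circlePoint, mul_one, Real.norm_eq_abs,
      abs_of_nonneg (mul_nonneg hx.1 h3)]
    nlinarith [hx.1, hx.2, hR.1, hR.2]
  have h2 : max (‖1 - x * circlePoint θ‖ / 2) (1 - R) ≤ ‖1 - (x * R : ℝ) * circlePoint θ‖ :=
    max_le (by linarith) h5
  rw [← ENNReal.ofReal_mul (by positivity)]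
  refine ENNReal.ofReal_le_ofReal ?_
  gcongr ?_ * _
  exact Real.rpow_le_rpow_of_nonpos h1 h2 (by linarith)

variable {n : ℕ}

/-! ### Embeddings of the mixed-norm spaces -/

lemma measurable_enorm_comp_rpow {f : (Fin n → ℂ) → ℂ} (hf : Measurable f) (p : ℝ) :
    Measurable fun a : (Fin n → ℝ) × UnitAddTorus (Fin n) => ‖f (torusPoint a.1 a.2)‖ₑ ^ p :=
  (hf.comp continuous_torusPoint.measurable).enorm.pow_const p

lemma measurable_powMean {f : (Fin n → ℂ) → ℂ} (hf : Measurable f) (p : ℝ) :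
    Measurable (powMean p f) :=
  (measurable_enorm_comp_rpow hf p).lintegral_prod_right'

lemma measurable_intMean {f : (Fin n → ℂ) → ℂ} (hf : Measurable f) (p : ℝ) :
    Measurable (intMean p f) :=
  (measurable_powMean hf p).pow_const _

lemma intMean_mono {f : (Fin n → ℂ) → ℂ} (hf : f ∈ Hol n) {p : ℝ} (hp : 0 < p) {r R : Fin n → ℝ}
    (hr : r ∈ cube n) (hR : R ∈ cube n) (hrR : r ≤ R) : intMean p f r ≤ intMean p f R :=
  ENNReal.rpow_le_rpow (powMean_mono hf hp hr hR hrR) (by positivity)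

lemma mem_cube_of_mem_Icc_halfway {R ρ : Fin n → ℝ} (hR : R ∈ cube n) (hρ : ρ ∈ Icc R (halfway R)) :
    ρ ∈ cube n := fun i =>
  ⟨(hR i).1.trans (hρ.1 i), (hρ.2 i).trans_lt (halfway_mem hR i).2⟩

lemma weight_le_of_mem_Icc_halfway {R ρ : Fin n → ℝ} (hR : R ∈ cube n)
    (hρ : ρ ∈ Icc R (halfway R)) (γ : ℝ) :
    weight γ R ≤ ENNReal.ofReal ((4 ^ |γ|) ^ n) * weight γ ρ := by
  refine weight_le_of_comparable hR (mem_cube_of_mem_Icc_halfway hR hρ) (fun i => ?_)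
    (fun i => ?_) γ
  · have h1 := hρ.2 i
    have h2 := (hR i).2
    simp only [halfway] at h1
    linarith
  · have h1 := hρ.1 i
    have h2 := (hR i).2
    linarith

lemma volume_Icc_halfway {R : Fin n → ℝ} (hR : R ∈ cube n) :
    volume (Icc R (halfway R)) = ENNReal.ofReal (1 / 2) ^ n * weight 1 R := by
  rw [Real.volume_Icc_pi, weight_eq_prod hR]
  have : ∀ i, ENNReal.ofReal (halfway R i - R i)
      = ENNReal.ofReal (1 / 2) * ENNReal.ofReal ((1 - R i) ^ (1 : ℝ)) := fun i => by
    rw [← ENNReal.ofReal_mul (by norm_num)]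
    congr 1
    simp only [halfway, Real.rpow_one]; ring
  simp_rw [this]
  rw [Finset.prod_mul_distrib]; simp

/-- For functions that do not decrease too fast towards the distinguished boundary, an exponent
`θ ≤ 1` can be moved inside the integral, at the cost of the weight `(1 - R) ^ (θ - 1)`. This
replaces the embedding `ℓ^θ ⊆ ℓ^1` of a dyadic decomposition. -/
lemma lintegral_rpow_le_of_quasi_mono (n : ℕ) {K : ℝ≥0∞} (hK : K ≠ ∞) {θ : ℝ} (hθ : 0 < θ)
    (hθ1 : θ ≤ 1) : ∃ C : ℝ≥0∞, C ≠ ∞ ∧ ∀ Φ : (Fin n → ℝ) → ℝ≥0∞, Measurable Φ →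
      (∀ R ∈ cube n, ∀ ρ ∈ Icc R (halfway R), Φ R ≤ K * Φ ρ) →
      (∫⁻ R in cube n, Φ R) ^ θ ≤ C * ∫⁻ R in cube n, Φ R ^ θ * weight (θ - 1) R := by
  set c := ENNReal.ofReal ((4 ^ |θ - 1|) ^ n) with hc
  set D : ℝ≥0∞ := 2 ^ n * K ^ θ * c with hD
  have hDtop : D ≠ ∞ := by
    have : K ^ θ ≠ ∞ := ENNReal.rpow_ne_top_of_nonneg hθ.le hK
    finiteness
  refine ⟨D ^ (1 - θ), ENNReal.rpow_ne_top_of_nonneg (by linarith) hDtop, fun Φ hΦ h => ?_⟩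
  set J := ∫⁻ R in cube n, Φ R ^ θ * weight (θ - 1) R with hJ
  have hG : Measurable fun R => Φ R ^ θ * weight (θ - 1) R :=
    (hΦ.pow_const _).mul (measurable_weight _)
  -- the box between `R` and `halfway R` has volume `2 ^ (-n) (1 - R)`, and on it the integrand of
  -- `J` is not much smaller than at `R`; hence a pointwise bound of `Φ` by `J`
  have h1 : ∀ R ∈ cube n, Φ R ^ θ * weight θ R ≤ D * J := by
    intro R hR
    have h2 : ∫⁻ ρ in Icc R (halfway R), Φ R ^ θ * weight (θ - 1) R
        ≤ ∫⁻ ρ in Icc R (halfway R), (K ^ θ * c) * (Φ ρ ^ θ * weight (θ - 1) ρ) := by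
      refine setLIntegral_mono' measurableSet_Icc fun ρ hρ => ?_
      calc Φ R ^ θ * weight (θ - 1) R ≤ (K * Φ ρ) ^ θ * (c * weight (θ - 1) ρ) := by
            gcongr
            · exact h R hR ρ hρ
            · exact weight_le_of_mem_Icc_halfway hR hρ _
        _ = _ := by rw [ENNReal.mul_rpow_of_nonneg _ _ hθ.le]; ring
    rw [setLIntegral_const, volume_Icc_halfway hR] at h2
    have h3 : ∫⁻ ρ in Icc R (halfway R), (K ^ θ * c) * (Φ ρ ^ θ * weight (θ - 1) ρ)
        ≤ (K ^ θ * c) * J := by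
      rw [lintegral_const_mul _ hG]
      refine mul_le_mul' le_rfl (lintegral_mono_set ?_)
      exact fun ρ hρ => mem_cube_of_mem_Icc_halfway hR hρ
    have h4 : (2 : ℝ≥0∞) ^ n * ENNReal.ofReal (1 / 2) ^ n = 1 := by
      rw [← mul_pow, show (2 : ℝ≥0∞) = ENNReal.ofReal 2 by simp, ← ENNReal.ofReal_mul (by norm_num)]
      norm_num
    calc Φ R ^ θ * weight θ R
        = (2 ^ n * ENNReal.ofReal (1 / 2) ^ n) * (Φ R ^ θ * (weight (θ - 1) R * weight 1 R)) := by
          rw [h4, one_mul, weight_mul hR, sub_add_cancel]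
      _ = 2 ^ n * (Φ R ^ θ * weight (θ - 1) R * (ENNReal.ofReal (1 / 2) ^ n * weight 1 R)) := by
          ring
      _ ≤ 2 ^ n * (K ^ θ * c * J) := mul_le_mul' le_rfl (h2.trans h3)
      _ = D * J := by rw [hD]; ring
  -- write `Φ = Φ ^ θ Φ ^ (1 - θ)` and use the pointwise bound for the second factor
  have h5 : ∫⁻ R in cube n, Φ R ≤ (D * J) ^ ((1 - θ) / θ) * J := by
    refine le_trans ?_ (lintegral_const_mul _ hG).le
    refine setLIntegral_mono' (measurableSet_cube n) fun R hR => ?_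
    calc Φ R = Φ R ^ θ * Φ R ^ (1 - θ) := by
          rw [← ENNReal.rpow_add_of_nonneg _ _ hθ.le (by linarith)]; simp
      _ = Φ R ^ θ * ((Φ R ^ θ * weight θ R) ^ ((1 - θ) / θ) * weight (θ - 1) R) := by
          congr 1
          rw [ENNReal.mul_rpow_of_nonneg _ _ (div_nonneg (by linarith) hθ.le), ← ENNReal.rpow_mul,
            weight_rpow hR, mul_assoc, weight_mul hR, mul_div_cancel₀ _ hθ.ne']
          simp
      _ ≤ Φ R ^ θ * ((D * J) ^ ((1 - θ) / θ) * weight (θ - 1) R) := by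
          refine mul_le_mul' le_rfl (mul_le_mul' ?_ le_rfl)
          exact ENNReal.rpow_le_rpow (h1 R hR) (div_nonneg (by linarith) hθ.le)
      _ = _ := by ring
  calc (∫⁻ R in cube n, Φ R) ^ θ ≤ ((D * J) ^ ((1 - θ) / θ) * J) ^ θ := by gcongr
    _ = D ^ (1 - θ) * J := by
      rw [ENNReal.mul_rpow_of_nonneg _ _ hθ.le, ← ENNReal.rpow_mul, div_mul_cancel₀ _ hθ.ne',
        ENNReal.mul_rpow_of_nonneg _ _ (by linarith), mul_assoc,
        ← ENNReal.rpow_add_of_nonneg _ _ (by linarith) hθ.le]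
      simp

/-- The change of variables `R ↦ halfway R`, of Jacobian `2 ^ (-n)`. -/
lemma lintegral_cube_halfway_le {Ψ : (Fin n → ℝ) → ℝ≥0∞} (hΨ : Measurable Ψ) :
    ∫⁻ R in cube n, Ψ (halfway R) ≤ 2 ^ n * ∫⁻ R in cube n, Ψ R := by
  set μ := (volume : Measure ℝ).restrict (Ico 0 1) with hμ
  have hm : Measurable fun x : ℝ => (1 + x) / 2 := by fun_prop
  have h1 : μ.map (fun x => (1 + x) / 2) ≤ (2 : ℝ≥0∞) • μ := by
    refine Measure.le_iff.2 fun s hs => ?_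
    rw [Measure.map_apply hm hs, hμ, Measure.restrict_apply (hm hs), Measure.smul_apply,
      Measure.restrict_apply hs, smul_eq_mul]
    have h2 : (fun x : ℝ => (1 + x) / 2) ⁻¹' s ∩ Ico 0 1 ⊆
        (fun x : ℝ => x * (1 / 2)) ⁻¹' ((fun x => x + 1 / 2) ⁻¹' (s ∩ Ico 0 1)) := by
      rintro x ⟨hx, hx0, hx1⟩
      have h3 : x * (1 / 2) + 1 / 2 = (1 + x) / 2 := by ring
      refine ⟨by simp only [h3]; exact hx, ?_, ?_⟩ <;> simp only <;> linarith
    refine (measure_mono h2).trans (le_of_eq ?_)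
    rw [Real.volume_preimage_mul_right (by norm_num), measure_preimage_add_right]
    norm_num
  have h4 : Measure.map halfway (volume.restrict (cube n)) ≤
      (2 : ℝ≥0∞) ^ n • volume.restrict (cube n) := by
    have h5 : (halfway : (Fin n → ℝ) → Fin n → ℝ) = fun R i => (fun x => (1 + x) / 2) (R i) := rfl
    have : ∀ i : Fin n, SigmaFinite (μ.map fun x : ℝ => (1 + x) / 2) := fun _ => inferInstance
    rw [volume_restrict_cube, h5, Measure.pi_map_pi (fun _ => hm.aemeasurable)]
    refine (pi_le_smul_pi (fun _ => 2) (by simp) _ (fun _ => μ) fun _ => h1).trans ?_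
    simp [hμ]
  rw [← lintegral_map hΨ (by unfold halfway; fun_prop)]
  refine (lintegral_mono' h4 le_rfl).trans ?_
  rw [lintegral_smul_measure, smul_eq_mul]

/-- The growth of integral means: `M_t(f, R) ≲ (1 - R) ^ (1/t - 1/p) M_p(f, (1 + R) / 2)` for
`p ≤ t`, since `‖f‖ ^ t = ‖f‖ ^ (t - p) ‖f‖ ^ p` and the first factor is bounded pointwise. -/
lemma intMean_le_intMean_halfway {f : (Fin n → ℂ) → ℂ} (hf : f ∈ Hol n) {p t : ℝ} (hp : 0 < p)
    (hpt : p ≤ t) {R : Fin n → ℝ} (hR : R ∈ cube n) :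
    intMean t f R ≤ ENNReal.ofReal (4 ^ n) ^ (1 / p - 1 / t) * weight (1 / t - 1 / p) R *
      intMean p f (halfway R) := by
  have ht : 0 < t := hp.trans_le hpt
  set P := powMean p f (halfway R) with hP
  have hK : ∀ θ, ‖f (torusPoint R θ)‖ₑ ^ p ≤ ENNReal.ofReal (4 ^ n) * weight (-1) R * P := by
    intro θ
    refine (enorm_rpow_le_powMean hf hp hR θ).trans (le_of_eq ?_)
    rw [weight, ← ENNReal.ofReal_mul (by positivity)]
    congr 2
    simp [div_eq_mul_inv, Finset.prod_mul_distrib, Real.rpow_neg_one]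
  set Q := ENNReal.ofReal (4 ^ n) * weight (-1) R * P with hQ
  have h0 : 0 ≤ (t - p) / p := div_nonneg (by linarith) hp.le
  have h1 : powMean t f R ≤ Q ^ ((t - p) / p) * P := by
    calc powMean t f R ≤ ∫⁻ θ, Q ^ ((t - p) / p) * ‖f (torusPoint R θ)‖ₑ ^ p ∂torusMeasure n := by
          refine lintegral_mono fun θ => ?_
          calc ‖f (torusPoint R θ)‖ₑ ^ t
              = (‖f (torusPoint R θ)‖ₑ ^ p) ^ ((t - p) / p) * ‖f (torusPoint R θ)‖ₑ ^ p := by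
                rw [← ENNReal.rpow_mul, mul_div_cancel₀ _ hp.ne',
                  ← ENNReal.rpow_add_of_nonneg _ _ (by linarith) hp.le, sub_add_cancel]
            _ ≤ _ := by gcongr; exact hK θ
      _ = Q ^ ((t - p) / p) * powMean p f R := by
          rw [lintegral_const_mul _ (measurable_enorm_comp_torusPoint_rpow hf hR p)]; rfl
      _ ≤ _ := by
          gcongr
          exact powMean_mono hf hp hR (halfway_mem hR) (le_halfway hR)
  calc intMean t f R ≤ (Q ^ ((t - p) / p) * P) ^ (1 / t) := by
        rw [intMean_eq]; gcongr
    _ = _ := by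
      have h2 : (t - p) / p * (1 / t) = 1 / p - 1 / t := by field_simp
      have h3 : 0 ≤ 1 / p - 1 / t := by rw [← h2]; positivity
      rw [ENNReal.mul_rpow_of_nonneg _ _ (by positivity), ← ENNReal.rpow_mul, h2, hQ,
        ENNReal.mul_rpow_of_nonneg _ _ h3, ENNReal.mul_rpow_of_nonneg _ _ h3, weight_rpow hR,
        mul_assoc, ← ENNReal.rpow_add_of_nonneg _ _ h3 (by positivity), sub_add_cancel,
        intMean_eq]
      congr 3
      ring

/-- The integral defining the mixed-norm space `A^{p,q}_α`. -/
noncomputable def mixedIntegral (p q α : ℝ) (f : (Fin n → ℂ) → ℂ) : ℝ≥0∞ :=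
  ∫⁻ R in cube n, intMean p f R ^ q * weight (α * q - 1) R

/-- The embedding `A^{p,q}_α ⊆ A^{t,s}_{α + 1/p - 1/t}` for `p ≤ t`, `q ≤ s`. The first index is
raised by `intMean_le_intMean_halfway`, the second by `lintegral_rpow_le_of_quasi_mono`. -/
lemma mixedIntegral_le (n : ℕ) {p q t s : ℝ} (α : ℝ) (hp : 0 < p) (hq : 0 < q) (hpt : p ≤ t)
    (hqs : q ≤ s) : ∃ C : ℝ≥0∞, C ≠ ∞ ∧ ∀ f ∈ Hol n, Measurable f →
      mixedIntegral t s (α + 1 / p - 1 / t) f ≤ C * mixedIntegral p q α f ^ (s / q) := by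
  have ht : 0 < t := hp.trans_le hpt
  have hs : 0 < s := hq.trans_le hqs
  set K := ENNReal.ofReal ((4 ^ |α * s - 1|) ^ n) with hK
  set E := (ENNReal.ofReal (4 ^ n) ^ (1 / p - 1 / t)) ^ s with hE
  have hpt' : 0 ≤ 1 / p - 1 / t := by
    rw [sub_nonneg]; exact one_div_le_one_div_of_le hp hpt
  have hEt : E ≠ ∞ := ENNReal.rpow_ne_top_of_nonneg hs.le
    (ENNReal.rpow_ne_top_of_nonneg hpt' ENNReal.ofReal_ne_top)
  obtain ⟨C, hC, h⟩ := lintegral_rpow_le_of_quasi_mono n (K := K) ENNReal.ofReal_ne_top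
    (θ := q / s) (by positivity) (by rw [div_le_one hs]; exact hqs)
  refine ⟨E * K * 2 ^ n * C ^ (s / q), ?_, fun f hf hfm => ?_⟩
  · have := ENNReal.rpow_ne_top_of_nonneg (show 0 ≤ s / q by positivity) hC
    finiteness
  set Φ : (Fin n → ℝ) → ℝ≥0∞ := fun R => intMean p f R ^ s * weight (α * s - 1) R with hΦ
  have hΦm : Measurable Φ := ((measurable_intMean hfm p).pow_const s).mul (measurable_weight _)
  have h1 := h Φ hΦm fun R hR ρ hρ => by
    calc Φ R ≤ intMean p f ρ ^ s * (K * weight (α * s - 1) ρ) := by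
          simp only [hΦ]
          gcongr
          · exact intMean_mono hf hp hR (mem_cube_of_mem_Icc_halfway hR hρ) hρ.1
          · exact weight_le_of_mem_Icc_halfway hR hρ _
      _ = _ := by simp only [hΦ]; ring
  have h2 : ∫⁻ R in cube n, Φ R ^ (q / s) * weight (q / s - 1) R = mixedIntegral p q α f := by
    refine setLIntegral_congr_fun (measurableSet_cube n) fun R hR => ?_
    simp only [hΦ]
    rw [ENNReal.mul_rpow_of_nonneg _ _ (by positivity), ← ENNReal.rpow_mul, weight_rpow hR,
      mul_assoc, weight_mul hR, mul_div_cancel₀ _ hs.ne']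
    congr 2
    field_simp; ring
  rw [h2] at h1
  have h3 : ∫⁻ R in cube n, Φ R ≤ C ^ (s / q) * mixedIntegral p q α f ^ (s / q) := by
    rw [← ENNReal.mul_rpow_of_nonneg _ _ (by positivity)]
    refine le_trans (le_of_eq ?_) (ENNReal.rpow_le_rpow h1 (show 0 ≤ s / q by positivity))
    rw [← ENNReal.rpow_mul, show q / s * (s / q) = 1 by field_simp, ENNReal.rpow_one]
  calc mixedIntegral t s (α + 1 / p - 1 / t) f
      ≤ ∫⁻ R in cube n, E * K * Φ (halfway R) := by
        refine setLIntegral_mono' (measurableSet_cube n) fun R hR => ?_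
        calc intMean t f R ^ s * weight ((α + 1 / p - 1 / t) * s - 1) R
            ≤ (ENNReal.ofReal (4 ^ n) ^ (1 / p - 1 / t) * weight (1 / t - 1 / p) R *
                intMean p f (halfway R)) ^ s * weight ((α + 1 / p - 1 / t) * s - 1) R := by
              gcongr; exact intMean_le_intMean_halfway hf hp hpt hR
          _ = E * (intMean p f (halfway R) ^ s * weight (α * s - 1) R) := by
              rw [ENNReal.mul_rpow_of_nonneg _ _ hs.le, ENNReal.mul_rpow_of_nonneg _ _ hs.le,
                weight_rpow hR, show α * s - 1 = (1 / t - 1 / p) * s +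
                  ((α + 1 / p - 1 / t) * s - 1) by ring, ← weight_mul hR]
              ring
          _ ≤ E * (intMean p f (halfway R) ^ s * (K * weight (α * s - 1) (halfway R))) := by
              gcongr
              exact weight_le_of_mem_Icc_halfway hR ⟨le_halfway hR, le_rfl⟩ _
          _ = _ := by simp only [hΦ]; ring
    _ = E * K * ∫⁻ R in cube n, Φ (halfway R) := by
        rw [lintegral_const_mul]
        exact hΦm.comp (by unfold halfway; fun_prop)
    _ ≤ E * K * (2 ^ n * ∫⁻ R in cube n, Φ R) := by gcongr; exact lintegral_cube_halfway_le hΦm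
    _ ≤ E * K * (2 ^ n * (C ^ (s / q) * mixedIntegral p q α f ^ (s / q))) := by gcongr
    _ = _ := by ring

/-! ### Embeddings of the Lizorkin–Triebel spaces -/

/-- Minkowski's integral inequality for the exponent `1 / θ ≥ 1` and the function `G ^ θ`. It
follows from Hölder's inequality applied to `G ^ θ = (G A ^ (θ - 1)) ^ θ (A ^ θ) ^ (1 - θ)`, where
`A` is the inner integral on the right. -/
lemma lintegral_rpow_lintegral_rpow_le {X Y : Type*} [MeasurableSpace X] [MeasurableSpace Y]
    {μ : Measure X} {ν : Measure Y} [SFinite μ] [SFinite ν] {G : X → Y → ℝ≥0∞}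
    (hG : Measurable (Function.uncurry G)) {θ : ℝ} (hθ : 0 < θ) (hθ1 : θ ≤ 1) :
    ∫⁻ y, (∫⁻ x, G x y ^ θ ∂μ) ^ (1 / θ) ∂ν ≤ (∫⁻ x, (∫⁻ y, G x y ∂ν) ^ θ ∂μ) ^ (1 / θ) := by
  set A : X → ℝ≥0∞ := fun x => ∫⁻ y, G x y ∂ν with hA
  have hAm : Measurable A := hG.lintegral_prod_right'
  have hGx : ∀ x, Measurable (G x) := fun x => hG.comp measurable_prodMk_left
  have hGy : ∀ y, Measurable fun x => G x y := fun y => hG.comp measurable_prodMk_right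
  set S := ∫⁻ x, A x ^ θ ∂μ with hS
  rcases eq_or_ne S ∞ with hS1 | hS1
  · simp [hS1, hθ]
  have hAtop : ∀ᵐ x ∂μ, A x ≠ ∞ := by
    filter_upwards [ae_lt_top (hAm.pow_const θ) hS1] with x hx h
    simp [h, hθ] at hx
  -- where `A = 0` the factor `A ^ (θ - 1)` is infinite for `θ < 1`; there `G` vanishes
  have hA0 : ∀ᵐ y ∂ν, ∀ᵐ x ∂μ, A x = 0 → G x y = 0 := by
    rw [← Measure.ae_ae_comm]
    · refine Filter.Eventually.of_forall fun x => ?_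
      by_cases h : A x = 0
      · filter_upwards [(lintegral_eq_zero_iff (hGx x)).1 h] with y hy _ using hy
      · exact Filter.Eventually.of_forall fun y h' => absurd h' h
    · have h1 : MeasurableSet {a : X × Y | A a.1 = 0} :=
        measurableSet_eq_fun (hAm.comp measurable_fst) measurable_const
      have h2 : MeasurableSet {a : X × Y | G a.1 a.2 = 0} :=
        measurableSet_eq_fun hG measurable_const
      exact h1.imp h2
  have h1 : ∀ᵐ y ∂ν, (∫⁻ x, G x y ^ θ ∂μ) ^ (1 / θ) ≤
      (∫⁻ x, G x y * A x ^ (θ - 1) ∂μ) * S ^ ((1 - θ) / θ) := by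
    filter_upwards [hA0] with y hy
    have h2 : ∫⁻ x, G x y ^ θ ∂μ ≤
        ∫⁻ x, (G x y * A x ^ (θ - 1)) ^ θ * (A x ^ θ) ^ (1 - θ) ∂μ := by
      refine lintegral_mono_ae ?_
      filter_upwards [hy, hAtop] with x hx hx'
      by_cases h : A x = 0
      · simp [hx h, hθ]
      · refine le_of_eq ?_
        rw [ENNReal.mul_rpow_of_nonneg _ _ hθ.le, mul_assoc, ← ENNReal.rpow_mul,
          ← ENNReal.rpow_mul, ← ENNReal.rpow_add _ _ h hx']
        ring_nf; simp
    have h3 := h2.trans (ENNReal.lintegral_mul_norm_pow_le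
      ((hGy y).mul (hAm.pow_const _)).aemeasurable (hAm.pow_const θ).aemeasurable hθ.le
      (sub_nonneg.2 hθ1) (by ring))
    refine (ENNReal.rpow_le_rpow h3 (by positivity : 0 ≤ 1 / θ)).trans (le_of_eq ?_)
    rw [ENNReal.mul_rpow_of_nonneg _ _ (by positivity), ← ENNReal.rpow_mul, ← ENNReal.rpow_mul,
      mul_one_div_cancel hθ.ne', ENNReal.rpow_one, mul_one_div]
    rfl
  refine (lintegral_mono_ae h1).trans ?_
  have hm : Measurable fun a : Y × X => G a.2 a.1 * A a.2 ^ (θ - 1) :=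
    (hG.comp measurable_swap).mul ((hAm.comp measurable_snd).pow_const _)
  rw [lintegral_mul_const _ hm.lintegral_prod_right', lintegral_lintegral_swap hm.aemeasurable]
  have h4 : ∫⁻ x, ∫⁻ y, G x y * A x ^ (θ - 1) ∂ν ∂μ ≤ S := by
    refine lintegral_mono fun x => ?_
    rw [lintegral_mul_const _ (hGx x)]
    change A x * A x ^ (θ - 1) ≤ A x ^ θ
    rcases eq_or_ne (A x) 0 with h | h
    · simp [h]
    rcases eq_or_ne (A x) ∞ with h' | h'
    · simp [h', hθ]
    · refine le_of_eq ?_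
      conv_lhs => enter [1]; rw [← ENNReal.rpow_one (A x)]
      rw [← ENNReal.rpow_add _ _ h h']; ring_nf
  calc _ ≤ S * S ^ ((1 - θ) / θ) := by gcongr
    _ = S ^ (1 / θ) := by
      conv_lhs => enter [1]; rw [← ENNReal.rpow_one S]
      rw [← ENNReal.rpow_add_of_nonneg _ _ zero_le_one (div_nonneg (by linarith) hθ.le)]
      congr 1
      field_simp; ring

/-- Jensen's inequality for the power `a ≥ 1`. -/
lemma rpow_lintegral_le {X : Type*} [MeasurableSpace X] {μ : Measure X} [IsProbabilityMeasure μ]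
    {g : X → ℝ≥0∞} (hg : Measurable g) {a : ℝ} (ha : 1 ≤ a) :
    (∫⁻ x, g x ∂μ) ^ a ≤ ∫⁻ x, g x ^ a ∂μ := by
  have ha0 : 0 < a := by linarith
  have h := ENNReal.lintegral_mul_norm_pow_le (μ := μ) (f := fun x => g x ^ a) (g := fun _ => 1)
    (hg.pow_const a).aemeasurable aemeasurable_const (p := 1 / a) (q := 1 - 1 / a) (by positivity)
    (by rw [sub_nonneg, div_le_one ha0]; exact ha) (by ring)
  simp only [← ENNReal.rpow_mul, mul_one_div_cancel ha0.ne', ENNReal.rpow_one, ENNReal.one_rpow,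
    mul_one, lintegral_one, measure_univ] at h
  refine (ENNReal.rpow_le_rpow h ha0.le).trans (le_of_eq ?_)
  rw [← ENNReal.rpow_mul, one_div_mul_cancel ha0.ne', ENNReal.rpow_one]

/-- The integral defining the Lizorkin–Triebel space `F^{p,q}_α`. -/
noncomputable def triebelIntegral (p q α : ℝ) (f : (Fin n → ℂ) → ℂ) : ℝ≥0∞ :=
  ∫⁻ θ, (∫⁻ R in cube n, ‖f (torusPoint R θ)‖ₑ ^ q * weight (α * q - 1) R) ^ (p / q)
    ∂torusMeasure n

lemma measurable_triebel_integrand {f : (Fin n → ℂ) → ℂ} (hf : Measurable f) (q γ : ℝ) :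
    Measurable fun a : UnitAddTorus (Fin n) × (Fin n → ℝ) =>
      ‖f (torusPoint a.2 a.1)‖ₑ ^ q * weight γ a.2 :=
  ((measurable_enorm_comp_rpow hf q).comp measurable_swap).mul
    ((measurable_weight γ).comp measurable_snd)

lemma measurable_triebel_integrand_sub {f : (Fin n → ℂ) → ℂ} (hf : Measurable f) (q γ : ℝ)
    (ξ : UnitAddTorus (Fin n)) : Measurable fun a : (Fin n → ℝ) × UnitAddTorus (Fin n) =>
      ‖f (torusPoint a.1 (ξ - a.2))‖ₑ ^ q * weight γ a.1 := by
  have hg : Measurable fun a : (Fin n → ℝ) × UnitAddTorus (Fin n) => (ξ - a.2, a.1) := by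
    fun_prop
  have h1 := (measurable_triebel_integrand hf q γ).comp hg
  exact h1

/-- `F^{p,q}_α ⊆ A^{p,q}_α` for `p ≤ q`, by Minkowski's inequality. -/
lemma mixedIntegral_le_triebelIntegral {f : (Fin n → ℂ) → ℂ} (hf : Measurable f) {p q : ℝ}
    (α : ℝ) (hp : 0 < p) (hpq : p ≤ q) :
    mixedIntegral p q α f ≤ triebelIntegral p q α f ^ (q / p) := by
  have hq : 0 < q := hp.trans_le hpq
  have h := lintegral_rpow_lintegral_rpow_le (μ := torusMeasure n)
    (ν := (volume : Measure (Fin n → ℝ)).restrict (cube n))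
    (G := fun θ R => ‖f (torusPoint R θ)‖ₑ ^ q * weight (α * q - 1) R)
    (measurable_triebel_integrand hf q _) (θ := p / q) (by positivity)
    (by rw [div_le_one hq]; exact hpq)
  rw [one_div_div] at h
  refine le_trans (le_of_eq ?_) h
  refine setLIntegral_congr_fun (measurableSet_cube n) fun R hR => ?_
  simp_rw [ENNReal.mul_rpow_of_nonneg _ _ (show 0 ≤ p / q by positivity), ← ENNReal.rpow_mul,
    mul_div_cancel₀ p hq.ne']
  rw [lintegral_mul_const', ENNReal.mul_rpow_of_nonneg _ _ (by positivity), ← ENNReal.rpow_mul,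
    show p / q * (q / p) = 1 by field_simp, ENNReal.rpow_one, intMean_eq, ← ENNReal.rpow_mul,
    one_div_mul_eq_div]
  · rfl
  · exact ENNReal.rpow_ne_top_of_nonneg (by positivity) (weight_ne_top _)

/-- For radii `ρ` at distance about `1 - R` from `R`, the function `‖f‖ ^ q` at the point `Rξ` is
dominated by an average of its values on the torus of radii `ρ`; the averaging measure may be
chosen to depend on `R` only. -/
lemma enorm_rpow_le_of_mem_Icc {f : (Fin n → ℂ) → ℂ} (hf : f ∈ Hol n) {q : ℝ} (hq : 0 < q)
    {R ρ : Fin n → ℝ} (hR : R ∈ cube n) (hρ : ρ ∈ Icc (halfway R) (halfway (halfway R)))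
    (ξ : UnitAddTorus (Fin n)) :
    ‖f (torusPoint R ξ)‖ₑ ^ q ≤ 16 ^ n *
      ∫⁻ η, ‖f (torusPoint ρ (ξ - η))‖ₑ ^ q ∂polyMeasure fun i => R i / halfway R i := by
  have hρc : ρ ∈ cube n := mem_cube_of_mem_Icc_halfway (halfway_mem hR) hρ
  have hpos : ∀ i, 0 < halfway R i := fun i => by
    have := (hR i).1
    simp only [halfway]; linarith
  have hρ0 : ∀ i, 0 < ρ i := fun i => (hpos i).trans_le (hρ.1 i)
  have hRρ : ∀ i, R i < ρ i := fun i => by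
    have h1 := hρ.1 i
    have := (hR i).2
    simp only [halfway] at h1; linarith
  set x : Fin n → ℝ := fun i => R i / ρ i with hx
  have hxR : x * ρ = R := by
    ext i; simp only [Pi.mul_apply, hx]; rw [div_mul_cancel₀ _ (hρ0 i).ne']
  have hx0 : ∀ i, 0 ≤ x i := fun i => div_nonneg (hR i).1 (hρ0 i).le
  have hx1 : ∀ i, x i < 1 := fun i => by rw [div_lt_one (hρ0 i)]; exact hRρ i
  have h1 := enorm_rpow_le_lintegral_polyMeasure hf hq hρc (fun i => ⟨hx0 i, (hx1 i).le⟩) ξ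
  rw [hxR] at h1
  have h2 : polyMeasure x ≤ (16 : ℝ≥0∞) ^ n • polyMeasure fun i => R i / halfway R i := by
    have h3 := pi_le_smul_pi (fun _ : Fin n => (16 : ℝ≥0∞)) (by simp)
      (fun i => circleMeasure (x i)) (fun i => circleMeasure (R i / halfway R i)) fun i => ?_
    · simpa [polyMeasure] using h3
    have hRi := hR i
    have hy : 1 - R i / halfway R i = (1 - R i) / (1 + R i) := by
      have : (1 + R i) ≠ 0 := by linarith [hRi.1]
      simp only [halfway]; field_simp; ring
    have hx' : 1 - x i = (ρ i - R i) / ρ i := by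
      have := (hρ0 i).ne'
      simp only [hx]; field_simp
    have h4 := hρ.1 i
    have h5 := hρ.2 i
    simp only [halfway] at h4 h5
    refine circleMeasure_le_of_le_two_mul (hx0 i) (hx1 i) (div_nonneg hRi.1 (hpos i).le) ?_ ?_ ?_
    · rw [div_lt_one (hpos i)]; simp only [halfway]; linarith [hRi.2]
    · rw [hy, hx', ← mul_div_assoc, div_le_div_iff₀ (hρ0 i) (by linarith [hRi.1])]
      nlinarith [hRi.1, hRi.2, hρ0 i]
    · rw [hy, hx', ← mul_div_assoc, div_le_div_iff₀ (by linarith [hRi.1]) (hρ0 i)]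
      nlinarith [hRi.1, hRi.2, hρ0 i]
  refine h1.trans ((lintegral_mono' h2 le_rfl).trans (le_of_eq ?_))
  rw [lintegral_smul_measure, smul_eq_mul]

/-- The box of the radii `ρ` between `(1 + R) / 2` and `(3 + R) / 4`. -/
def radialBox (R : Fin n → ℝ) : Set (Fin n → ℝ) := Icc (halfway R) (halfway (halfway R))

/-- The indicator function of the pairs `(R, ρ)` with `ρ` in the box `radialBox R`. -/
noncomputable def boxKernel : (Fin n → ℝ) × (Fin n → ℝ) → ℝ≥0∞ :=
  {a : (Fin n → ℝ) × (Fin n → ℝ) | a.2 ∈ radialBox a.1}.indicator 1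

lemma measurable_boxKernel : Measurable (boxKernel (n := n)) := by
  have hh : Measurable (halfway : (Fin n → ℝ) → Fin n → ℝ) := by unfold halfway; fun_prop
  exact measurable_one.indicator ((measurableSet_le (hh.comp measurable_fst) measurable_snd).inter
    (measurableSet_le measurable_snd (hh.comp (hh.comp measurable_fst))))

lemma boxKernel_of_mem {R ρ : Fin n → ℝ} (h : ρ ∈ radialBox R) : boxKernel (R, ρ) = 1 :=
  indicator_of_mem (s := {a : (Fin n → ℝ) × (Fin n → ℝ) | a.2 ∈ radialBox a.1}) h _

lemma boxKernel_of_notMem {R ρ : Fin n → ℝ} (h : ρ ∉ radialBox R) : boxKernel (R, ρ) = 0 :=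
  indicator_of_notMem (s := {a : (Fin n → ℝ) × (Fin n → ℝ) | a.2 ∈ radialBox a.1}) h _

lemma radialBox_subset_cube {R : Fin n → ℝ} (hR : R ∈ cube n) : radialBox R ⊆ cube n :=
  fun _ hρ => mem_cube_of_mem_Icc_halfway (halfway_mem hR) hρ

lemma one_sub_comparable_of_mem_radialBox {R ρ : Fin n → ℝ} (hρ : ρ ∈ radialBox R) (i : Fin n) :
    1 - R i ≤ 4 * (1 - ρ i) ∧ 2 * (1 - ρ i) ≤ 1 - R i := by
  have h1 := hρ.1 i
  have h2 := hρ.2 i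
  simp only [halfway] at h1 h2
  constructor <;> linarith

/-- The part of the inner integral of `triebelIntegral` that comes from the radii comparable
with `R`. -/
noncomputable def localIntegral (q α : ℝ) (f : (Fin n → ℂ) → ℂ) (R : Fin n → ℝ)
    (ξ : UnitAddTorus (Fin n)) : ℝ≥0∞ :=
  ∫⁻ ρ in cube n, boxKernel (R, ρ) * (‖f (torusPoint ρ ξ)‖ₑ ^ q * weight (α * q - 1) ρ)

lemma measurable_localIntegral {f : (Fin n → ℂ) → ℂ} (hf : Measurable f) (q α : ℝ) :
    Measurable fun a : (Fin n → ℝ) × UnitAddTorus (Fin n) => localIntegral q α f a.1 a.2 := by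
  have h1 : Measurable fun b : ((Fin n → ℝ) × UnitAddTorus (Fin n)) × (Fin n → ℝ) =>
      (b.1.1, b.2) := by fun_prop
  have h2 : Measurable fun b : ((Fin n → ℝ) × UnitAddTorus (Fin n)) × (Fin n → ℝ) =>
      (b.1.2, b.2) := by fun_prop
  exact ((measurable_boxKernel.comp h1).mul
    ((measurable_triebel_integrand hf q (α * q - 1)).comp h2)).lintegral_prod_right'

lemma localIntegral_le (q α : ℝ) (f : (Fin n → ℂ) → ℂ) (R : Fin n → ℝ)
    (ξ : UnitAddTorus (Fin n)) : localIntegral q α f R ξ ≤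
      ∫⁻ ρ in cube n, ‖f (torusPoint ρ ξ)‖ₑ ^ q * weight (α * q - 1) ρ := by
  refine lintegral_mono fun ρ => mul_le_of_le_one_left' ?_
  by_cases h : ρ ∈ radialBox R
  · rw [boxKernel_of_mem h]
  · rw [boxKernel_of_notMem h]; exact zero_le_one

lemma localIntegral_eq (q α : ℝ) (f : (Fin n → ℂ) → ℂ) {R : Fin n → ℝ} (hR : R ∈ cube n)
    (ξ : UnitAddTorus (Fin n)) : localIntegral q α f R ξ =
      ∫⁻ ρ in radialBox R, ‖f (torusPoint ρ ξ)‖ₑ ^ q * weight (α * q - 1) ρ := by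
  have h1 : ∀ ρ, boxKernel (R, ρ) * (‖f (torusPoint ρ ξ)‖ₑ ^ q * weight (α * q - 1) ρ) =
      (radialBox R).indicator (fun ρ => ‖f (torusPoint ρ ξ)‖ₑ ^ q * weight (α * q - 1) ρ) ρ :=
    fun ρ => by
      by_cases h : ρ ∈ radialBox R
      · rw [boxKernel_of_mem h, indicator_of_mem h, one_mul]
      · rw [boxKernel_of_notMem h, indicator_of_notMem h, zero_mul]
  have hm : MeasurableSet (radialBox R) := measurableSet_Icc
  simp only [localIntegral, h1]
  rw [lintegral_indicator hm, Measure.restrict_restrict hm,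
    inter_eq_left.2 (radialBox_subset_cube hR)]

/-- The average of a pointwise bound over a set `S`. -/
lemma mul_measure_le_of_forall_le {X Y : Type*} [MeasurableSpace X] [MeasurableSpace Y]
    {μ : Measure X} {ν : Measure Y} [SFinite μ] [SFinite ν] {G : X → Y → ℝ≥0∞}
    (hG : Measurable fun a : X × Y => G a.1 a.2) {S : Set X} (hS : MeasurableSet S) {a K : ℝ≥0∞}
    (h : ∀ x ∈ S, a ≤ K * ∫⁻ y, G x y ∂ν) :
    a * μ S ≤ K * ∫⁻ y, ∫⁻ x in S, G x y ∂μ ∂ν := by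
  rw [← setLIntegral_const, ← lintegral_lintegral_swap hG.aemeasurable,
    ← lintegral_const_mul _ hG.lintegral_prod_right']
  exact setLIntegral_mono' hS h

/-- The constant by which `powMean_mul_weight_le` bounds the mean over a torus. -/
noncomputable def localConst (n : ℕ) (q α : ℝ) : ℝ≥0∞ :=
  ENNReal.ofReal ((4 ^ |(1 : ℝ)|) ^ n) * 2 ^ n *
    (16 ^ n * ENNReal.ofReal ((4 ^ |α * q - 1|) ^ n))

/-- For `q ≤ p` the mean over the torus of radii `R` is controlled by the radii comparable with `R`:
average `enorm_rpow_le_of_mem_Icc` over the box `radialBox R`, apply Jensen's inequality to the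
probability measure on the torus, and integrate. -/
lemma powMean_mul_weight_le {f : (Fin n → ℂ) → ℂ} (hf : f ∈ Hol n) (hfm : Measurable f)
    {p q : ℝ} (α : ℝ) (hq : 0 < q) (hqp : q ≤ p) {R : Fin n → ℝ} (hR : R ∈ cube n) :
    powMean p f R * weight (α * p) R ≤ localConst n q α ^ (p / q) *
      ∫⁻ ξ, localIntegral q α f R ξ ^ (p / q) ∂torusMeasure n := by
  have hp : 0 < p := hq.trans_le hqp
  have hpq0 : 0 ≤ p / q := by positivity
  have hpq1 : 1 ≤ p / q := by rw [le_div_iff₀ hq]; linarith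
  set C1 := localConst n q α with hC1
  set c := ENNReal.ofReal ((4 ^ |α * q - 1|) ^ n) with hc
  set c1 := ENNReal.ofReal ((4 ^ |(1 : ℝ)|) ^ n) with hc1
  set w : (Fin n → ℝ) → ℝ≥0∞ := weight (α * q - 1) with hw
  set π := polyMeasure fun i => R i / halfway R i with hπ
  have : IsProbabilityMeasure π := isProbabilityMeasure_polyMeasure fun i =>
    div_nonneg (hR i).1 (halfway_mem hR i).1
  have hHR : Measurable (localIntegral q α f R) :=
    (measurable_localIntegral hfm q α).comp measurable_prodMk_left
  have h1 : ∀ ξ, ‖f (torusPoint R ξ)‖ₑ ^ q * weight (α * q) R ≤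
      C1 * ∫⁻ η, localIntegral q α f R (ξ - η) ∂π := by
    intro ξ
    have h2 : ‖f (torusPoint R ξ)‖ₑ ^ q * w R * volume (radialBox R) ≤
        (16 ^ n * c) * ∫⁻ η, localIntegral q α f R (ξ - η) ∂π := by
      simp_rw [localIntegral_eq q α f hR]
      refine mul_measure_le_of_forall_le
        (G := fun ρ η => ‖f (torusPoint ρ (ξ - η))‖ₑ ^ q * weight (α * q - 1) ρ)
        (measurable_triebel_integrand_sub hfm q _ ξ) measurableSet_Icc fun ρ hρ => ?_
      have hρc := radialBox_subset_cube hR hρ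
      rw [lintegral_mul_const' _ _ (weight_ne_top _)]
      calc ‖f (torusPoint R ξ)‖ₑ ^ q * w R ≤
            (16 ^ n * ∫⁻ η, ‖f (torusPoint ρ (ξ - η))‖ₑ ^ q ∂π) * (c * w ρ) := by
            refine mul_le_mul' (enorm_rpow_le_of_mem_Icc hf hq hR hρ ξ) ?_
            have hρ' := one_sub_comparable_of_mem_radialBox hρ
            exact weight_le_of_comparable hR hρc (fun i => (hρ' i).1)
              (fun i => by linarith [(hρ' i).2, one_sub_pos hρc i]) _
        _ = _ := by ring
    have h4 : weight 1 R ≤ c1 * 2 ^ n * volume (radialBox R) := by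
      rw [radialBox, volume_Icc_halfway (halfway_mem hR)]
      have h5 := weight_le_of_mem_Icc_halfway hR ⟨le_halfway hR, le_rfl⟩ 1
      have h6 : (2 : ℝ≥0∞) ^ n * ENNReal.ofReal (1 / 2) ^ n = 1 := by
        rw [← mul_pow, show (2 : ℝ≥0∞) = ENNReal.ofReal 2 by simp,
          ← ENNReal.ofReal_mul (by norm_num)]
        norm_num
      calc weight 1 R ≤ c1 * weight 1 (halfway R) := h5
        _ = c1 * (2 ^ n * ENNReal.ofReal (1 / 2) ^ n) * weight 1 (halfway R) := by
            rw [h6, mul_one]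
        _ = _ := by ring
    calc ‖f (torusPoint R ξ)‖ₑ ^ q * weight (α * q) R
        = ‖f (torusPoint R ξ)‖ₑ ^ q * w R * weight 1 R := by
          rw [mul_assoc, hw, weight_mul hR, sub_add_cancel]
      _ ≤ ‖f (torusPoint R ξ)‖ₑ ^ q * w R * (c1 * 2 ^ n * volume (radialBox R)) := by gcongr
      _ = c1 * 2 ^ n * (‖f (torusPoint R ξ)‖ₑ ^ q * w R * volume (radialBox R)) := by ring
      _ ≤ c1 * 2 ^ n * (16 ^ n * c * ∫⁻ η, localIntegral q α f R (ξ - η) ∂π) :=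
          mul_le_mul' le_rfl h2
      _ = _ := by rw [hC1, localConst]; ring
  have h5 : ∀ ξ, ‖f (torusPoint R ξ)‖ₑ ^ p * weight (α * p) R ≤
      C1 ^ (p / q) * ∫⁻ η, localIntegral q α f R (ξ - η) ^ (p / q) ∂π := by
    intro ξ
    calc ‖f (torusPoint R ξ)‖ₑ ^ p * weight (α * p) R
        = (‖f (torusPoint R ξ)‖ₑ ^ q * weight (α * q) R) ^ (p / q) := by
          rw [ENNReal.mul_rpow_of_nonneg _ _ hpq0, ← ENNReal.rpow_mul, weight_rpow hR,
            mul_div_cancel₀ _ hq.ne', mul_assoc, mul_div_cancel₀ _ hq.ne']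
      _ ≤ (C1 * ∫⁻ η, localIntegral q α f R (ξ - η) ∂π) ^ (p / q) :=
          ENNReal.rpow_le_rpow (h1 ξ) hpq0
      _ ≤ _ := by
          rw [ENNReal.mul_rpow_of_nonneg _ _ hpq0]
          gcongr
          exact rpow_lintegral_le (hHR.comp (measurable_const.sub measurable_id)) hpq1
  have h6 : Measurable fun a : UnitAddTorus (Fin n) × UnitAddTorus (Fin n) =>
      localIntegral q α f R (a.1 - a.2) ^ (p / q) :=
    (hHR.comp (measurable_fst.sub measurable_snd)).pow_const _
  calc powMean p f R * weight (α * p) R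
      = ∫⁻ ξ, ‖f (torusPoint R ξ)‖ₑ ^ p * weight (α * p) R ∂torusMeasure n := by
        rw [lintegral_mul_const' _ _ (weight_ne_top _)]; rfl
    _ ≤ ∫⁻ ξ, C1 ^ (p / q) * ∫⁻ η, localIntegral q α f R (ξ - η) ^ (p / q) ∂π ∂torusMeasure n :=
        lintegral_mono h5
    _ = C1 ^ (p / q) * ∫⁻ η, ∫⁻ ξ, localIntegral q α f R (ξ - η) ^ (p / q) ∂torusMeasure n ∂π := by
        rw [lintegral_const_mul _ h6.lintegral_prod_right',
          lintegral_lintegral_swap h6.aemeasurable]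
    _ = _ := by
        simp_rw [lintegral_sub_right_eq_self (μ := torusMeasure n)
          (fun ξ => localIntegral q α f R ξ ^ (p / q))]
        simp

/-- The radii `R` with `ρ ∈ radialBox R` lie in a box of size comparable with `1 - ρ`. -/
lemma lintegral_weight_mul_boxKernel_le {ρ : Fin n → ℝ} (hρ : ρ ∈ cube n) :
    ∫⁻ R in cube n, weight (-1) R * boxKernel (R, ρ) ≤
      ENNReal.ofReal ((4 ^ |(-1 : ℝ)|) ^ n) * 2 ^ n := by
  set cm := ENNReal.ofReal ((4 ^ |(-1 : ℝ)|) ^ n) with hcm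
  set E := Icc (fun i => 1 - 4 * (1 - ρ i)) (fun i => 1 - 2 * (1 - ρ i)) with hE
  have h2 : ∫⁻ R in cube n, weight (-1) R *
      boxKernel (R, ρ) ≤
      ∫⁻ R in cube n, E.indicator (fun _ => cm * weight (-1) ρ) R := by
    refine setLIntegral_mono' (measurableSet_cube n) fun R hR => ?_
    by_cases h : ρ ∈ radialBox R
    · have h3 : R ∈ E := ⟨fun i => by linarith [(one_sub_comparable_of_mem_radialBox h i).1],
        fun i => by linarith [(one_sub_comparable_of_mem_radialBox h i).2]⟩
      rw [indicator_of_mem h3, boxKernel_of_mem h, mul_one]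
      exact weight_le_of_comparable hR hρ (fun i => (one_sub_comparable_of_mem_radialBox h i).1)
        (fun i => by linarith [(one_sub_comparable_of_mem_radialBox h i).2, one_sub_pos hρ i]) _
    · rw [boxKernel_of_notMem h, mul_zero]
      exact zero_le
  refine h2.trans ((setLIntegral_le_lintegral _ _).trans ?_)
  rw [lintegral_indicator measurableSet_Icc, setLIntegral_const, Real.volume_Icc_pi]
  have h4 : ∀ i, ENNReal.ofReal (1 - 2 * (1 - ρ i) - (1 - 4 * (1 - ρ i)))
      = 2 * ENNReal.ofReal ((1 - ρ i) ^ (1 : ℝ)) := fun i => by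
    rw [show (2 : ℝ≥0∞) = ENNReal.ofReal 2 by simp, ← ENNReal.ofReal_mul (by norm_num)]
    congr 1
    rw [Real.rpow_one]; ring
  simp_rw [h4]
  rw [Finset.prod_mul_distrib, ← weight_eq_prod hρ]
  simp only [Finset.prod_const, Finset.card_univ, Fintype.card_fin]
  refine le_of_eq ?_
  calc cm * weight (-1) ρ * (2 ^ n * weight 1 ρ) = cm * 2 ^ n * (weight (-1) ρ * weight 1 ρ) := by
        ring
    _ = cm * 2 ^ n := by rw [weight_mul hρ]; simp

lemma lintegral_weight_mul_lintegral_boxKernel_le {F : (Fin n → ℝ) → ℝ≥0∞} (hm2 : Measurable F) :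
    ∫⁻ R in cube n, weight (-1) R * ∫⁻ ρ in cube n, boxKernel (R, ρ) * F ρ ≤
      (ENNReal.ofReal ((4 ^ |(-1 : ℝ)|) ^ n) * 2 ^ n) * ∫⁻ ρ in cube n, F ρ := by
  have hm : Measurable fun a : (Fin n → ℝ) × (Fin n → ℝ) =>
      weight (-1) a.1 * (boxKernel (a.1, a.2) * F a.2) :=
    ((measurable_weight _).comp measurable_fst).mul (measurable_boxKernel.mul (hm2.comp
      measurable_snd))
  have hb : ∀ ρ, Measurable fun R : Fin n → ℝ => weight (-1) R * boxKernel (R, ρ) := fun ρ =>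
    (measurable_weight _).mul (measurable_boxKernel.comp measurable_prodMk_right)
  calc ∫⁻ R in cube n, weight (-1) R * ∫⁻ ρ in cube n, boxKernel (R, ρ) * F ρ
      = ∫⁻ R in cube n, ∫⁻ ρ in cube n, weight (-1) R * (boxKernel (R, ρ) * F ρ) := by
        refine lintegral_congr fun R => ?_
        rw [lintegral_const_mul' _ _ (weight_ne_top _)]
    _ = ∫⁻ ρ in cube n, ∫⁻ R in cube n, weight (-1) R * (boxKernel (R, ρ) * F ρ) :=
        lintegral_lintegral_swap (f := fun R ρ => weight (-1) R * (boxKernel (R, ρ) * F ρ))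
          hm.aemeasurable
    _ ≤ ∫⁻ ρ in cube n, (ENNReal.ofReal ((4 ^ |(-1 : ℝ)|) ^ n) * 2 ^ n) * F ρ := by
        refine setLIntegral_mono' (measurableSet_cube n) fun ρ hρ => ?_
        simp_rw [← mul_assoc (weight (-1) _)]
        rw [lintegral_mul_const _ (hb ρ)]
        exact mul_le_mul' (lintegral_weight_mul_boxKernel_le hρ) le_rfl
    _ = _ := lintegral_const_mul _ hm2

lemma lintegral_weight_mul_localIntegral_le {f : (Fin n → ℂ) → ℂ} (hfm : Measurable f) (q α : ℝ)
    (ξ : UnitAddTorus (Fin n)) :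
    ∫⁻ R in cube n, weight (-1) R * localIntegral q α f R ξ ≤
      (ENNReal.ofReal ((4 ^ |(-1 : ℝ)|) ^ n) * 2 ^ n) *
        ∫⁻ ρ in cube n, ‖f (torusPoint ρ ξ)‖ₑ ^ q * weight (α * q - 1) ρ := by
  have hξ : Measurable fun ρ : Fin n → ℝ => (ξ, ρ) := measurable_prodMk_left
  have hm := (measurable_triebel_integrand hfm q (α * q - 1)).comp hξ
  exact lintegral_weight_mul_lintegral_boxKernel_le hm

/-- `F^{p,q}_α ⊆ A^{p,p}_α` for `q ≤ p`: the means over a torus are bounded by the local part of the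
inner integral, and `∫ (1 - R)^{-1} H(R)^{p/q} dR ≤ H^{p/q - 1} ∫ (1 - R)^{-1} H(R) dR ≲ H^{p/q}`
for the local parts `H(R)` of the full inner integral `H`. -/
lemma exists_mixedIntegral_le_triebelIntegral (n : ℕ) {p q : ℝ} (α : ℝ) (hq : 0 < q)
    (hqp : q ≤ p) : ∃ C : ℝ≥0∞, C ≠ ∞ ∧ ∀ f : (Fin n → ℂ) → ℂ, f ∈ Hol n → Measurable f →
      mixedIntegral p p α f ≤ C * triebelIntegral p q α f := by
  have hp : 0 < p := hq.trans_le hqp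
  set cm := ENNReal.ofReal ((4 ^ |(-1 : ℝ)|) ^ n) with hcm
  set C1 := localConst n q α with hC1
  have hC1t : C1 ≠ ∞ := by rw [hC1, localConst]; finiteness
  have hpq0 : 0 ≤ p / q := by positivity
  have hpq1 : 1 ≤ p / q := by rw [le_div_iff₀ hq]; linarith
  refine ⟨C1 ^ (p / q) * (cm * 2 ^ n), ?_, fun f hf hfm => ?_⟩
  · have := ENNReal.rpow_ne_top_of_nonneg hpq0 hC1t
    finiteness
  -- the full inner integral
  set H' : UnitAddTorus (Fin n) → ℝ≥0∞ :=
    fun ξ => ∫⁻ ρ in cube n, ‖f (torusPoint ρ ξ)‖ₑ ^ q * weight (α * q - 1) ρ with hH'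
  have hintm := measurable_triebel_integrand hfm q (α * q - 1)
  have hH'm : Measurable H' := hintm.lintegral_prod_right'
  have hm3 : Measurable fun a : (Fin n → ℝ) × UnitAddTorus (Fin n) =>
      weight (-1) a.1 * localIntegral q α f a.1 a.2 ^ (p / q) :=
    ((measurable_weight _).comp measurable_fst).mul ((measurable_localIntegral hfm q α).pow_const _)
  have hm4 : ∀ ξ, Measurable fun R => weight (-1) R * localIntegral q α f R ξ := fun ξ =>
    (measurable_weight _).mul ((measurable_localIntegral hfm q α).comp measurable_prodMk_right)
  calc mixedIntegral p p α f
      = ∫⁻ R in cube n, weight (-1) R * (powMean p f R * weight (α * p) R) := by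
        refine setLIntegral_congr_fun (measurableSet_cube n) fun R hR => ?_
        rw [intMean_eq, ← ENNReal.rpow_mul, one_div_mul_cancel hp.ne', ENNReal.rpow_one,
          sub_eq_add_neg, ← weight_mul hR]
        ring
    _ ≤ ∫⁻ R in cube n, C1 ^ (p / q) *
          ∫⁻ ξ, weight (-1) R * localIntegral q α f R ξ ^ (p / q) ∂torusMeasure n := by
        refine setLIntegral_mono' (measurableSet_cube n) fun R hR => ?_
        rw [lintegral_const_mul' _ _ (weight_ne_top _)]
        calc weight (-1) R * (powMean p f R * weight (α * p) R) ≤ weight (-1) R *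
              (C1 ^ (p / q) * ∫⁻ ξ, localIntegral q α f R ξ ^ (p / q) ∂torusMeasure n) :=
              mul_le_mul' le_rfl (powMean_mul_weight_le hf hfm α hq hqp hR)
          _ = _ := by ring
    _ = C1 ^ (p / q) * ∫⁻ ξ, ∫⁻ R in cube n, weight (-1) R * localIntegral q α f R ξ ^ (p / q) 
          ∂volume ∂torusMeasure n := by
        rw [lintegral_const_mul _ hm3.lintegral_prod_right',
          lintegral_lintegral_swap hm3.aemeasurable]
    _ ≤ C1 ^ (p / q) * ∫⁻ ξ, (cm * 2 ^ n) * H' ξ ^ (p / q) ∂torusMeasure n := by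
        refine mul_le_mul' le_rfl (lintegral_mono fun ξ => ?_)
        calc ∫⁻ R in cube n, weight (-1) R * localIntegral q α f R ξ ^ (p / q)
            ≤ ∫⁻ R in cube n, (weight (-1) R * localIntegral q α f R ξ) * H' ξ ^ (p / q - 1) := by
              refine lintegral_mono fun R => ?_
              simp only
              rw [mul_assoc]
              refine mul_le_mul' le_rfl ?_
              calc localIntegral q α f R ξ ^ (p / q)
                  = localIntegral q α f R ξ * localIntegral q α f R ξ ^ (p / q - 1) := by
                    conv_rhs => enter [1]; rw [← ENNReal.rpow_one (localIntegral q α f R ξ)]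
                    rw [← ENNReal.rpow_add_of_nonneg _ _ zero_le_one (by linarith)]
                    congr 1; ring
                _ ≤ _ := mul_le_mul' le_rfl
                      (ENNReal.rpow_le_rpow (localIntegral_le q α f R ξ) (by linarith))
          _ ≤ (cm * 2 ^ n) * H' ξ * H' ξ ^ (p / q - 1) := by
              rw [lintegral_mul_const _ (hm4 ξ)]
              exact mul_le_mul' (lintegral_weight_mul_localIntegral_le hfm q α ξ) le_rfl
          _ = (cm * 2 ^ n) * H' ξ ^ (p / q) := by
              rw [mul_assoc]
              congr 1
              conv_lhs => enter [1]; rw [← ENNReal.rpow_one (H' ξ)]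
              rw [← ENNReal.rpow_add_of_nonneg _ _ zero_le_one (by linarith)]
              congr 1; ring
    _ = _ := by
        rw [lintegral_const_mul _ (hH'm.pow_const _), ← mul_assoc]
        rfl

/-! ### Power series in the polydisc -/

/-- The monomial `R^k` of a vector of radii. -/
def realMonom (k : Fin n → ℕ) (R : Fin n → ℝ) : ℝ := ∏ i, R i ^ k i

/-- The character `ξ^k` of the torus, where `ξⱼ = exp(2πiθⱼ)`. -/
noncomputable def torusChar (k : Fin n → ℕ) (θ : UnitAddTorus (Fin n)) : ℂ :=
  ∏ i, circlePoint (θ i) ^ k i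

@[simp] lemma norm_torusChar (k : Fin n → ℕ) (θ : UnitAddTorus (Fin n)) :
    ‖torusChar k θ‖ = 1 := by
  simp [torusChar, norm_prod]

lemma continuous_torusChar (k : Fin n → ℕ) : Continuous (torusChar k) := by
  have := continuous_circlePoint
  unfold torusChar
  fun_prop

lemma torusChar_add (k : Fin n → ℕ) (θ η : UnitAddTorus (Fin n)) :
    torusChar k (θ + η) = torusChar k θ * torusChar k η := by
  simp [torusChar, circlePoint_add, mul_pow, Finset.prod_mul_distrib]

lemma torusChar_neg (k : Fin n → ℕ) (θ : UnitAddTorus (Fin n)) :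
    torusChar k (-θ) = (starRingEnd ℂ) (torusChar k θ) := by
  simp [torusChar, circlePoint_neg, map_prod]

lemma monom_torusPoint (k : Fin n → ℕ) (R : Fin n → ℝ) (θ : UnitAddTorus (Fin n)) :
    monom k (torusPoint R θ) = realMonom k R * torusChar k θ := by
  simp [monom, torusPoint_apply, realMonom, torusChar, mul_pow, Finset.prod_mul_distrib]

lemma realMonom_nonneg (k : Fin n → ℕ) {R : Fin n → ℝ} (hR : R ∈ cube n) : 0 ≤ realMonom k R :=
  Finset.prod_nonneg fun i _ => pow_nonneg (hR i).1 _

lemma realMonom_mul (k : Fin n → ℕ) (r R : Fin n → ℝ) :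
    realMonom k (r * R) = realMonom k r * realMonom k R := by
  simp [realMonom, mul_pow, Finset.prod_mul_distrib]

lemma continuous_realMonom (k : Fin n → ℕ) : Continuous (realMonom k) := by
  unfold realMonom; fun_prop

lemma norm_monom (k : Fin n → ℕ) (z : Fin n → ℂ) : ‖monom k z‖ = realMonom k fun i => ‖z i‖ := by
  simp [monom, realMonom, norm_prod]

lemma norm_mem_cube {z : Fin n → ℂ} (hz : z ∈ polydisc n) : (fun i => ‖z i‖) ∈ cube n :=
  fun i => ⟨norm_nonneg _, hz i⟩

/-- The coefficients `A` are those of a power series that converges absolutely in the polydisc. -/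
def ConvergentOnCube (A : (Fin n → ℕ) → ℂ) : Prop :=
  ∀ R ∈ cube n, Summable fun k => ‖A k‖ * realMonom k R

lemma HasExpansion.convergentOnCube {f : (Fin n → ℂ) → ℂ} {a : (Fin n → ℕ) → ℂ}
    (h : HasExpansion f a) : ConvergentOnCube a := by
  intro R hR
  have hz : (fun i => (R i : ℂ)) ∈ polydisc n := fun i => by
    simpa [abs_of_nonneg (hR i).1] using (hR i).2
  have h1 := (h _ hz).summable.norm
  refine h1.congr fun k => ?_
  rw [norm_mul, norm_monom]
  congr 2
  ext i
  simp [abs_of_nonneg (hR i).1]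

lemma ConvergentOnCube.summable {A : (Fin n → ℕ) → ℂ} (hA : ConvergentOnCube A) {z : Fin n → ℂ}
    (hz : z ∈ polydisc n) : Summable fun k => ‖A k * monom k z‖ := by
  refine (hA _ (norm_mem_cube hz)).congr fun k => ?_
  rw [norm_mul, norm_monom]

/-- The sum of a power series. -/
noncomputable def powerSeries (A : (Fin n → ℕ) → ℂ) (z : Fin n → ℂ) : ℂ := ∑' k, A k * monom k z

lemma ConvergentOnCube.hasExpansion {A : (Fin n → ℕ) → ℂ} (hA : ConvergentOnCube A) :
    HasExpansion (powerSeries A) A := fun _ hz => (hA.summable hz).of_norm.hasSum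

lemma polydisc_eq_ball (n : ℕ) : polydisc n = Metric.ball 0 1 := by
  ext z
  simp [polydisc, pi_norm_lt_iff]

lemma realMonom_mono (k : Fin n → ℕ) {r R : Fin n → ℝ} (hr : ∀ i, 0 ≤ r i) (h : ∀ i, r i ≤ R i) :
    realMonom k r ≤ realMonom k R :=
  Finset.prod_le_prod (fun i _ => pow_nonneg (hr i) _)
    fun i _ => pow_le_pow_left₀ (hr i) (h i) _

lemma differentiable_monom (k : Fin n → ℕ) : Differentiable ℂ (monom k) := by
  unfold monom
  fun_prop

/-- The derivatives of the terms are controlled by Cauchy's estimates on a slightly larger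
polydisc. -/
lemma ConvergentOnCube.mem_Hol {A : (Fin n → ℕ) → ℂ} (hA : ConvergentOnCube A) :
    powerSeries A ∈ Hol n := by
  intro z hz
  have hz0 := hz
  rw [polydisc_eq_ball, mem_ball_zero_iff] at hz
  obtain ⟨r, hr1, hr2⟩ := exists_between hz
  obtain ⟨ρ, hρ1, hρ2⟩ := exists_between hr2
  have hr0 : 0 ≤ r := (norm_nonneg z).trans hr1.le
  have hρc : (fun _ : Fin n => ρ) ∈ cube n := fun i => ⟨hr0.trans hρ1.le, hρ2⟩
  have hε : 0 < ρ - r := sub_pos.2 hρ1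
  have hm : ∀ k : Fin n → ℕ, ∀ w ∈ Metric.closedBall (0 : Fin n → ℂ) ρ,
      ‖monom k w‖ ≤ realMonom k fun _ => ρ := by
    intro k w hw
    rw [norm_monom]
    rw [mem_closedBall_zero_iff] at hw
    exact realMonom_mono k (fun _ => norm_nonneg _) fun i => (norm_le_pi_norm w i).trans hw
  have h1 := hasFDerivAt_tsum_of_isPreconnected (𝕜 := ℂ) (s := Metric.ball (0 : Fin n → ℂ) r)
    (f := fun k z => A k * monom k z) (f' := fun k z => A k • fderiv ℂ (monom k) z)
    (u := fun k => (‖A k‖ * realMonom k fun _ => ρ) * (2 / (ρ - r))) (x₀ := z) (x := z)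
    ((hA _ hρc).mul_right _) Metric.isOpen_ball
    (convex_ball (0 : Fin n → ℂ) r).isPreconnected ?_ ?_ ?_ ?_ ?_
  · exact h1.differentiableAt.differentiableWithinAt
  · intro k w _
    exact ((differentiable_monom k).differentiableAt.hasFDerivAt).const_mul (A k)
  · intro k w hw
    rw [norm_smul, mul_assoc]
    refine mul_le_mul_of_nonneg_left ?_ (norm_nonneg _)
    rw [← mul_div_assoc]
    rw [mem_ball_zero_iff] at hw
    refine Complex.norm_fderiv_le_div_of_mapsTo_ball (differentiable_monom k).differentiableOn ?_ hε
    intro v hv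
    rw [mem_ball_iff_norm] at hv
    rw [mem_closedBall_iff_norm]
    refine (norm_sub_le _ _).trans ?_
    have h2 := hm k v (mem_closedBall_zero_iff.2 (by
      calc ‖v‖ = ‖(v - w) + w‖ := by rw [sub_add_cancel]
        _ ≤ _ := norm_add_le _ _
        _ ≤ ρ := by linarith))
    have h3 := hm k w (mem_closedBall_zero_iff.2 (by linarith))
    linarith
  · exact mem_ball_zero_iff.2 hr1
  · exact (hA.summable hz0).of_norm
  · exact mem_ball_zero_iff.2 hr1

lemma HasExpansion.eq_of {f g : (Fin n → ℂ) → ℂ} {a : (Fin n → ℕ) → ℂ} (hf : HasExpansion f a)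
    (hg : HasExpansion g a) {z : Fin n → ℂ} (hz : z ∈ polydisc n) : f z = g z :=
  (hf z hz).unique (hg z hz)

lemma sqrt_mem_cube {R : Fin n → ℝ} (hR : R ∈ cube n) : (fun i => √(R i)) ∈ cube n :=
  fun i => ⟨Real.sqrt_nonneg _, by
    rw [Real.sqrt_lt' one_pos]; simpa using (hR i).2⟩

lemma sqrt_mul_sqrt_cube {R : Fin n → ℝ} (hR : R ∈ cube n) :
    (fun i => √(R i)) * (fun i => √(R i)) = R := by
  ext i; simp [Real.mul_self_sqrt (hR i).1]

/-- If `A` is the sequence of coefficients of a power series that converges in the polydisc, and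
`(Bₖ R^k)ₖ` is bounded for each `R`, then the products `Bₖ Aₖ` are the coefficients of a power
series that converges in the polydisc. -/
lemma ConvergentOnCube.mul {A B : (Fin n → ℕ) → ℂ} (hA : ConvergentOnCube A)
    (hB : ∀ R ∈ cube n, ∃ M, ∀ k, ‖B k‖ * realMonom k R ≤ M) :
    ConvergentOnCube fun k => B k * A k := by
  intro R hR
  obtain ⟨M, hM⟩ := hB _ (sqrt_mem_cube hR)
  refine Summable.of_nonneg_of_le (fun k => mul_nonneg (norm_nonneg _) (realMonom_nonneg k hR))
    (fun k => ?_) ((hA _ (sqrt_mem_cube hR)).mul_left M)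
  conv_lhs => rw [← sqrt_mul_sqrt_cube hR]
  rw [norm_mul, realMonom_mul]
  set x := realMonom k fun i => √(R i) with hx
  have hx0 : 0 ≤ x := realMonom_nonneg k (sqrt_mem_cube hR)
  calc ‖B k‖ * ‖A k‖ * (x * x) = (‖B k‖ * x) * (‖A k‖ * x) := by ring
    _ ≤ M * (‖A k‖ * x) := mul_le_mul_of_nonneg_right (hM k) (by positivity)

lemma ConvergentOnCube.bounded {A : (Fin n → ℕ) → ℂ} (hA : ConvergentOnCube A) {R : Fin n → ℝ}
    (hR : R ∈ cube n) : ∃ M, ∀ k, ‖A k‖ * realMonom k R ≤ M :=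
  ⟨_, fun k => (hA R hR).le_tsum k fun j _ => mul_nonneg (norm_nonneg _) (realMonom_nonneg j hR)⟩

/-! ### Fourier coefficients -/

lemma torusChar_eq_mFourier (k : Fin n → ℕ) (θ : UnitAddTorus (Fin n)) :
    torusChar k θ = UnitAddTorus.mFourier (fun i => (k i : ℤ)) θ := by
  simp [torusChar, UnitAddTorus.mFourier, fourier_apply, circlePoint, AddCircle.toCircle_nsmul]

lemma integral_mFourier (k : Fin n → ℤ) :
    ∫ θ, UnitAddTorus.mFourier k θ ∂torusMeasure n = if k = 0 then 1 else 0 := by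
  split_ifs with h
  · subst h
    simp [UnitAddTorus.mFourier_zero]
  · obtain ⟨i, hi⟩ := Function.ne_iff.1 h
    simp only [UnitAddTorus.mFourier, ContinuousMap.coe_mk, torusMeasure]
    rw [integral_fintype_prod_eq_prod (𝕜 := ℂ) (fun i x => fourier (k i) x)]
    refine Finset.prod_eq_zero (Finset.mem_univ i) ?_
    exact integral_eq_zero_of_add_right_eq_neg (μ := haarAddCircle)
      (fourier_add_half_inv_index hi one_pos)

lemma integral_torusChar_mul (k l : Fin n → ℕ) :
    ∫ θ, torusChar k θ * torusChar l (-θ) ∂torusMeasure n = if k = l then 1 else 0 := by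
  have h : ∀ θ, torusChar k θ * torusChar l (-θ) =
      UnitAddTorus.mFourier ((fun i => (k i : ℤ)) + -fun i => (l i : ℤ)) θ := fun θ => by
    rw [UnitAddTorus.mFourier_add, UnitAddTorus.mFourier_neg, torusChar_neg,
      ← torusChar_eq_mFourier, ← torusChar_eq_mFourier]
  simp_rw [h, integral_mFourier]
  congr 1
  simp [funext_iff, ← sub_eq_add_neg, sub_eq_zero]

lemma integrable_torus {u : UnitAddTorus (Fin n) → ℂ} (hu : Continuous u) :
    Integrable u (torusMeasure n) :=
  hu.integrable_of_hasCompactSupport (HasCompactSupport.of_compactSpace u)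

/-- Integration of an absolutely convergent trigonometric series against a continuous function. -/
lemma hasSum_integral_mul_trig {F : UnitAddTorus (Fin n) → ℂ} (hF : Continuous F)
    {B : (Fin n → ℕ) → ℂ} (hB : Summable fun k => ‖B k‖)
    {e : (Fin n → ℕ) → UnitAddTorus (Fin n) → ℂ} (he : ∀ k, Continuous (e k))
    (he1 : ∀ k θ, ‖e k θ‖ = 1) :
    HasSum (fun k => B k * ∫ θ, F θ * e k θ ∂torusMeasure n)
      (∫ θ, F θ * ∑' k, B k * e k θ ∂torusMeasure n) := by
  obtain ⟨M, hM⟩ := isCompact_univ.exists_bound_of_continuousOn hF.continuousOn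
  have hint : ∀ k, Integrable (fun θ => B k * (F θ * e k θ)) (torusMeasure n) := fun k =>
    integrable_torus (continuous_const.mul (hF.mul (he k)))
  have hb : ∀ k, ∫ θ, ‖B k * (F θ * e k θ)‖ ∂torusMeasure n ≤ ‖B k‖ * M := fun k => by
    have h1 : ∫ θ, ‖B k * (F θ * e k θ)‖ ∂torusMeasure n ≤
        ∫ _, ‖B k‖ * M ∂torusMeasure n := by
      refine integral_mono (hint k).norm (integrable_const _) fun θ => ?_
      simp only [norm_mul, he1, mul_one]
      exact mul_le_mul_of_nonneg_left (hM θ (mem_univ _)) (norm_nonneg _)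
    simpa using h1
  have h := hasSum_integral_of_summable_integral_norm hint
    (Summable.of_nonneg_of_le (fun k => integral_nonneg fun θ => norm_nonneg _) hb
      (hB.mul_right M))
  simp only [integral_const_mul] at h
  have h2 : ∀ θ, F θ * ∑' k, B k * e k θ = ∑' k, B k * (F θ * e k θ) := fun θ => by
    rw [← tsum_mul_left]
    exact tsum_congr fun k => by ring
  simp_rw [h2]
  exact h

lemma continuous_trig {A : (Fin n → ℕ) → ℂ} (hA : Summable fun k => ‖A k‖) :
    Continuous fun θ => ∑' k, A k * torusChar k θ :=
  continuous_tsum (fun k => continuous_const.mul (continuous_torusChar k)) hA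
    fun k θ => by simp

lemma integral_trig_mul_torusChar {A : (Fin n → ℕ) → ℂ} (hA : Summable fun k => ‖A k‖)
    (l : Fin n → ℕ) :
    ∫ θ, (∑' k, A k * torusChar k θ) * torusChar l (-θ) ∂torusMeasure n = A l := by
  have h := hasSum_integral_mul_trig (F := fun θ => torusChar l (-θ))
    ((continuous_torusChar l).comp continuous_neg) hA continuous_torusChar norm_torusChar
  simp_rw [mul_comm (torusChar l (-_)), integral_torusChar_mul] at h
  refine h.unique ?_
  convert hasSum_single (f := fun k => A k * if k = l then (1 : ℂ) else 0) l ?_ using 1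
  · simp
  · intro k hk; simp [hk]

/-- Parseval's formula for the convolution of two trigonometric series. -/
lemma integral_trig_mul_trig {A B : (Fin n → ℕ) → ℂ} (hA : Summable fun k => ‖A k‖)
    (hB : Summable fun k => ‖B k‖) (ξ : UnitAddTorus (Fin n)) :
    ∫ η, (∑' k, A k * torusChar k η) * (∑' k, B k * torusChar k (ξ - η)) ∂torusMeasure n =
      ∑' k, A k * B k * torusChar k ξ := by
  have h := hasSum_integral_mul_trig (F := fun η => ∑' k, A k * torusChar k η)
    (continuous_trig hA) hB (e := fun k η => torusChar k (ξ - η))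
    (fun k => (continuous_torusChar k).comp (by fun_prop)) fun k η => norm_torusChar _ _
  rw [← h.tsum_eq]
  refine tsum_congr fun k => ?_
  simp_rw [sub_eq_add_neg, torusChar_add, mul_left_comm _ (torusChar k ξ)]
  rw [integral_const_mul, integral_trig_mul_torusChar hA]
  ring

lemma HasExpansion.apply_torusPoint {f : (Fin n → ℂ) → ℂ} {a : (Fin n → ℕ) → ℂ}
    (h : HasExpansion f a) {R : Fin n → ℝ} (hR : R ∈ cube n) (θ : UnitAddTorus (Fin n)) :
    f (torusPoint R θ) = ∑' k, (a k * realMonom k R) * torusChar k θ := by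
  rw [← (h _ (torusPoint_mem_polydisc hR θ)).tsum_eq]
  exact tsum_congr fun k => by rw [monom_torusPoint, mul_assoc]

lemma ConvergentOnCube.summable_norm {A : (Fin n → ℕ) → ℂ} (hA : ConvergentOnCube A)
    {R : Fin n → ℝ} (hR : R ∈ cube n) : Summable fun k => ‖A k * (realMonom k R : ℂ)‖ := by
  refine (hA R hR).congr fun k => ?_
  rw [norm_mul, Complex.norm_real, Real.norm_eq_abs, abs_of_nonneg (realMonom_nonneg k hR)]

/-- Cauchy's formula on the torus of radius `1/2` returns the coefficients of an expansion. -/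
lemma HasExpansion.taylorCoeff_eq {f : (Fin n → ℂ) → ℂ} {a : (Fin n → ℕ) → ℂ}
    (h : HasExpansion f a) (k : Fin n → ℕ) : taylorCoeff f k = a k := by
  have hR : (fun _ : Fin n => (1 / 2 : ℝ)) ∈ cube n := fun i => by constructor <;> norm_num
  have h1 : UnitAddTorus.mFourierCoeff (fun θ => f (torusPoint (fun _ => 1 / 2) θ))
      (fun i => (k i : ℤ)) = ∫ θ, (∑' k, (a k * realMonom k fun _ => (1 / 2 : ℝ)) * torusChar k θ) *
        torusChar k (-θ) ∂torusMeasure n := by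
    refine integral_congr_ae (Filter.Eventually.of_forall fun θ => ?_)
    simp only
    rw [h.apply_torusPoint hR, UnitAddTorus.mFourier_neg, torusChar_neg, torusChar_eq_mFourier,
      smul_eq_mul, mul_comm]
  rw [taylorCoeff, h1, integral_trig_mul_torusChar (h.convergentOnCube.summable_norm hR)]
  have h2 : (realMonom k fun _ => (1 / 2 : ℝ)) = ((2 : ℝ) ^ ∑ i, k i)⁻¹ := by
    simp [realMonom, Finset.prod_pow_eq_pow_sum]
  rw [h2]
  push_cast
  field_simp

/-! ### Fractional derivatives -/

/-- The multiplier `∏ⱼ (kⱼ + m choose m)` of the operator `D^m`. -/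
def binomCoeff (m : ℕ) (k : Fin n → ℕ) : ℕ := ∏ i, (k i + m).choose m

lemma prod_Gamma_eq_binomCoeff (m : ℕ) (k : Fin n → ℕ) :
    (∏ i, Real.Gamma (k i + m + 1) / (Real.Gamma (m + 1) * Real.Gamma (k i + 1)) : ℝ) =
      binomCoeff m k := by
  rw [binomCoeff, Nat.cast_prod]
  refine Finset.prod_congr rfl fun i _ => ?_
  rw [← Nat.cast_add, Real.Gamma_nat_eq_factorial, Real.Gamma_nat_eq_factorial,
    Real.Gamma_nat_eq_factorial, Nat.cast_choose ℝ (Nat.le_add_left _ _), Nat.add_sub_cancel]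

/-- For a natural number `m`, the quotients of Gamma values in `D^m` are binomial coefficients. -/
lemma HasExpansion.fracDeriv_eq {g : (Fin n → ℂ) → ℂ} {c : (Fin n → ℕ) → ℂ}
    (h : HasExpansion g c) (m : ℕ) :
    fracDeriv (m : ℝ) g = powerSeries fun k => (binomCoeff m k : ℂ) * c k := by
  ext z
  refine tsum_congr fun k => ?_
  rw [prod_Gamma_eq_binomCoeff, h.taylorCoeff_eq]
  simp

/-- The coefficients of `D^m` grow polynomially, so they do not affect convergence in the polydisc.
-/
lemma exists_binomCoeff_mul_le (m : ℕ) {R : Fin n → ℝ} (hR : R ∈ cube n) :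
    ∃ M, ∀ k, ‖(binomCoeff m k : ℂ)‖ * realMonom k R ≤ M := by
  have h1 : ∀ x ∈ Ico (0 : ℝ) 1, ∃ M : ℝ, ∀ k : ℕ, ((k + m).choose m : ℝ) * x ^ k ≤ M := by
    intro x hx
    have hs := summable_choose_mul_geometric_of_norm_lt_one m
      (show ‖x‖ < 1 by rw [Real.norm_of_nonneg hx.1]; exact hx.2)
    exact ⟨_, fun k => hs.le_tsum k fun j _ => mul_nonneg (Nat.cast_nonneg _) (pow_nonneg hx.1 _)⟩
  choose! M hM using h1
  refine ⟨∏ i, M (R i), fun k => ?_⟩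
  rw [Complex.norm_natCast, binomCoeff, Nat.cast_prod, realMonom, ← Finset.prod_mul_distrib]
  exact Finset.prod_le_prod (fun i _ => mul_nonneg (Nat.cast_nonneg _) (pow_nonneg (hR i).1 _))
    fun i _ => hM _ (hR i) _

lemma ConvergentOnCube.binomCoeff_mul {A : (Fin n → ℕ) → ℂ} (hA : ConvergentOnCube A) (m : ℕ) :
    ConvergentOnCube fun k => (binomCoeff m k : ℂ) * A k :=
  hA.mul fun _ hR => exists_binomCoeff_mul_le m hR

/-- The product of absolutely convergent series of one index each is a series over the vectors of
indices. -/
lemma hasSum_pi_prod {n : ℕ} {f : Fin n → ℕ → ℂ} {a : Fin n → ℂ}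
    (hs : ∀ i, Summable fun j => ‖f i j‖) (ha : ∀ i, HasSum (f i) (a i)) :
    (Summable fun k : Fin n → ℕ => ‖∏ i, f i (k i)‖) ∧
      HasSum (fun k : Fin n → ℕ => ∏ i, f i (k i)) (∏ i, a i) := by
  induction n with
  | zero =>
    refine ⟨Summable.of_finite, ?_⟩
    simp
  | succ n ih =>
    obtain ⟨h1, h2⟩ := ih (fun i => hs i.succ) (fun i => ha i.succ)
    have h3 := summable_mul_of_summable_norm (hs 0) h1
    have h4 := (hs 0).mul_norm h1
    have h5 := (ha 0).mul h2 h3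
    rw [Fin.prod_univ_succ]
    constructor
    · refine ((Fin.consEquiv fun _ : Fin (n + 1) => ℕ).summable_iff).1 (h4.congr fun x => ?_)
      simp [Fin.consEquiv, Fin.prod_univ_succ]
    · refine ((Fin.consEquiv fun _ : Fin (n + 1) => ℕ).hasSum_iff).1 ?_
      have h6 : (fun k : Fin (n + 1) → ℕ => ∏ i, f i (k i)) ∘ (Fin.consEquiv fun _ => ℕ) =
          fun x : ℕ × (Fin n → ℕ) => f 0 x.1 * ∏ i, f i.succ (x.2 i) := by
        ext x; simp [Fin.consEquiv, Fin.prod_univ_succ]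
      rw [h6]; exact h5

/-- The functions `∏ⱼ (1 - rⱼ zⱼ)^{-(m+1)}`. The multiplier with coefficients `cₖ` maps such a
function to the dilate `z ↦ D^m g(rz)`. -/
noncomputable def testFun (m : ℕ) (r : Fin n → ℝ) (z : Fin n → ℂ) : ℂ :=
  ∏ i, 1 / (1 - r i * z i) ^ (m + 1)

lemma hasExpansion_testFun (m : ℕ) {r : Fin n → ℝ} (hr : ∀ i, r i ∈ Icc (0 : ℝ) 1) :
    HasExpansion (testFun m r) fun k => (binomCoeff m k : ℂ) * realMonom k r := by
  intro z hz
  have hx : ∀ i, ‖(r i : ℂ) * z i‖ < 1 := fun i => by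
    rw [norm_mul, Complex.norm_real, Real.norm_of_nonneg (hr i).1]
    exact mul_lt_one_of_nonneg_of_lt_one_right (hr i).2 (norm_nonneg _) (hz i)
  have h := (hasSum_pi_prod
    (f := fun i j => ((j + m).choose m : ℂ) * ((r i : ℂ) * z i) ^ j)
    (fun i => (summable_choose_mul_geometric_of_norm_lt_one m (hx i)).norm)
    fun i => hasSum_choose_mul_geometric_of_norm_lt_one m (hx i)).2
  convert h using 2 with k
  · simp [binomCoeff, realMonom, monom, mul_pow, Finset.prod_mul_distrib, mul_assoc]
  · rfl

/-! ### The integral representation of a coefficient product -/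

lemma intervalIntegral_moment (m k : ℕ) :
    ∫ x in (0 : ℝ)..1, 2 * (m + 1) * x * (1 - x ^ 2) ^ m * x ^ (2 * k) =
      1 / ((k + (m + 1)).choose (m + 1) : ℝ) := by
  induction k generalizing m with
  | zero =>
    have h := intervalIntegral.integral_eq_sub_of_hasDerivAt (a := 0) (b := 1)
      (f := fun x : ℝ => -(1 - x ^ 2) ^ (m + 1))
      (f' := fun x => 2 * (m + 1) * x * (1 - x ^ 2) ^ m * x ^ (2 * 0)) (fun x _ => ?_)
      (Continuous.intervalIntegrable (by fun_prop) _ _)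
    · rw [h]; simp
    · have h1 := (((hasDerivAt_pow 2 x).const_sub 1).pow (m + 1)).neg
      refine h1.congr_deriv ?_
      push_cast
      simp
      ring
  | succ k ih =>
    have h := intervalIntegral.integral_eq_sub_of_hasDerivAt (a := 0) (b := 1)
      (f := fun x : ℝ => x ^ (2 * k + 2) * (1 - x ^ 2) ^ (m + 2 - 1))
      (f' := fun x => (k + 1) / (m + 2) * (2 * ((m + 1 : ℕ) + 1) * x * (1 - x ^ 2) ^ (m + 1) *
        x ^ (2 * k)) - 2 * (m + 1) * x * (1 - x ^ 2) ^ m * x ^ (2 * (k + 1))) (fun x _ => ?_)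
      (Continuous.intervalIntegrable (by fun_prop) _ _)
    · rw [intervalIntegral.integral_sub (Continuous.intervalIntegrable (by fun_prop) _ _)
        (Continuous.intervalIntegrable (by fun_prop) _ _), intervalIntegral.integral_const_mul,
        ih (m + 1)] at h
      simp only [one_pow, sub_self, ne_eq, Nat.add_eq_zero_iff, OfNat.ofNat_ne_zero, and_false,
        not_false_eq_true, zero_pow, zero_mul] at h
      have h2 : (0 : ℝ) ^ (m + 2 - 1) = 0 := by simp
      rw [h2, mul_zero, sub_self] at h
      rw [← sub_eq_zero.1 h]
      have h3 := Nat.choose_succ_right_eq (k + (m + 1 + 1)) (m + 1)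
      rw [show k + (m + 1 + 1) - (m + 1) = k + 1 by omega] at h3
      have h4 : ((k + (m + 1 + 1)).choose (m + 1 + 1) : ℝ) * (m + 2) =
          (k + (m + 1 + 1)).choose (m + 1) * (k + 1) := by exact_mod_cast h3
      rw [show k + 1 + (m + 1) = k + (m + 1 + 1) by ring]
      have h5 : ((k + (m + 1 + 1)).choose (m + 1 + 1) : ℝ) ≠ 0 :=
        Nat.cast_ne_zero.2 (Nat.choose_pos (by omega)).ne'
      have h6 : ((k + (m + 1 + 1)).choose (m + 1) : ℝ) ≠ 0 :=
        Nat.cast_ne_zero.2 (Nat.choose_pos (by omega)).ne'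
      have h7 : (m + 2 : ℝ) ≠ 0 := by positivity
      rw [mul_one_div, div_div, div_eq_div_iff (by positivity) h6]
      linarith
    · have h1 := (hasDerivAt_pow (2 * k + 2) x).mul
        (((hasDerivAt_pow 2 x).const_sub 1).pow (m + 2 - 1))
      refine h1.congr_deriv ?_
      have h7 : (m + 2 : ℝ) ≠ 0 := by positivity
      simp only [Nat.add_succ_sub_one, Pi.pow_apply]
      push_cast
      field_simp
      ring

/-- The kernel on the radii with moments `∫ ρ^{2k} = 1 / ∏ⱼ (kⱼ + m + 1 choose m + 1)`. The
index is shifted: the kernel that inverts `D^m` is `momentKernel (m - 1)`. -/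
def momentKernel (m : ℕ) (ρ : Fin n → ℝ) : ℝ := ∏ i, (2 * (m + 1) * ρ i * (1 - ρ i ^ 2) ^ m)

lemma momentKernel_nonneg (m : ℕ) {ρ : Fin n → ℝ} (hρ : ρ ∈ cube n) : 0 ≤ momentKernel m ρ :=
  Finset.prod_nonneg fun i _ => by
    have h := hρ i
    have h1 : 0 ≤ 1 - ρ i ^ 2 := by nlinarith [h.1, h.2]
    have := h.1
    positivity

lemma continuous_momentKernel (m : ℕ) : Continuous (momentKernel (n := n) m) := by
  unfold momentKernel; fun_prop

lemma momentKernel_le (m : ℕ) {ρ : Fin n → ℝ} (hρ : ρ ∈ cube n) :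
    ENNReal.ofReal (momentKernel m ρ) ≤
      ENNReal.ofReal ((2 * (m + 1) * 2 ^ m) ^ n) * weight (m : ℝ) ρ := by
  rw [weight, ← ENNReal.ofReal_mul (by positivity)]
  refine ENNReal.ofReal_le_ofReal ?_
  have h : ((2 * (m + 1) * 2 ^ m : ℝ) ^ n) = ∏ _i : Fin n, (2 * (m + 1) * 2 ^ m : ℝ) := by simp
  rw [h, ← Finset.prod_mul_distrib, momentKernel]
  refine Finset.prod_le_prod (fun i _ => ?_) fun i _ => ?_
  · have h := hρ i
    have h1 : 0 ≤ 1 - ρ i ^ 2 := by nlinarith [h.1, h.2]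
    have := h.1
    positivity
  · have h := hρ i
    have h1 : 0 ≤ 1 - ρ i ^ 2 := by nlinarith [h.1, h.2]
    have h2 : 0 ≤ 1 - ρ i := by linarith [h.2]
    rw [Real.rpow_natCast]
    calc 2 * (m + 1) * ρ i * (1 - ρ i ^ 2) ^ m ≤ 2 * (m + 1) * 1 * (2 * (1 - ρ i)) ^ m := by
          have h3 := h.1
          gcongr
          · exact h.2.le
          · nlinarith [h.1, h.2]
      _ = _ := by rw [mul_pow]; ring

lemma integral_momentKernel_mul (m : ℕ) (k : Fin n → ℕ) :
    ∫ ρ in cube n, momentKernel m ρ * (realMonom k ρ * realMonom k ρ) =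
      1 / (binomCoeff (m + 1) k : ℝ) := by
  have h : ∀ ρ : Fin n → ℝ, momentKernel m ρ * (realMonom k ρ * realMonom k ρ) =
      ∏ i, (2 * (m + 1) * ρ i * (1 - ρ i ^ 2) ^ m * ρ i ^ (2 * k i)) := fun ρ => by
    simp only [momentKernel, realMonom, ← Finset.prod_mul_distrib, two_mul, pow_add]
  simp_rw [h]
  rw [volume_restrict_cube, integral_fintype_prod_eq_prod (𝕜 := ℝ)
    (fun i x => 2 * (m + 1) * x * (1 - x ^ 2) ^ m * x ^ (2 * k i))]
  rw [binomCoeff, Nat.cast_prod, one_div, ← Finset.prod_inv_distrib]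
  refine Finset.prod_congr rfl fun i _ => ?_
  rw [← one_div, ← intervalIntegral_moment, intervalIntegral.integral_of_le zero_le_one,
    integral_Ioc_eq_integral_Ioo, integral_Ico_eq_integral_Ioo]

/-- The value at `Rξ` of the function with coefficients `cₖ aₖ` is an average over the radii `ρ`,
with weight `(1 - ρ)^{m-1}`, of the convolutions `∫ D^m g(Rρη) f(ρξη̄) dη`: these have the
coefficients `(kⱼ + m choose m) cₖ aₖ ρ^{2k} R^k`, and `momentKernel` removes the binomial factors.
-/
lemma enorm_le_lintegral_convolution {G f h : (Fin n → ℂ) → ℂ} {a c : (Fin n → ℕ) → ℂ} {m : ℕ}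
    (hm : 1 ≤ m) (hf : HasExpansion f a)
    (hG : HasExpansion G fun k => (binomCoeff m k : ℂ) * c k)
    (hh : HasExpansion h fun k => c k * a k) {R : Fin n → ℝ} (hR : R ∈ cube n)
    (ξ : UnitAddTorus (Fin n)) :
    ‖h (torusPoint R ξ)‖ₑ ≤ ENNReal.ofReal ((m * 2 ^ m) ^ n) * ∫⁻ ρ in cube n,
      (∫⁻ η, ‖G (torusPoint (R * ρ) η) * f (torusPoint ρ (ξ - η))‖ₑ ∂torusMeasure n) *
        weight (m - 1 : ℝ) ρ := by
  obtain ⟨m, rfl⟩ := Nat.exists_eq_add_of_le' hm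
  set u : (Fin n → ℕ) → ℂ := fun k => c k * a k * realMonom k R * torusChar k ξ with hu
  have hsum : Summable fun k => ‖u k‖ := by
    refine (hh.convergentOnCube.summable_norm hR).congr fun k => ?_
    rw [hu]; simp only; rw [norm_mul _ (torusChar k ξ), norm_torusChar, mul_one]
  have hker : ∀ k : Fin n → ℕ, Integrable (fun ρ : Fin n → ℝ =>
      momentKernel m ρ * (realMonom k ρ * realMonom k ρ)) (volume.restrict (cube n)) := by
    intro k
    have hcont : Continuous fun ρ : Fin n → ℝ =>
        momentKernel m ρ * (realMonom k ρ * realMonom k ρ) :=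
      (continuous_momentKernel m).mul ((continuous_realMonom k).mul (continuous_realMonom k))
    have hsub : cube n ⊆ Icc 0 1 := fun ρ hρ => ⟨fun i => (hρ i).1, fun i => (hρ i).2.le⟩
    exact (hcont.continuousOn.integrableOn_compact isCompact_Icc).mono_set hsub
  set v : (Fin n → ℕ) → (Fin n → ℝ) → ℂ := fun k ρ => (binomCoeff (m + 1) k : ℂ) * u k *
    ((momentKernel m ρ * (realMonom k ρ * realMonom k ρ) : ℝ) : ℂ) with hv
  have hb0 : ∀ k : Fin n → ℕ, (binomCoeff (m + 1) k : ℝ) ≠ 0 := fun k =>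
    Nat.cast_ne_zero.2 (Finset.prod_ne_zero_iff.2 fun i _ =>
      (Nat.choose_pos (Nat.le_add_left _ _)).ne')
  have hvi : ∀ k, Integrable (v k) (volume.restrict (cube n)) := fun k =>
    (hker k).ofReal.const_mul _
  have hv1 : ∀ k, ∫ ρ in cube n, v k ρ = u k := by
    intro k
    simp only [hv]
    rw [integral_const_mul, integral_complex_ofReal, integral_momentKernel_mul]
    have : (binomCoeff (m + 1) k : ℂ) ≠ 0 := by exact_mod_cast hb0 k
    push_cast
    field_simp
  have hv2 : ∀ k, ∫ ρ in cube n, ‖v k ρ‖ = ‖u k‖ := by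
    intro k
    have h1 : ∫ ρ in cube n, ‖v k ρ‖ = ∫ ρ in cube n, (binomCoeff (m + 1) k : ℝ) * ‖u k‖ *
        (momentKernel m ρ * (realMonom k ρ * realMonom k ρ)) := by
      refine setIntegral_congr_fun (measurableSet_cube n) fun ρ hρ => ?_
      simp only [hv]
      rw [norm_mul, norm_mul, Complex.norm_natCast, Complex.norm_real, Real.norm_of_nonneg]
      exact mul_nonneg (momentKernel_nonneg m hρ)
        (mul_nonneg (realMonom_nonneg k hρ) (realMonom_nonneg k hρ))
    rw [h1, integral_const_mul, integral_momentKernel_mul]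
    have := hb0 k
    field_simp
  -- the series of kernels may be integrated term by term over the radii
  have h1 := hasSum_integral_of_summable_integral_norm hvi (by simpa only [hv2] using hsum)
  simp only [hv1] at h1
  have h2 : h (torusPoint R ξ) = ∫ ρ in cube n, ∑' k, v k ρ := by
    rw [hh.apply_torusPoint hR]
    exact h1.tsum_eq
  -- by Parseval's formula the sum over `k` is a convolution on the torus
  have h3 : ∀ ρ ∈ cube n, ∑' k, v k ρ = (momentKernel m ρ : ℂ) *
      ∫ η, G (torusPoint (R * ρ) η) * f (torusPoint ρ (ξ - η)) ∂torusMeasure n := by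
    intro ρ hρ
    have hRρ := mul_mem_cube hR hρ
    simp_rw [hG.apply_torusPoint hRρ, hf.apply_torusPoint hρ]
    rw [integral_trig_mul_trig (hG.convergentOnCube.summable_norm hRρ)
      (hf.convergentOnCube.summable_norm hρ), ← tsum_mul_left]
    refine tsum_congr fun k => ?_
    simp only [hv, hu, realMonom_mul]
    push_cast
    ring
  rw [h2]
  refine (enorm_integral_le_lintegral_enorm _).trans ?_
  have h4 : ∫⁻ ρ in cube n, ‖∑' k, v k ρ‖ₑ ≤ ∫⁻ ρ in cube n,
      ENNReal.ofReal ((2 * (m + 1) * 2 ^ m) ^ n) *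
      ((∫⁻ η, ‖G (torusPoint (R * ρ) η) * f (torusPoint ρ (ξ - η))‖ₑ ∂torusMeasure n) *
        weight (m : ℝ) ρ) := by
    refine setLIntegral_mono' (measurableSet_cube n) fun ρ hρ => ?_
    rw [h3 ρ hρ, enorm_mul]
    have h5 : ‖(momentKernel m ρ : ℂ)‖ₑ = ENNReal.ofReal (momentKernel m ρ) := by
      rw [← ofReal_norm, Complex.norm_real, Real.norm_of_nonneg (momentKernel_nonneg m hρ)]
    rw [h5]
    calc _ ≤ (ENNReal.ofReal ((2 * (m + 1) * 2 ^ m) ^ n) * weight (m : ℝ) ρ) *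
          ∫⁻ η, ‖G (torusPoint (R * ρ) η) * f (torusPoint ρ (ξ - η))‖ₑ ∂torusMeasure n :=
          mul_le_mul' (momentKernel_le m hρ) (enorm_integral_le_lintegral_enorm _)
      _ = _ := by ring
  refine h4.trans (le_of_eq ?_)
  rw [lintegral_const_mul' _ _ ENNReal.ofReal_ne_top]
  push_cast
  rw [add_sub_cancel_right, show (2 * (m + 1) * 2 ^ m : ℝ) = (m + 1) * 2 ^ (m + 1) by ring]

/-! ### Sufficiency of the condition -/

/-- The function `z ↦ G(Rz) · conj f(ξ z̄)`, which is holomorphic; its modulus at `ρη` is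
`|G(Rρη)| |f(ρξη̄)|`, the integrand of `enorm_le_lintegral_convolution`. -/
noncomputable def convolutionIntegrand (G f : (Fin n → ℂ) → ℂ) (R : Fin n → ℝ)
    (ξ : UnitAddTorus (Fin n)) (z : Fin n → ℂ) : ℂ :=
  G (fun i => R i * z i) *
    (starRingEnd ℂ) (f fun i => circlePoint (ξ i) * (starRingEnd ℂ) (z i))

lemma convolutionIntegrand_torusPoint (G f : (Fin n → ℂ) → ℂ) (R : Fin n → ℝ)
    (ξ : UnitAddTorus (Fin n)) (ρ : Fin n → ℝ) (η : UnitAddTorus (Fin n)) :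
    ‖convolutionIntegrand G f R ξ (torusPoint ρ η)‖ₑ =
      ‖G (torusPoint (R * ρ) η) * f (torusPoint ρ (ξ - η))‖ₑ := by
  have h1 : (fun i => (R i : ℂ) * torusPoint ρ η i) = torusPoint (R * ρ) η := by
    ext i; simp [torusPoint_apply, mul_assoc]
  have h2 : (fun i => circlePoint (ξ i) * (starRingEnd ℂ) (torusPoint ρ η i)) =
      torusPoint ρ (ξ - η) := by
    ext i
    have h : (ξ - η) i = ξ i + -η i := sub_eq_add_neg _ _
    simp only [torusPoint_apply, map_mul, Complex.conj_ofReal, h, circlePoint_add, circlePoint_neg]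
    ring
  rw [convolutionIntegrand, h1, h2, enorm_mul, enorm_mul, RCLike.enorm_conj]

lemma convolutionIntegrand_mem_Hol {G f : (Fin n → ℂ) → ℂ} (hG : G ∈ Hol n)
    {a : (Fin n → ℕ) → ℂ} (hf : HasExpansion f a) {R : Fin n → ℝ} (hR : R ∈ cube n)
    (ξ : UnitAddTorus (Fin n)) : convolutionIntegrand G f R ξ ∈ Hol n := by
  have h1 : DifferentiableOn ℂ (fun z : Fin n → ℂ => G fun i => R i * z i) (polydisc n) := by
    refine DifferentiableOn.comp (g := G) (t := polydisc n) hG (by fun_prop) fun z hz i => ?_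
    rw [norm_mul, Complex.norm_real, Real.norm_of_nonneg (hR i).1]
    exact mul_lt_one_of_nonneg_of_lt_one_left (hR i).1 (hR i).2 (hz i).le
  have hA : ConvergentOnCube fun k => (starRingEnd ℂ) (a k * torusChar k ξ) := fun R hR => by
    refine (hf.convergentOnCube R hR).congr fun k => ?_
    rw [RCLike.norm_conj, norm_mul, norm_torusChar, mul_one]
  refine DifferentiableOn.mul h1 (hA.mem_Hol.congr fun z hz => ?_)
  have hw : (fun i => circlePoint (ξ i) * (starRingEnd ℂ) (z i)) ∈ polydisc n := fun i => by
    simpa using hz i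
  rw [← (hf _ hw).tsum_eq, powerSeries, Complex.conj_tsum]
  refine tsum_congr fun k => ?_
  simp only [monom, torusChar, map_mul, map_prod, map_pow, mul_pow, Finset.prod_mul_distrib,
    Complex.conj_conj]
  ring

lemma measurable_convolutionIntegrand {G f : (Fin n → ℂ) → ℂ} (hG : Measurable G)
    (hf : Measurable f) (R : Fin n → ℝ) (ξ : UnitAddTorus (Fin n)) :
    Measurable (convolutionIntegrand G f R ξ) := by
  have h1 : Measurable fun z : Fin n → ℂ => fun i => (R i : ℂ) * z i :=
    (by fun_prop : Continuous fun z : Fin n → ℂ => fun i => (R i : ℂ) * z i).measurable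
  have h2 : Measurable fun z : Fin n → ℂ => fun i => circlePoint (ξ i) * (starRingEnd ℂ) (z i) :=
    (by fun_prop : Continuous fun z : Fin n → ℂ =>
      fun i => circlePoint (ξ i) * (starRingEnd ℂ) (z i)).measurable
  exact (hG.comp h1).mul (Complex.continuous_conj.measurable.comp (hf.comp h2))

/-- For `t ≤ 1` the integral representation becomes an inequality between `t`-th powers, since the
holomorphic function `convolutionIntegrand` lies in `A^{1,1}_m` with a norm controlled by the one in
`A^{t,t}_{m+1-1/t}`. Integration in `ξ` then separates the means of `G` and of `f`. -/
lemma exists_powMean_le_convolution (n : ℕ) {t : ℝ} (ht : 0 < t) (ht1 : t ≤ 1) {m : ℕ}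
    (hm : 1 ≤ m) :
    ∃ K : ℝ≥0∞, K ≠ ∞ ∧ ∀ (G f h : (Fin n → ℂ) → ℂ) (a c : (Fin n → ℕ) → ℂ), Measurable G →
      Measurable f → G ∈ Hol n → HasExpansion f a →
      HasExpansion G (fun k => (binomCoeff m k : ℂ) * c k) → HasExpansion h (fun k => c k * a k) →
      ∀ R ∈ cube n, powMean t h R ≤ K * ∫⁻ ρ in cube n,
        powMean t G (R * ρ) * powMean t f ρ * weight ((m + 1) * t - 2) ρ := by
  obtain ⟨C, hC, hemb⟩ := mixedIntegral_le n (p := t) (q := t) (t := 1) (s := 1) (m + 1 - 1 / t)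
    ht ht ht1 ht1
  set D := ENNReal.ofReal ((m * 2 ^ m) ^ n) with hD
  refine ⟨(D * C) ^ t, ENNReal.rpow_ne_top_of_nonneg ht.le (by finiteness), ?_⟩
  intro G f h a c hGm hfm hG hf hGc hh R hR
  set Ψ : (Fin n → ℝ) → UnitAddTorus (Fin n) → UnitAddTorus (Fin n) → ℝ≥0∞ := fun ρ ξ η =>
    ‖G (torusPoint (R * ρ) η)‖ₑ ^ t * ‖f (torusPoint ρ (ξ - η))‖ₑ ^ t with hΨ
  have hpt : ∀ ξ, ‖h (torusPoint R ξ)‖ₑ ^ t ≤ (D * C) ^ t * ∫⁻ ρ in cube n,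
      (∫⁻ η, Ψ ρ ξ η ∂torusMeasure n) * weight ((m + 1) * t - 2) ρ := by
    intro ξ
    set F := convolutionIntegrand G f R ξ with hF
    have h1 := enorm_le_lintegral_convolution hm hf hGc hh hR ξ
    have h2 := hemb F (convolutionIntegrand_mem_Hol hG hf hR ξ)
      (measurable_convolutionIntegrand hGm hfm R ξ)
    have h3 : mixedIntegral 1 1 (m + 1 - 1 / t + 1 / t - 1 / 1) F = ∫⁻ ρ in cube n,
        (∫⁻ η, ‖G (torusPoint (R * ρ) η) * f (torusPoint ρ (ξ - η))‖ₑ ∂torusMeasure n) *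
          weight (m - 1 : ℝ) ρ := by
      refine lintegral_congr fun ρ => ?_
      simp only [intMean, ENNReal.rpow_one, div_one, hF, convolutionIntegrand_torusPoint]
      congr 2
      ring
    have h4 : mixedIntegral t t (m + 1 - 1 / t) F = ∫⁻ ρ in cube n,
        (∫⁻ η, Ψ ρ ξ η ∂torusMeasure n) * weight ((m + 1) * t - 2) ρ := by
      refine lintegral_congr fun ρ => ?_
      rw [intMean, ← ENNReal.rpow_mul, one_div_mul_cancel ht.ne', ENNReal.rpow_one]
      simp only [hF, convolutionIntegrand_torusPoint, enorm_mul,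
        ENNReal.mul_rpow_of_nonneg _ _ ht.le]
      congr 2
      field_simp
      ring
    rw [h3, h4] at h2
    calc ‖h (torusPoint R ξ)‖ₑ ^ t ≤ (D * (C * (∫⁻ ρ in cube n,
        (∫⁻ η, Ψ ρ ξ η ∂torusMeasure n) * weight ((m + 1) * t - 2) ρ) ^ (1 / t))) ^ t :=
          ENNReal.rpow_le_rpow (h1.trans (mul_le_mul' le_rfl h2)) ht.le
      _ = _ := by
          rw [← mul_assoc, ENNReal.mul_rpow_of_nonneg _ _ ht.le, ← ENNReal.rpow_mul,
            one_div_mul_cancel ht.ne', ENNReal.rpow_one]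
  have hGt : Measurable fun b : (Fin n → ℝ) × UnitAddTorus (Fin n) =>
      ‖G (torusPoint (R * b.1) b.2)‖ₑ ^ t := by
    have hg : Measurable fun b : (Fin n → ℝ) × UnitAddTorus (Fin n) => (R * b.1, b.2) :=
      (by fun_prop : Continuous fun b : (Fin n → ℝ) × UnitAddTorus (Fin n) =>
        (R * b.1, b.2)).measurable
    have h1 := (measurable_enorm_comp_rpow hGm t).comp hg
    exact h1
  have hΨm : Measurable fun b : ((Fin n → ℝ) × UnitAddTorus (Fin n)) × UnitAddTorus (Fin n) =>
      Ψ b.1.1 b.1.2 b.2 := by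
    have hg1 : Measurable fun b : ((Fin n → ℝ) × UnitAddTorus (Fin n)) × UnitAddTorus (Fin n) =>
      (b.1.1, b.2) := by fun_prop
    have hg2 : Measurable fun b : ((Fin n → ℝ) × UnitAddTorus (Fin n)) × UnitAddTorus (Fin n) =>
      (b.1.1, b.1.2 - b.2) := by fun_prop
    have h1 := hGt.comp hg1
    have h2 := (measurable_enorm_comp_rpow hfm t).comp hg2
    exact h1.mul h2
  have hΨ2 : Measurable fun b : (Fin n → ℝ) × UnitAddTorus (Fin n) =>
      (∫⁻ η, Ψ b.1 b.2 η ∂torusMeasure n) * weight ((m + 1) * t - 2) b.1 :=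
    hΨm.lintegral_prod_right'.mul ((measurable_weight _).comp measurable_fst)
  have hΨ3 : Measurable fun b : UnitAddTorus (Fin n) × (Fin n → ℝ) =>
      (∫⁻ η, Ψ b.2 b.1 η ∂torusMeasure n) * weight ((m + 1) * t - 2) b.2 := by
    have h1 := hΨ2.comp measurable_swap
    exact h1
  have hin : ∀ ρ, ∫⁻ ξ, ∫⁻ η, Ψ ρ ξ η ∂torusMeasure n ∂torusMeasure n =
      powMean t G (R * ρ) * powMean t f ρ := by
    intro ρ
    have hm1 : Measurable fun b : UnitAddTorus (Fin n) × UnitAddTorus (Fin n) => Ψ ρ b.1 b.2 := by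
      have hg : Measurable fun b : UnitAddTorus (Fin n) × UnitAddTorus (Fin n) =>
        ((ρ, b.1), b.2) := by fun_prop
      have h1 := hΨm.comp hg
      exact h1
    rw [lintegral_lintegral_swap hm1.aemeasurable]
    have h2 : ∀ η, ∫⁻ ξ, Ψ ρ ξ η ∂torusMeasure n =
        ‖G (torusPoint (R * ρ) η)‖ₑ ^ t * powMean t f ρ := by
      intro η
      have hm2 : Measurable fun ξ : UnitAddTorus (Fin n) => ‖f (torusPoint ρ (ξ - η))‖ₑ ^ t := by
        have hg : Measurable fun ξ : UnitAddTorus (Fin n) => (ρ, ξ - η) := by fun_prop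
        have h1 := (measurable_enorm_comp_rpow hfm t).comp hg
        exact h1
      simp only [hΨ]
      rw [lintegral_const_mul _ hm2, lintegral_sub_right_eq_self (μ := torusMeasure n)
        (fun ξ => ‖f (torusPoint ρ ξ)‖ₑ ^ t)]
      rfl
    simp_rw [h2]
    have hm3 : Measurable fun η : UnitAddTorus (Fin n) => ‖G (torusPoint (R * ρ) η)‖ₑ ^ t := by
      have hg : Measurable fun η : UnitAddTorus (Fin n) => (ρ, η) := measurable_prodMk_left
      have h1 := hGt.comp hg
      exact h1
    rw [lintegral_mul_const _ hm3]
    rfl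
  calc powMean t h R ≤ ∫⁻ ξ, (D * C) ^ t * ∫⁻ ρ in cube n,
        (∫⁻ η, Ψ ρ ξ η ∂torusMeasure n) * weight ((m + 1) * t - 2) ρ ∂volume ∂torusMeasure n :=
        lintegral_mono hpt
    _ = (D * C) ^ t * ∫⁻ ρ in cube n, ∫⁻ ξ, (∫⁻ η, Ψ ρ ξ η ∂torusMeasure n) *
        weight ((m + 1) * t - 2) ρ ∂torusMeasure n := by
        rw [lintegral_const_mul _ hΨ3.lintegral_prod_right',
          lintegral_lintegral_swap hΨ3.aemeasurable]
    _ = _ := by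
        congr 1
        refine lintegral_congr fun ρ => ?_
        rw [lintegral_mul_const' _ _ (weight_ne_top _), hin]

/-- The condition on the means of `D^m g` is sufficient on the space `A^{t,s}_α`, for the value of
`α` in `hα`. After the bound for `M_t(D^m g, Rρ)` is inserted into `exists_powMean_le_convolution`,
the power `s / t ≤ 1` is moved inside the radial integral; the claim follows by integration in `R`
first. -/
lemma mixedIntegral_ne_top_of_bounded {t s β κ α : ℝ} (ht : 0 < t) (ht1 : t ≤ 1) (hs : 0 < s)
    (hst : s ≤ t) (hβ : 0 < β) (hκ : β < κ) {m : ℕ} (hm : 1 ≤ m)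
    (hα : α = β - κ + (m + 1) - 1 / t)
    {G f h : (Fin n → ℂ) → ℂ} {a c : (Fin n → ℕ) → ℂ} (hGm : Measurable G) (hfm : Measurable f)
    (hG : G ∈ Hol n) (hfh : f ∈ Hol n) (hf : HasExpansion f a)
    (hGc : HasExpansion G fun k => (binomCoeff m k : ℂ) * c k)
    (hh : HasExpansion h fun k => c k * a k) {B : ℝ≥0∞} (hB : B ≠ ∞)
    (hbd : ∀ r ∈ cube n, intMean t G r * weight κ r ≤ B) (hfin : mixedIntegral t s α f ≠ ∞) :
    mixedIntegral t s β h ≠ ∞ := by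
  obtain ⟨K, hK, hconv⟩ := exists_powMean_le_convolution n ht ht1 hm
  set γ : ℝ := (m + 1) * t - 2 with hγ
  obtain ⟨C, hC, hquasi⟩ := lintegral_rpow_le_of_quasi_mono n
    (K := ENNReal.ofReal ((4 ^ |γ|) ^ n)) ENNReal.ofReal_ne_top (θ := s / t) (by positivity)
    (by rw [div_le_one ht]; exact hst)
  have hst0 : 0 < s / t := by positivity
  have hG1 : ∀ r ∈ cube n, powMean t G r ≤ B ^ t * weight (-κ * t) r := by
    intro r hr
    have h1 := ENNReal.rpow_le_rpow (hbd r hr) ht.le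
    rw [ENNReal.mul_rpow_of_nonneg _ _ ht.le, intMean_eq, ← ENNReal.rpow_mul,
      one_div_mul_cancel ht.ne', ENNReal.rpow_one, weight_rpow hr] at h1
    calc powMean t G r = powMean t G r * weight (κ * t) r * weight (-κ * t) r := by
          rw [mul_assoc, weight_mul hr]; simp
      _ ≤ _ := mul_le_mul' h1 le_rfl
  set Φ : (Fin n → ℝ) → (Fin n → ℝ) → ℝ≥0∞ := fun R ρ =>
    weight (-κ * t) (R * ρ) * powMean t f ρ * weight γ ρ with hΦ
  have hΦm : ∀ R, Measurable (Φ R) := fun R => by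
    have h1 : Measurable fun ρ : Fin n → ℝ => weight (-κ * t) (R * ρ) :=
      (measurable_weight _).comp (measurable_const.mul measurable_id)
    exact (h1.mul (measurable_powMean hfm t)).mul (measurable_weight γ)
  have hmean : ∀ R ∈ cube n, intMean t h R ^ s ≤ (K * B ^ t) ^ (s / t) *
      (C * ∫⁻ ρ in cube n, Φ R ρ ^ (s / t) * weight (s / t - 1) ρ) := by
    intro R hR
    have h1 : powMean t h R ≤ K * B ^ t * ∫⁻ ρ in cube n, Φ R ρ := by
      refine (hconv G f h a c hGm hfm hG hf hGc hh R hR).trans ?_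
      rw [mul_assoc, ← lintegral_const_mul _ (hΦm R)]
      refine mul_le_mul' le_rfl (setLIntegral_mono' (measurableSet_cube n) fun ρ hρ => ?_)
      calc _ ≤ B ^ t * weight (-κ * t) (R * ρ) * powMean t f ρ * weight γ ρ :=
            mul_le_mul' (mul_le_mul' (hG1 _ (mul_mem_cube hR hρ)) le_rfl) le_rfl
        _ = _ := by rw [hΦ]; ring
    -- both `(1 - Rρ)^{-κt}` and the means of `f` increase with `ρ`
    have h2 := hquasi (Φ R) (hΦm R) fun r hr ρ hρ => by
      have hρc := mem_cube_of_mem_Icc_halfway hr hρ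
      calc Φ R r ≤ weight (-κ * t) (R * ρ) * powMean t f ρ *
            (ENNReal.ofReal ((4 ^ |γ|) ^ n) * weight γ ρ) := by
            refine mul_le_mul' (mul_le_mul' ?_ (powMean_mono hfh ht hr hρc hρ.1))
              (weight_le_of_mem_Icc_halfway hr hρ γ)
            refine weight_mono (mul_mem_cube hR hr) (mul_mem_cube hR hρc)
              (fun i => mul_le_mul_of_nonneg_left (hρ.1 i) (hR i).1) ?_
            nlinarith
        _ = _ := by rw [hΦ]; ring
    calc intMean t h R ^ s = powMean t h R ^ (s / t) := by
          rw [intMean_eq, ← ENNReal.rpow_mul, one_div_mul_eq_div]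
      _ ≤ (K * B ^ t * ∫⁻ ρ in cube n, Φ R ρ) ^ (s / t) := ENNReal.rpow_le_rpow h1 hst0.le
      _ = (K * B ^ t) ^ (s / t) * (∫⁻ ρ in cube n, Φ R ρ) ^ (s / t) :=
          ENNReal.mul_rpow_of_nonneg _ _ hst0.le
      _ ≤ _ := mul_le_mul' le_rfl h2
  set M := (K * B ^ t) ^ (s / t) * C with hM
  have hMt : M ≠ ∞ := by
    have h1 : (K * B ^ t) ^ (s / t) ≠ ∞ := ENNReal.rpow_ne_top_of_nonneg hst0.le
      (ENNReal.mul_ne_top hK (ENNReal.rpow_ne_top_of_nonneg ht.le hB))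
    exact ENNReal.mul_ne_top h1 hC
  set Q : (Fin n → ℝ) → ℝ≥0∞ := fun ρ =>
    intMean t f ρ ^ s * weight (γ * (s / t) + (s / t - 1)) ρ with hQ
  have hQm : Measurable Q := ((measurable_intMean hfm t).pow_const s).mul (measurable_weight _)
  have hΦs : ∀ R ∈ cube n, ∀ ρ ∈ cube n, Φ R ρ ^ (s / t) * weight (s / t - 1) ρ =
      weight (-(κ * s)) (ρ * R) * Q ρ := by
    intro R hR ρ hρ
    simp only [hΦ, hQ]
    rw [ENNReal.mul_rpow_of_nonneg _ _ hst0.le, ENNReal.mul_rpow_of_nonneg _ _ hst0.le,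
      weight_rpow (mul_mem_cube hR hρ), weight_rpow hρ, mul_assoc, weight_mul hρ,
      show -κ * t * (s / t) = -(κ * s) by field_simp, mul_comm R ρ, intMean_eq,
      ← ENNReal.rpow_mul, one_div_mul_eq_div]
    ring
  have hΘm : Measurable fun b : (Fin n → ℝ) × (Fin n → ℝ) =>
      weight (-(κ * s)) (b.2 * b.1) * weight (β * s - 1) b.1 * Q b.2 :=
    (((measurable_weight _).comp (measurable_snd.mul measurable_fst)).mul
      ((measurable_weight _).comp measurable_fst)).mul (hQm.comp measurable_snd)
  have hfinal : mixedIntegral t s β h ≤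
      M * (ENNReal.ofReal (1 / (β * s) + 1 / (κ * s - β * s)) ^ n * mixedIntegral t s α f) := by
    calc mixedIntegral t s β h ≤ ∫⁻ R in cube n, M * ∫⁻ ρ in cube n,
          weight (-(κ * s)) (ρ * R) * weight (β * s - 1) R * Q ρ := by
          refine setLIntegral_mono' (measurableSet_cube n) fun R hR => ?_
          have h1 : ∫⁻ ρ in cube n, Φ R ρ ^ (s / t) * weight (s / t - 1) ρ =
              ∫⁻ ρ in cube n, weight (-(κ * s)) (ρ * R) * Q ρ :=
            setLIntegral_congr_fun (measurableSet_cube n) (hΦs R hR)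
          have h2 : ∫⁻ ρ in cube n, weight (-(κ * s)) (ρ * R) * weight (β * s - 1) R * Q ρ =
              (∫⁻ ρ in cube n, weight (-(κ * s)) (ρ * R) * Q ρ) * weight (β * s - 1) R := by
            rw [← lintegral_mul_const' _ _ (weight_ne_top _)]
            exact lintegral_congr fun ρ => by ring
          rw [h2, ← h1]
          calc _ ≤ _ := mul_le_mul' (hmean R hR) le_rfl
            _ = _ := by rw [hM]; ring
      _ = M * ∫⁻ ρ in cube n, ∫⁻ R in cube n,
          weight (-(κ * s)) (ρ * R) * weight (β * s - 1) R * Q ρ := by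
          rw [lintegral_const_mul _ hΘm.lintegral_prod_right',
            lintegral_lintegral_swap hΘm.aemeasurable]
      _ ≤ M * ∫⁻ ρ in cube n, ENNReal.ofReal (1 / (β * s) + 1 / (κ * s - β * s)) ^ n *
          (intMean t f ρ ^ s * weight (α * s - 1) ρ) := by
          refine mul_le_mul' le_rfl (setLIntegral_mono' (measurableSet_cube n) fun ρ hρ => ?_)
          have hm1 : Measurable fun R : Fin n → ℝ =>
              weight (-(κ * s)) (ρ * R) * weight (β * s - 1) R :=
            ((measurable_weight _).comp (measurable_const.mul measurable_id)).mul
              (measurable_weight _)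
          rw [lintegral_mul_const _ hm1]
          -- here `0 < β < κ` enters
          have h1 := lintegral_weight_mul_le (b := β * s) (A := κ * s) (by positivity)
            (mul_lt_mul_of_pos_right hκ hs) hρ
          calc _ ≤ _ := mul_le_mul' h1 le_rfl
            _ = ENNReal.ofReal (1 / (β * s) + 1 / (κ * s - β * s)) ^ n * (intMean t f ρ ^ s *
                (weight (β * s - κ * s) ρ * weight (γ * (s / t) + (s / t - 1)) ρ)) := by
                simp only [hQ]; ring
            _ = _ := by
                rw [weight_mul hρ]
                congr 3
                rw [hα, hγ]
                field_simp
                ring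
      _ = _ := by
          rw [lintegral_const_mul' _ _ (ENNReal.pow_ne_top ENNReal.ofReal_ne_top)]
          rfl
  refine ne_top_of_le_ne_top ?_ hfinal
  exact ENNReal.mul_ne_top hMt (ENNReal.mul_ne_top (by finiteness) hfin)

/-! ### Norms of the test functions -/

lemma norm_one_sub_pos {x : ℝ} (hx : x ∈ Ico (0 : ℝ) 1) (η : UnitAddCircle) :
    0 < ‖1 - (x : ℂ) * circlePoint η‖ :=
  (sub_pos.2 hx.2).trans_le (one_sub_le_norm hx.1 η)

lemma enorm_testFun_rpow (m : ℕ) {r R : Fin n → ℝ} (hr : r ∈ cube n) (hR : R ∈ cube n)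
    (θ : UnitAddTorus (Fin n)) {p : ℝ} (hp : 0 < p) :
    ‖testFun m r (torusPoint R θ)‖ₑ ^ p =
      ∏ i, ENNReal.ofReal (‖1 - ((r i * R i : ℝ) : ℂ) * circlePoint (θ i)‖ ^ (-((m + 1) * p))) := by
  have hrR := mul_mem_cube hr hR
  rw [← ofReal_norm, ENNReal.ofReal_rpow_of_nonneg (norm_nonneg _) hp.le,
    ← ENNReal.ofReal_prod_of_nonneg fun i _ => Real.rpow_nonneg (norm_nonneg _) _]
  congr 1
  rw [testFun, norm_prod, ← Real.finsetProd_rpow _ _ fun i _ => norm_nonneg _]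
  refine Finset.prod_congr rfl fun i _ => ?_
  have h1 : (r i : ℂ) * torusPoint R θ i = ((r i * R i : ℝ) : ℂ) * circlePoint (θ i) := by
    rw [torusPoint_apply]; push_cast; ring
  have h2 : 0 < ‖1 - ((r i * R i : ℝ) : ℂ) * circlePoint (θ i)‖ := norm_one_sub_pos (hrR i) _
  rw [h1, norm_div, norm_pow, norm_one, one_div, ← Real.rpow_natCast, ← Real.rpow_neg h2.le,
    ← Real.rpow_mul h2.le]
  congr 1
  push_cast
  ring

lemma measurable_norm_rpow (x γ : ℝ) : Measurable fun η : UnitAddCircle =>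
    ENNReal.ofReal (‖1 - (x : ℂ) * circlePoint η‖ ^ γ) := by
  have := continuous_circlePoint.measurable
  fun_prop

/-- The norm of the test function in `A^{p,q}_α` is at most a multiple of
`(1 - r)^{α + 1/p - (m + 1)}`. -/
lemma exists_mixedIntegral_testFun_le (n : ℕ) {p q α : ℝ} (m : ℕ) (hp : 0 < p) (hq : 0 < q)
    (hα : 0 < α) (hm : α + 1 / p < m + 1) : ∃ C : ℝ≥0∞, C ≠ ∞ ∧ ∀ r ∈ cube n,
      mixedIntegral p q α (testFun m r) ≤ C * weight ((α + 1 / p - (m + 1)) * q) r := by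
  have hA : 1 < (m + 1) * p := by
    have h1 : 1 / p < m + 1 := by linarith
    rwa [div_lt_iff₀ hp] at h1
  obtain ⟨C, hC, hC1⟩ := exists_lintegral_norm_rpow_le hA
  set b := α * q with hb
  set A := (m + 1 - 1 / p) * q with hA'
  have hbA : b < A := mul_lt_mul_of_pos_right (by linarith) hq
  refine ⟨(C ^ n) ^ (q / p) * ENNReal.ofReal (1 / b + 1 / (A - b)) ^ n, ?_, fun r hr => ?_⟩
  · have h1 : (C ^ n) ^ (q / p) ≠ ∞ := ENNReal.rpow_ne_top_of_nonneg (by positivity) (by finiteness)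
    finiteness
  have hmean : ∀ R ∈ cube n, intMean p (testFun m r) R ^ q ≤
      (C ^ n) ^ (q / p) * weight (-A) (r * R) := by
    intro R hR
    have hrR := mul_mem_cube hr hR
    have h1 : powMean p (testFun m r) R ≤ C ^ n * weight (1 - (m + 1) * p) (r * R) := by
      simp only [powMean, enorm_testFun_rpow m hr hR _ hp]
      rw [torusMeasure, lintegral_pi_prod _ (fun i η => ENNReal.ofReal
        (‖1 - ((r i * R i : ℝ) : ℂ) * circlePoint η‖ ^ (-((m + 1) * p))))
        fun i => measurable_norm_rpow _ _, weight_eq_prod hrR]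
      calc _ ≤ ∏ i : Fin n, C * ENNReal.ofReal ((1 - (r * R) i) ^ (1 - (m + 1) * p)) :=
            Finset.prod_le_prod' fun i _ => hC1 _ (hrR i)
        _ = _ := by rw [Finset.prod_mul_distrib]; simp
    calc intMean p (testFun m r) R ^ q = powMean p (testFun m r) R ^ (q / p) := by
          rw [intMean_eq, ← ENNReal.rpow_mul, one_div_mul_eq_div]
      _ ≤ (C ^ n * weight (1 - (m + 1) * p) (r * R)) ^ (q / p) :=
          ENNReal.rpow_le_rpow h1 (by positivity)
      _ = _ := by
          rw [ENNReal.mul_rpow_of_nonneg _ _ (by positivity), weight_rpow hrR]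
          congr 2
          rw [hA']; field_simp; ring
  calc mixedIntegral p q α (testFun m r) ≤ ∫⁻ R in cube n, (C ^ n) ^ (q / p) *
        (weight (-A) (r * R) * weight (b - 1) R) := by
        refine setLIntegral_mono' (measurableSet_cube n) fun R hR => ?_
        rw [← mul_assoc]
        exact mul_le_mul' (hmean R hR) le_rfl
    _ ≤ (C ^ n) ^ (q / p) * (ENNReal.ofReal (1 / b + 1 / (A - b)) ^ n * weight (b - A) r) := by
        rw [lintegral_const_mul' _ _ (ENNReal.rpow_ne_top_of_nonneg (by positivity)
          (by finiteness))]
        exact mul_le_mul' le_rfl (lintegral_weight_mul_le (by positivity) hbA hr)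
    _ = _ := by
        rw [mul_assoc]
        congr 3
        rw [hb, hA']; ring

/-- The norm of the test function in `F^{p,q}_α` obeys the same bound as in `A^{p,q}_α`. The radial
integral is taken first; it turns `|1 - rRξ|^{-(m+1)q}` into `|1 - rξ|^{(α-m-1)q}`. -/
lemma exists_triebelIntegral_testFun_le (n : ℕ) {p q α : ℝ} (m : ℕ) (hp : 0 < p) (hq : 0 < q)
    (hα : 0 < α) (hm : α + 1 / p < m + 1) : ∃ C : ℝ≥0∞, C ≠ ∞ ∧ ∀ r ∈ cube n,
      triebelIntegral p q α (testFun m r) ≤ C * weight ((α + 1 / p - (m + 1)) * p) r := by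
  set A := (m + 1 - α) * p with hA'
  have hA : 1 < A := by
    have h1 : 1 / p < m + 1 - α := by linarith
    rwa [div_lt_iff₀ hp] at h1
  obtain ⟨C, hC, hC1⟩ := exists_lintegral_norm_rpow_le hA
  set b := α * q with hb
  set B := (m + 1) * q with hB
  have hbB : b < B := mul_lt_mul_of_pos_right (by have : 0 < 1 / p := by positivity
                                                  linarith) hq
  set D := ENNReal.ofReal (1 / b + 1 / (B - b)) with hD
  have hpq : 0 ≤ p / q := by positivity
  refine ⟨(D ^ n) ^ (p / q) * (ENNReal.ofReal (2 ^ A) * C) ^ n, ?_, fun r hr => ?_⟩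
  · have h1 : (D ^ n) ^ (p / q) ≠ ∞ := ENNReal.rpow_ne_top_of_nonneg hpq (by finiteness)
    finiteness
  have hin : ∀ θ, (∫⁻ R in cube n, ‖testFun m r (torusPoint R θ)‖ₑ ^ q * weight (α * q - 1) R) ^
      (p / q) ≤ (D ^ n) ^ (p / q) * ∏ i, (ENNReal.ofReal (2 ^ A) *
        ENNReal.ofReal (‖1 - (r i : ℂ) * circlePoint (θ i)‖ ^ (-A))) := by
    intro θ
    have h1 : ∫⁻ R in cube n, ‖testFun m r (torusPoint R θ)‖ₑ ^ q * weight (α * q - 1) R ≤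
        D ^ n * ∏ i, ENNReal.ofReal ((‖1 - (r i : ℂ) * circlePoint (θ i)‖ / 2) ^ (b - B)) := by
      have h2 : ∫⁻ R in cube n, ‖testFun m r (torusPoint R θ)‖ₑ ^ q * weight (α * q - 1) R =
          ∫⁻ R in cube n, ∏ i, (ENNReal.ofReal (‖1 - ((r i * R i : ℝ) : ℂ) *
            circlePoint (θ i)‖ ^ (-B)) * ENNReal.ofReal ((1 - R i) ^ (b - 1))) := by
        refine setLIntegral_congr_fun (measurableSet_cube n) fun R hR => ?_
        rw [enorm_testFun_rpow m hr hR θ hq, weight_eq_prod hR, ← Finset.prod_mul_distrib]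
      rw [h2, lintegral_cube_prod (fun i x => ENNReal.ofReal (‖1 - ((r i * x : ℝ) : ℂ) *
            circlePoint (θ i)‖ ^ (-B)) * ENNReal.ofReal ((1 - x) ^ (b - 1))) fun i => by fun_prop]
      calc _ ≤ ∏ i : Fin n, D * ENNReal.ofReal ((‖1 - (r i : ℂ) * circlePoint (θ i)‖ / 2) ^
              (b - B)) := Finset.prod_le_prod' fun i _ =>
              lintegral_radial_norm_rpow_le (by positivity) hbB (hr i) (θ i)
        _ = _ := by rw [Finset.prod_mul_distrib]; simp
    refine (ENNReal.rpow_le_rpow h1 hpq).trans (le_of_eq ?_)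
    rw [ENNReal.mul_rpow_of_nonneg _ _ hpq, ← ENNReal.prod_rpow_of_nonneg hpq]
    congr 1
    refine Finset.prod_congr rfl fun i _ => ?_
    have h2 : 0 < ‖1 - (r i : ℂ) * circlePoint (θ i)‖ := norm_one_sub_pos (hr i) _
    rw [ENNReal.ofReal_rpow_of_nonneg (by positivity) hpq, ← ENNReal.ofReal_mul (by positivity),
      ← Real.rpow_mul (by positivity)]
    congr 1
    have h3 : (b - B) * (p / q) = -A := by rw [hb, hB, hA']; field_simp; ring
    rw [h3, Real.div_rpow h2.le (by norm_num), Real.rpow_neg (by norm_num : (0 : ℝ) ≤ 2)]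
    rw [div_inv_eq_mul, mul_comm]
  calc triebelIntegral p q α (testFun m r) ≤ ∫⁻ θ, (D ^ n) ^ (p / q) *
        ∏ i, (ENNReal.ofReal (2 ^ A) *
          ENNReal.ofReal (‖1 - (r i : ℂ) * circlePoint (θ i)‖ ^ (-A))) ∂torusMeasure n :=
        lintegral_mono hin
    _ = (D ^ n) ^ (p / q) * ∏ i, ∫⁻ η, ENNReal.ofReal (2 ^ A) *
          ENNReal.ofReal (‖1 - (r i : ℂ) * circlePoint η‖ ^ (-A)) ∂haarAddCircle := by
        rw [lintegral_const_mul' _ _ (ENNReal.rpow_ne_top_of_nonneg hpq (by finiteness)),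
          torusMeasure, lintegral_pi_prod _ (fun i η => ENNReal.ofReal (2 ^ A) *
          ENNReal.ofReal (‖1 - (r i : ℂ) * circlePoint η‖ ^ (-A)))
          fun i => (measurable_norm_rpow _ _).const_mul _]
    _ ≤ (D ^ n) ^ (p / q) * ∏ i : Fin n, (ENNReal.ofReal (2 ^ A) * C) *
          ENNReal.ofReal ((1 - r i) ^ (1 - A)) := by
        refine mul_le_mul' le_rfl (Finset.prod_le_prod' fun i _ => ?_)
        rw [lintegral_const_mul' _ _ ENNReal.ofReal_ne_top, mul_assoc]
        exact mul_le_mul' le_rfl (hC1 _ (hr i))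
    _ = _ := by
        rw [Finset.prod_mul_distrib, ← weight_eq_prod hr]
        simp only [Finset.prod_const, Finset.card_univ, Fintype.card_fin]
        rw [mul_assoc]
        congr 3
        rw [hA']; field_simp; ring

/-! ### Geometric sums in mixed norms -/

/-- A geometric factor lets any power `P > 0` pass inside a sum: with `σ = δ ^ (1 / 2)`, every
`σ ^ j * u j` is at most the `(1 / P)`-th power of the sum on the right, and the remaining factors
`σ ^ j` have a finite sum. -/
lemma tsum_geometric_mul_rpow_le {δ : ℝ≥0∞} (u : ℕ → ℝ≥0∞) {P : ℝ} (hP : 0 < P) :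
    (∑' j, δ ^ j * u j) ^ P ≤
      (1 - δ ^ (1 / 2 : ℝ))⁻¹ ^ P * ∑' j, (δ ^ (P / 2)) ^ j * u j ^ P := by
  set σ := δ ^ (1 / 2 : ℝ) with hσ
  have h1 : ∀ j, δ ^ j * u j = σ ^ j * (σ ^ j * u j) := fun j => by
    rw [← mul_assoc, ← mul_pow, hσ, ← ENNReal.rpow_add_of_nonneg _ _ (by norm_num) (by norm_num)]
    norm_num
  have h2 : ∀ j, σ ^ j * u j ≤ (∑' j, (δ ^ (P / 2)) ^ j * u j ^ P) ^ (1 / P) := fun j => by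
    have h3 : (σ ^ j * u j) ^ P = (δ ^ (P / 2)) ^ j * u j ^ P := by
      rw [ENNReal.mul_rpow_of_nonneg _ _ hP.le, hσ, ← ENNReal.rpow_natCast, ← ENNReal.rpow_natCast,
        ← ENNReal.rpow_mul, ← ENNReal.rpow_mul, ← ENNReal.rpow_mul]
      congr 2; ring
    have h4 := ENNReal.rpow_le_rpow (ENNReal.le_tsum (f := fun j => (δ ^ (P / 2)) ^ j * u j ^ P) j)
      (by positivity : 0 ≤ 1 / P)
    rwa [← h3, ← ENNReal.rpow_mul, mul_one_div_cancel hP.ne', ENNReal.rpow_one] at h4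
  calc (∑' j, δ ^ j * u j) ^ P ≤ (∑' j, σ ^ j *
        (∑' j, (δ ^ (P / 2)) ^ j * u j ^ P) ^ (1 / P)) ^ P := by
        refine ENNReal.rpow_le_rpow (ENNReal.tsum_le_tsum fun j => ?_) hP.le
        rw [h1]
        exact mul_le_mul' le_rfl (h2 j)
    _ = _ := by
        rw [ENNReal.tsum_mul_right, ENNReal.tsum_geometric, ENNReal.mul_rpow_of_nonneg _ _ hP.le,
          ← ENNReal.rpow_mul, one_div_mul_cancel hP.ne', ENNReal.rpow_one]

/-- A geometrically weighted sum of functions with uniformly bounded mixed norms has finite mixed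
norm. -/
lemma lintegral_rpow_lintegral_rpow_ne_top {X Y : Type*} [MeasurableSpace X] [MeasurableSpace Y]
    {μ : Measure X} {ν : Measure Y} [SFinite ν] {v : Y → ℝ≥0∞} (hv : Measurable v)
    {w : X → ℝ≥0∞} (hw : Measurable w) {P Q : ℝ} (hP : 0 < P) (hQ : 0 < Q) {δ : ℝ≥0∞}
    (hδ : δ < 1) {F : X → Y → ℝ≥0∞} {G : ℕ → X → Y → ℝ≥0∞}
    (hG : ∀ j, Measurable fun a : X × Y => G j a.1 a.2)
    (hF : ∀ x y, F x y ≤ ∑' j, δ ^ j * G j x y) {M : ℝ≥0∞} (hM : M ≠ ∞)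
    (hGM : ∀ j, ∫⁻ x, (∫⁻ y, G j x y ^ P * v y ∂ν) ^ Q * w x ∂μ ≤ M) :
    ∫⁻ x, (∫⁻ y, F x y ^ P * v y ∂ν) ^ Q * w x ∂μ ≠ ∞ := by
  have hlt : ∀ {a : ℝ}, 0 < a → δ ^ a < 1 := fun ha => ENNReal.rpow_lt_one hδ ha
  have hfin : ∀ {x : ℝ≥0∞}, x < 1 → (1 - x)⁻¹ ≠ ∞ := fun hx => by
    rw [ENNReal.inv_ne_top]; exact (tsub_pos_of_lt hx).ne'
  set c1 := (1 - δ ^ (1 / 2 : ℝ))⁻¹ ^ P with hc1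
  have hc1t : c1 ≠ ∞ := ENNReal.rpow_ne_top_of_nonneg hP.le (hfin (hlt (by norm_num)))
  set δ1 := δ ^ (P / 2) with hδ1
  have hδ1t : δ1 < 1 := hlt (by positivity)
  set c2 := (1 - δ1 ^ (1 / 2 : ℝ))⁻¹ ^ Q with hc2
  have hc2t : c2 ≠ ∞ := ENNReal.rpow_ne_top_of_nonneg hQ.le
    (hfin (ENNReal.rpow_lt_one hδ1t (by norm_num)))
  set δ2 := δ1 ^ (Q / 2) with hδ2
  have hδ2t : δ2 < 1 := ENNReal.rpow_lt_one hδ1t (by positivity)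
  have hGv : ∀ j, Measurable fun a : X × Y => G j a.1 a.2 ^ P * v a.2 := fun j =>
    ((hG j).pow_const P).mul (hv.comp measurable_snd)
  have hGx : ∀ j x, Measurable fun y => G j x y ^ P * v y := fun j x =>
    (hGv j).comp measurable_prodMk_left
  have hin : ∀ x, ∫⁻ y, F x y ^ P * v y ∂ν ≤
      c1 * ∑' j, δ1 ^ j * ∫⁻ y, G j x y ^ P * v y ∂ν := by
    intro x
    calc ∫⁻ y, F x y ^ P * v y ∂ν ≤ ∫⁻ y, c1 * ∑' j, δ1 ^ j * (G j x y ^ P * v y) ∂ν := by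
          refine lintegral_mono fun y => ?_
          have h1 := (ENNReal.rpow_le_rpow (hF x y) hP.le).trans
            (tsum_geometric_mul_rpow_le (fun j => G j x y) hP)
          calc F x y ^ P * v y ≤ (c1 * ∑' j, δ1 ^ j * G j x y ^ P) * v y := mul_le_mul' h1 le_rfl
            _ = _ := by
              rw [mul_assoc, ← ENNReal.tsum_mul_right]
              simp_rw [mul_assoc]
      _ = _ := by
          rw [lintegral_const_mul' _ _ hc1t, lintegral_tsum fun j =>
            ((hGx j x).const_mul _).aemeasurable]
          congr 1
          exact tsum_congr fun j => lintegral_const_mul _ (hGx j x)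
  have hout : ∀ j, Measurable fun x => (∫⁻ y, G j x y ^ P * v y ∂ν) ^ Q * w x := fun j =>
    ((hGv j).lintegral_prod_right'.pow_const Q).mul hw
  have hbound : ∫⁻ x, (∫⁻ y, F x y ^ P * v y ∂ν) ^ Q * w x ∂μ ≤
      c1 ^ Q * c2 * ((1 - δ2)⁻¹ * M) := by
    calc ∫⁻ x, (∫⁻ y, F x y ^ P * v y ∂ν) ^ Q * w x ∂μ ≤ ∫⁻ x, (c1 ^ Q * c2) *
          ∑' j, δ2 ^ j * ((∫⁻ y, G j x y ^ P * v y ∂ν) ^ Q * w x) ∂μ := by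
          refine lintegral_mono fun x => ?_
          have h1 := ENNReal.rpow_le_rpow (hin x) hQ.le
          rw [ENNReal.mul_rpow_of_nonneg _ _ hQ.le] at h1
          have h2 := h1.trans (mul_le_mul' le_rfl (tsum_geometric_mul_rpow_le
            (fun j => ∫⁻ y, G j x y ^ P * v y ∂ν) hQ))
          refine (mul_le_mul' h2 (le_refl (w x))).trans (le_of_eq ?_)
          rw [← mul_assoc, mul_assoc _ _ (w x), ← ENNReal.tsum_mul_right]
          simp_rw [mul_assoc]
          rfl
      _ = (c1 ^ Q * c2) * ∑' j, δ2 ^ j *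
            ∫⁻ x, (∫⁻ y, G j x y ^ P * v y ∂ν) ^ Q * w x ∂μ := by
          have h3 : c1 ^ Q ≠ ∞ := ENNReal.rpow_ne_top_of_nonneg hQ.le hc1t
          rw [lintegral_const_mul' _ _ (ENNReal.mul_ne_top h3 hc2t), lintegral_tsum fun j =>
            ((hout j).const_mul _).aemeasurable]
          congr 1
          exact tsum_congr fun j => lintegral_const_mul _ (hout j)
      _ ≤ (c1 ^ Q * c2) * ∑' j, δ2 ^ j * M := by
          refine mul_le_mul' le_rfl (ENNReal.tsum_le_tsum fun j => mul_le_mul' le_rfl (hGM j))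
      _ = _ := by rw [ENNReal.tsum_mul_right, ENNReal.tsum_geometric]
  refine ne_top_of_le_ne_top ?_ hbound
  have h3 : c1 ^ Q ≠ ∞ := ENNReal.rpow_ne_top_of_nonneg hQ.le hc1t
  exact ENNReal.mul_ne_top (ENNReal.mul_ne_top h3 hc2t) (ENNReal.mul_ne_top (hfin hδ2t) hM)

/-! ### Superpositions of dilates -/

lemma HasExpansion.dilate {f : (Fin n → ℂ) → ℂ} {a : (Fin n → ℕ) → ℂ} (h : HasExpansion f a)
    {r : Fin n → ℝ} (hr : r ∈ cube n) :
    HasExpansion (fun z => f fun i => r i * z i) fun k => a k * realMonom k r := by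
  intro z hz
  have h1 := h (fun i => r i * z i) fun i => by
    rw [norm_mul, Complex.norm_real, Real.norm_of_nonneg (hr i).1]
    exact mul_lt_one_of_nonneg_of_lt_one_left (hr i).1 (hr i).2 (hz i).le
  have h2 : (fun k : Fin n → ℕ => a k * monom k fun i => (r i : ℂ) * z i) =
      fun k => a k * realMonom k r * monom k z := by
    ext k
    simp [monom, realMonom, mul_pow, Finset.prod_mul_distrib, mul_assoc]
  rwa [h2] at h1

lemma realMonom_le_one (k : Fin n → ℕ) {r : Fin n → ℝ} (hr : r ∈ cube n) : realMonom k r ≤ 1 :=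
  Finset.prod_le_one (fun i _ => pow_nonneg (hr i).1 _)
    fun i _ => pow_le_one₀ (hr i).1 (hr i).2.le

/-- The dilates of a power series have a common majorant. -/
lemma HasExpansion.norm_le_of_dilate {B : (Fin n → ℕ) → ℂ} (hB : ConvergentOnCube B)
    {φ : (Fin n → ℂ) → ℂ} {r : Fin n → ℝ} (hr : r ∈ cube n)
    (hφ : HasExpansion φ fun k => B k * realMonom k r) {z : Fin n → ℂ} (hz : z ∈ polydisc n) :
    ‖φ z‖ ≤ ∑' k, ‖B k * monom k z‖ := by
  rw [← (hφ z hz).tsum_eq]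
  refine tsum_of_norm_bounded (hB.summable hz).hasSum fun k => ?_
  rw [mul_right_comm, norm_mul _ (realMonom k r : ℂ), Complex.norm_real,
    Real.norm_of_nonneg (realMonom_nonneg k hr)]
  exact mul_le_of_le_one_right (norm_nonneg _) (realMonom_le_one k hr)

lemma summable_superposition {B : (Fin n → ℕ) → ℂ} (hB : ConvergentOnCube B)
    {φ : ℕ → (Fin n → ℂ) → ℂ} {r : ℕ → Fin n → ℝ} (hr : ∀ j, r j ∈ cube n)
    (hφ : ∀ j, HasExpansion (φ j) fun k => B k * realMonom k (r j)) {l : ℕ → ℝ}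
    (hl : Summable fun j => ‖l j‖) {z : Fin n → ℂ} (hz : z ∈ polydisc n) :
    Summable fun j => (l j : ℂ) * φ j z := by
  refine Summable.of_norm_bounded (hl.mul_right (∑' k, ‖B k * monom k z‖)) fun j => ?_
  rw [norm_mul, Complex.norm_real]
  exact mul_le_mul_of_nonneg_left ((hφ j).norm_le_of_dilate hB (hr j) hz) (norm_nonneg _)

/-- An absolutely convergent superposition `∑ⱼ lⱼ φ(rⱼ ·)` of dilates of one power series may be
rearranged into a power series. -/
lemma hasExpansion_superposition {B : (Fin n → ℕ) → ℂ} (hB : ConvergentOnCube B)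
    {φ : ℕ → (Fin n → ℂ) → ℂ} {r : ℕ → Fin n → ℝ} (hr : ∀ j, r j ∈ cube n)
    (hφ : ∀ j, HasExpansion (φ j) fun k => B k * realMonom k (r j)) {l : ℕ → ℝ}
    (hl : Summable fun j => ‖l j‖) :
    HasExpansion (fun z => ∑' j, (l j : ℂ) * φ j z)
      fun k => B k * ((∑' j, l j * realMonom k (r j) : ℝ) : ℂ) := by
  intro z hz
  set u : (Fin n → ℕ) × ℕ → ℂ := fun x =>
    (B x.1 * monom x.1 z) * ((l x.2 * realMonom x.1 (r x.2) : ℝ) : ℂ) with hu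
  have hlr : ∀ k j, ‖l j * realMonom k (r j)‖ ≤ ‖l j‖ := fun k j => by
    rw [norm_mul, Real.norm_of_nonneg (realMonom_nonneg k (hr j))]
    exact mul_le_of_le_one_right (norm_nonneg _) (realMonom_le_one k (hr j))
  have hus : Summable u := by
    have h1 := (hB.summable hz).mul_of_nonneg hl (fun _ => norm_nonneg _) fun _ => norm_nonneg _
    refine Summable.of_norm_bounded h1 fun x => ?_
    rw [hu, norm_mul, Complex.norm_real]
    exact mul_le_mul_of_nonneg_left (hlr _ _) (norm_nonneg _)
  have h1 : HasSum (fun k => B k * ((∑' j, l j * realMonom k (r j) : ℝ) : ℂ) * monom k z)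
      (∑' x, u x) := by
    refine hus.hasSum.prod_fiberwise fun k => ?_
    have h2 : Summable fun j => l j * realMonom k (r j) := Summable.of_norm_bounded hl (hlr k)
    rw [mul_right_comm]
    exact (Complex.hasSum_ofReal.2 h2.hasSum).mul_left (B k * monom k z)
  have h3 : HasSum (fun j => (l j : ℂ) * φ j z) (∑' x, u x) := by
    refine ((Equiv.prodComm ℕ (Fin n → ℕ)).hasSum_iff.2 hus.hasSum).prod_fiberwise fun j => ?_
    have h4 : (fun k => (u ∘ Equiv.prodComm ℕ (Fin n → ℕ)) (j, k)) =
        fun k => (l j : ℂ) * (B k * realMonom k (r j) * monom k z) := by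
      ext k
      simp only [hu, Function.comp_apply, Equiv.prodComm_apply, Prod.swap_prod_mk]
      push_cast
      ring
    rw [h4]
    exact (hφ j z hz).mul_left (l j : ℂ)
  change HasSum _ (∑' j, (l j : ℂ) * φ j z)
  rw [h3.tsum_eq]
  exact h1

/-! ### Properties of the mixed norm -/

/-- Outside the polydisc a function of `Hol n` is arbitrary; cutting it off there makes it Borel
measurable without changing the integrals over the tori. -/
lemma measurable_indicator_polydisc {f : (Fin n → ℂ) → ℂ} (hf : f ∈ Hol n) :
    Measurable ((polydisc n).indicator f) := by
  classical
  rw [← piecewise_eq_indicator]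
  exact hf.continuousOn.measurable_piecewise continuousOn_const (isOpen_polydisc n).measurableSet

lemma powMean_congr {f g : (Fin n → ℂ) → ℂ} (h : EqOn f g (polydisc n)) (p : ℝ) {R : Fin n → ℝ}
    (hR : R ∈ cube n) : powMean p f R = powMean p g R :=
  lintegral_congr fun θ => by rw [h (torusPoint_mem_polydisc hR θ)]

lemma intMean_congr {f g : (Fin n → ℂ) → ℂ} (h : EqOn f g (polydisc n)) (p : ℝ) {R : Fin n → ℝ}
    (hR : R ∈ cube n) : intMean p f R = intMean p g R := by
  rw [intMean_eq, intMean_eq, powMean_congr h p hR]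

lemma mixedIntegral_congr {f g : (Fin n → ℂ) → ℂ} (h : EqOn f g (polydisc n)) (p q α : ℝ) :
    mixedIntegral p q α f = mixedIntegral p q α g :=
  setLIntegral_congr_fun (measurableSet_cube n) fun R hR => by rw [intMean_congr h p hR]

lemma triebelIntegral_congr {f g : (Fin n → ℂ) → ℂ} (h : EqOn f g (polydisc n)) (p q α : ℝ) :
    triebelIntegral p q α f = triebelIntegral p q α g :=
  lintegral_congr fun θ => by
    congr 1
    exact setLIntegral_congr_fun (measurableSet_cube n) fun R hR => by
      rw [h (torusPoint_mem_polydisc hR θ)]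

lemma measurable_mixed_integrand {f : (Fin n → ℂ) → ℂ} (hf : Measurable f) (p q γ : ℝ) :
    Measurable fun R : Fin n → ℝ => intMean p f R ^ q * weight γ R :=
  ((measurable_intMean hf p).pow_const q).mul (measurable_weight _)

lemma measurable_enorm_comp_torusPoint {f : (Fin n → ℂ) → ℂ} (hf : Measurable f) (p : ℝ)
    (R : Fin n → ℝ) : Measurable fun θ => ‖f (torusPoint R θ)‖ₑ ^ p := by
  have hg : Measurable fun θ : UnitAddTorus (Fin n) => (R, θ) := measurable_prodMk_left
  have h := (measurable_enorm_comp_rpow hf p).comp hg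
  exact h

/-- Below the exponent `1` the integral itself, not its root, is subadditive. -/
lemma mixedIntegral_le_add {t s : ℝ} (β : ℝ) (ht : 0 < t) (ht1 : t ≤ 1) (hs : 0 < s) (hst : s ≤ t)
    {u v w : (Fin n → ℂ) → ℂ} (hu : Measurable u)
    (h : ∀ z ∈ polydisc n, ‖w z‖ₑ ≤ ‖u z‖ₑ + ‖v z‖ₑ) :
    mixedIntegral t s β w ≤ mixedIntegral t s β u + mixedIntegral t s β v := by
  have hst0 : 0 ≤ s / t := by positivity
  have hst1 : s / t ≤ 1 := by rw [div_le_one ht]; exact hst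
  have hI : ∀ (f : (Fin n → ℂ) → ℂ) R, intMean t f R ^ s = powMean t f R ^ (s / t) := fun f R => by
    rw [intMean_eq, ← ENNReal.rpow_mul, one_div_mul_eq_div]
  rw [mixedIntegral, mixedIntegral, mixedIntegral, ← lintegral_add_left
    (measurable_mixed_integrand hu t s _)]
  refine setLIntegral_mono' (measurableSet_cube n) fun R hR => ?_
  rw [← add_mul, hI, hI, hI]
  refine mul_le_mul' ?_ le_rfl
  have h1 : powMean t w R ≤ powMean t u R + powMean t v R := by
    rw [powMean, powMean, powMean, ← lintegral_add_left
      (measurable_enorm_comp_torusPoint hu t R)]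
    refine lintegral_mono fun θ => ?_
    exact (ENNReal.rpow_le_rpow (h _ (torusPoint_mem_polydisc hR θ)) ht.le).trans
      (ENNReal.rpow_add_le_add_rpow _ _ ht.le ht1)
  exact (ENNReal.rpow_le_rpow h1 hst0).trans (ENNReal.rpow_add_le_add_rpow _ _ hst0 hst1)

lemma mixedIntegral_const_mul {p q : ℝ} (α : ℝ) (hp : 0 < p) (hq : 0 < q) (c : ℂ)
    (f : (Fin n → ℂ) → ℂ) :
    mixedIntegral p q α (fun z => c * f z) = ‖c‖ₑ ^ q * mixedIntegral p q α f := by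
  have hc : ‖c‖ₑ ^ q ≠ ∞ := ENNReal.rpow_ne_top_of_nonneg hq.le enorm_ne_top
  have hc' : ‖c‖ₑ ^ p ≠ ∞ := ENNReal.rpow_ne_top_of_nonneg hp.le enorm_ne_top
  rw [mixedIntegral, mixedIntegral, ← lintegral_const_mul' _ _ hc]
  refine lintegral_congr fun R => ?_
  rw [← mul_assoc]
  congr 1
  simp only [intMean, enorm_mul, ENNReal.mul_rpow_of_nonneg _ _ hp.le]
  rw [lintegral_const_mul' _ _ hc', ENNReal.mul_rpow_of_nonneg _ _ (by positivity),
    ← ENNReal.rpow_mul, mul_one_div_cancel hp.ne', ENNReal.rpow_one,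
    ENNReal.mul_rpow_of_nonneg _ _ hq.le]

/-- Lower semicontinuity of the mixed norm under pointwise convergence, by Fatou's lemma. -/
lemma mixedIntegral_le_of_tendsto {p q : ℝ} (α : ℝ) (hp : 0 < p) (hq : 0 < q)
    {u : ℕ → (Fin n → ℂ) → ℂ} {v : (Fin n → ℂ) → ℂ} (hu : ∀ k, Measurable (u k))
    (h : ∀ z, Filter.Tendsto (fun k => u k z) Filter.atTop (nhds (v z))) {K : ℝ≥0∞}
    (hK : ∀ k, mixedIntegral p q α (u k) ≤ K) : mixedIntegral p q α v ≤ K := by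
  have hmean : ∀ R, powMean p v R ≤ Filter.liminf (fun k => powMean p (u k) R) Filter.atTop := by
    intro R
    refine le_trans (le_of_eq ?_) (lintegral_liminf_le fun k =>
      measurable_enorm_comp_torusPoint (hu k) p R)
    refine lintegral_congr fun θ => Eq.symm (Filter.Tendsto.liminf_eq ?_)
    exact ((ENNReal.continuous_rpow_const (y := p)).tendsto _).comp (h _).enorm
  have hmono : ∀ R, intMean p v R ^ q * weight (α * q - 1) R ≤
      Filter.liminf (fun k => intMean p (u k) R ^ q * weight (α * q - 1) R) Filter.atTop := by
    intro R
    set F : ℝ≥0∞ → ℝ≥0∞ := fun y => (y ^ (1 / p)) ^ q * weight (α * q - 1) R with hF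
    have hFm : Monotone F := fun a b hab => by
      have : 0 ≤ 1 / p := by positivity
      exact mul_le_mul' (ENNReal.rpow_le_rpow (ENNReal.rpow_le_rpow hab this) hq.le) le_rfl
    have hFc : Continuous F := (ENNReal.continuous_mul_const (weight_ne_top _)).comp
      (ENNReal.continuous_rpow_const.comp ENNReal.continuous_rpow_const)
    refine (hFm (hmean R)).trans (le_of_eq ?_)
    exact hFm.map_liminf_of_continuousAt _ hFc.continuousAt
  calc mixedIntegral p q α v ≤ ∫⁻ R in cube n, Filter.liminf
        (fun k => intMean p (u k) R ^ q * weight (α * q - 1) R) Filter.atTop := lintegral_mono hmono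
    _ ≤ Filter.liminf (fun k => mixedIntegral p q α (u k)) Filter.atTop :=
        lintegral_liminf_le fun k =>
          measurable_mixed_integrand (hu k) p q _
    _ ≤ K := Filter.liminf_le_of_frequently_le' (Filter.Frequently.of_forall hK)

/-- The contribution of the radii `ρ ∈ [r, (1 + r) / 2]` to the mixed norm of the dilate `f(r ·)`:
since means increase, they are at least `M_t(f, r ^ 2)` there. -/
lemma exists_intMean_mul_self_le (n : ℕ) {t s : ℝ} (β : ℝ) (ht : 0 < t) (hs : 0 < s) :
    ∃ C : ℝ≥0∞, C ≠ ∞ ∧ ∀ f ∈ Hol n, ∀ r ∈ cube n,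
      intMean t f (r * r) ^ s * weight (β * s) r ≤
        C * mixedIntegral t s β fun z => f fun i => r i * z i := by
  set c := ENNReal.ofReal ((4 ^ |β * s - 1|) ^ n) with hc
  refine ⟨2 ^ n * c, by finiteness, fun f hf r hr => ?_⟩
  have hsub : Icc r (halfway r) ⊆ cube n := fun ρ hρ => mem_cube_of_mem_Icc_halfway hr hρ
  have hdil : ∀ R, intMean t (fun z => f fun i => r i * z i) R = intMean t f (r * R) := fun R => by
    simp only [intMean]
    congr 2
    ext θ
    congr 3
    ext i
    simp [torusPoint_apply, mul_assoc]
  have h6 : (2 : ℝ≥0∞) ^ n * ENNReal.ofReal (1 / 2) ^ n = 1 := by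
    rw [← mul_pow, show (2 : ℝ≥0∞) = ENNReal.ofReal 2 by simp,
      ← ENNReal.ofReal_mul (by norm_num)]
    norm_num
  have h1 : intMean t f (r * r) ^ s * weight (β * s - 1) r * volume (Icc r (halfway r)) ≤
      c * mixedIntegral t s β fun z => f fun i => r i * z i := by
    rw [← setLIntegral_const, mixedIntegral, ← lintegral_const_mul' _ _ ENNReal.ofReal_ne_top]
    refine le_trans ?_ (lintegral_mono_set hsub)
    refine setLIntegral_mono' measurableSet_Icc fun ρ hρ => ?_
    have hρc := hsub hρ
    rw [hdil]
    calc intMean t f (r * r) ^ s * weight (β * s - 1) r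
        ≤ intMean t f (r * ρ) ^ s * (c * weight (β * s - 1) ρ) := by
          refine mul_le_mul' (ENNReal.rpow_le_rpow ?_ hs.le) (weight_le_of_mem_Icc_halfway hr hρ _)
          exact intMean_mono hf ht (mul_mem_cube hr hr) (mul_mem_cube hr hρc)
            fun i => mul_le_mul_of_nonneg_left (hρ.1 i) (hr i).1
      _ = _ := by ring
  calc intMean t f (r * r) ^ s * weight (β * s) r
      = intMean t f (r * r) ^ s * (weight (β * s - 1) r * weight 1 r) := by
        rw [weight_mul hr, sub_add_cancel]
    _ = 2 ^ n * (intMean t f (r * r) ^ s * weight (β * s - 1) r *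
        (ENNReal.ofReal (1 / 2) ^ n * weight 1 r)) := by
        calc _ = (2 ^ n * ENNReal.ofReal (1 / 2) ^ n) *
              (intMean t f (r * r) ^ s * (weight (β * s - 1) r * weight 1 r)) := by
              rw [h6, one_mul]
          _ = _ := by ring
    _ ≤ 2 ^ n * (c * mixedIntegral t s β fun z => f fun i => r i * z i) := by
        rw [← volume_Icc_halfway hr]
        exact mul_le_mul' le_rfl h1
    _ = _ := by rw [mul_assoc]

/-! ### A uniform boundedness principle -/

/-- A finite lower semicontinuous function on the Cantor space is bounded on a cylinder, by Baire's
theorem, and all but finitely many coordinates can be switched without leaving the cylinder. -/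
lemma exists_bound_of_switch {Φ : (ℕ → Bool) → ℝ≥0∞} (hlsc : ∀ K : ℕ, IsClosed {ε | Φ ε ≤ K})
    (hfin : ∀ ε, Φ ε ≠ ∞) : ∃ K N : ℕ, ∀ j ≥ N, ∃ ε ε' : ℕ → Bool, Φ ε ≤ K ∧ Φ ε' ≤ K ∧
      ε j = true ∧ ε' j = false ∧ ∀ i ≠ j, ε i = ε' i := by
  obtain ⟨K, ε₀, hε₀⟩ := nonempty_interior_of_iUnion_of_closed hlsc (by
    refine eq_univ_of_forall fun ε => mem_iUnion.2 ?_
    obtain ⟨K, hK⟩ := ENNReal.exists_nat_gt (hfin ε)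
    exact ⟨K, hK.le⟩)
  obtain ⟨I, u, hu, hI⟩ := isOpen_pi_iff.1 isOpen_interior ε₀ hε₀
  have hmem : ∀ j ≥ I.sup id + 1, ∀ b, Φ (Function.update ε₀ j b) ≤ K := by
    intro j hj b
    suffices h : Function.update ε₀ j b ∈ interior {ε | Φ ε ≤ K} by
      have h' : Function.update ε₀ j b ∈ {ε | Φ ε ≤ K} := interior_subset h
      exact h'
    refine hI fun i hi => ?_
    have hij : i ≠ j := by
      rintro rfl
      have : id i ≤ I.sup id := Finset.le_sup hi
      simp only [id] at this
      omega
    rw [Function.update_of_ne hij]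
    exact (hu i hi).2
  refine ⟨K, I.sup id + 1, fun j hj => ⟨Function.update ε₀ j true, Function.update ε₀ j false,
    hmem j hj _, hmem j hj _, by simp, by simp, fun i hi => ?_⟩⟩
  rw [Function.update_of_ne hi, Function.update_of_ne hi]

/-! ### Necessity of the condition -/

lemma HasExpansion.mem_Hol {f : (Fin n → ℂ) → ℂ} {a : (Fin n → ℕ) → ℂ} (h : HasExpansion f a) :
    f ∈ Hol n :=
  h.convergentOnCube.mem_Hol.congr fun _ hz => h.eq_of h.convergentOnCube.hasExpansion hz

/-- The coefficients `εⱼ 2^{-j} (1 - rⱼ)^e` for `εⱼ ∈ {0, 1}`. -/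
noncomputable def switchCoeff (e : ℝ) (r : ℕ → Fin n → ℝ) (ε : ℕ → Bool) (j : ℕ) : ℝ :=
  (if ε j then 1 else 0) * ((2⁻¹ : ℝ) ^ j * (weight e (r j)).toReal)

lemma weight_le_one {e : ℝ} (he : 0 ≤ e) {R : Fin n → ℝ} (hR : R ∈ cube n) : weight e R ≤ 1 := by
  have h := weight_anti hR (r := 0) (fun i => (hR i).1) he
  simpa [weight] using h

lemma enorm_switchCoeff (e : ℝ) (r : ℕ → Fin n → ℝ) (ε : ℕ → Bool) (j : ℕ) :
    ‖((switchCoeff e r ε j : ℝ) : ℂ)‖ₑ =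
      (if ε j then 1 else 0) * (2⁻¹ ^ j * weight e (r j)) := by
  have h : (0 : ℝ) ≤ 2⁻¹ ^ j * (weight e (r j)).toReal := by positivity
  rw [switchCoeff, ← ofReal_norm, Complex.norm_real, norm_mul, Real.norm_of_nonneg h]
  split_ifs
  · rw [norm_one, one_mul, one_mul, ENNReal.ofReal_mul (by positivity),
      ENNReal.ofReal_toReal (weight_ne_top _), ENNReal.ofReal_pow (by positivity),
      ENNReal.ofReal_inv_of_pos (by norm_num)]
    simp
  · simp

lemma norm_switchCoeff_le {e : ℝ} (he : 0 ≤ e) {r : ℕ → Fin n → ℝ} (hr : ∀ j, r j ∈ cube n)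
    (ε : ℕ → Bool) (j : ℕ) : ‖switchCoeff e r ε j‖ ≤ 2⁻¹ ^ j := by
  have h1 : (weight e (r j)).toReal ≤ 1 :=
    ENNReal.toReal_le_of_le_ofReal zero_le_one (by simpa using weight_le_one he (hr j))
  have h : (0 : ℝ) ≤ 2⁻¹ ^ j * (weight e (r j)).toReal := by positivity
  rw [switchCoeff, norm_mul, Real.norm_of_nonneg h]
  have h2 : (2⁻¹ : ℝ) ^ j * (weight e (r j)).toReal ≤ 2⁻¹ ^ j :=
    mul_le_of_le_one_right (by positivity) h1
  split_ifs
  · simpa using h2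
  · simp

lemma summable_switchCoeff {e : ℝ} (he : 0 ≤ e) {r : ℕ → Fin n → ℝ} (hr : ∀ j, r j ∈ cube n)
    (ε : ℕ → Bool) : Summable fun j => ‖switchCoeff e r ε j‖ :=
  Summable.of_nonneg_of_le (fun _ => norm_nonneg _) (norm_switchCoeff_le he hr ε)
    (summable_geometric_of_lt_one (by norm_num) (by norm_num))

lemma convergentOnCube_binomCoeff (n m : ℕ) :
    ConvergentOnCube fun k : Fin n → ℕ => (binomCoeff m k : ℂ) := by
  have h := (hasExpansion_testFun (n := n) m (r := 1) (by simp)).convergentOnCube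
  intro R hR
  refine (h R hR).congr fun k => ?_
  simp [realMonom]

lemma hasExpansion_superposition_testFun {e : ℝ} (he : 0 ≤ e) (m : ℕ) {r : ℕ → Fin n → ℝ}
    (hr : ∀ j, r j ∈ cube n) (ε : ℕ → Bool) :
    HasExpansion (fun z => ∑' j, (switchCoeff e r ε j : ℂ) * testFun m (r j) z) fun k =>
      (binomCoeff m k : ℂ) * ((∑' j, switchCoeff e r ε j * realMonom k (r j) : ℝ) : ℂ) :=
  hasExpansion_superposition (convergentOnCube_binomCoeff n m) hr
    (fun j => hasExpansion_testFun m fun i => ⟨(hr j i).1, (hr j i).2.le⟩)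
    (summable_switchCoeff he hr ε)

/-- The condition on the means of `G = D^m g` is necessary on every space `X` that contains all the
sums `∑ⱼ εⱼ 2^{-j} (1 - rⱼ)^e f_{rⱼ}`, `εⱼ ∈ {0, 1}`, of test functions `f_r = testFun m r`.
Otherwise choose radii `rⱼ` for which the norm of `(1 - rⱼ)^e G(rⱼ ·)` exceeds `4 ^ j`, up to a
constant factor. The images `∑ⱼ εⱼ 2^{-j} (1 - rⱼ)^e G(rⱼ ·)` have finite norms that depend on `ε`
in a lower semicontinuous way, so by Baire's theorem the single terms are bounded for large `j`.
This replaces the closed graph theorem, for which the quasi-norms of `X` would have to be shown to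
be complete. -/
lemma exists_intMean_bound_of_multiplier {X : Set ((Fin n → ℂ) → ℂ)} {t s β e : ℝ} {m : ℕ}
    (ht : 0 < t) (ht1 : t ≤ 1) (hs : 0 < s) (hst : s ≤ t) (he : 0 ≤ e)
    {G : (Fin n → ℂ) → ℂ} {c : (Fin n → ℕ) → ℂ}
    (hGc : HasExpansion G fun k => (binomCoeff m k : ℂ) * c k)
    (hc : c ∈ coeffMultipliers X (mixedSpace n t s β))
    (hX : ∀ r : ℕ → Fin n → ℝ, (∀ j, r j ∈ cube n) → ∀ ε : ℕ → Bool,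
      (fun z => ∑' j, (switchCoeff e r ε j : ℂ) * testFun m (r j) z) ∈ X) :
    ∃ B : ℝ≥0∞, B ≠ ∞ ∧ ∀ ρ ∈ cube n, intMean t G ρ * weight (e + β) ρ ≤ B := by
  by_contra! hcon
  -- `4 ^ j` beats the factor `2 ^ (-j)` of `switchCoeff`
  have hρ' : ∀ j : ℕ, ∃ ρ ∈ cube n, (4 : ℝ≥0∞) ^ j < intMean t G ρ * weight (e + β) ρ :=
    fun j => hcon _ (by finiteness)
  choose ρ hρ hbig using hρ'
  -- `exists_intMean_mul_self_le` sees the dilate by `r` at the radii `r ^ 2`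
  set r : ℕ → Fin n → ℝ := fun j i => √(ρ j i) with hr'
  have hr : ∀ j, r j ∈ cube n := fun j => sqrt_mem_cube (hρ j)
  have hrr : ∀ j, r j * r j = ρ j := fun j => sqrt_mul_sqrt_cube (hρ j)
  have hG : G ∈ Hol n := hGc.mem_Hol
  set φ : ℕ → (Fin n → ℂ) → ℂ := fun j z => G fun i => r j i * z i with hφ'
  have hφ : ∀ j, HasExpansion (φ j) fun k => (binomCoeff m k : ℂ) * c k * realMonom k (r j) :=
    fun j => hGc.dilate (hr j)
  have hB := hGc.convergentOnCube
  set S : (ℕ → Bool) → (Fin n → ℂ) → ℂ := fun ε z =>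
    ∑' j, (switchCoeff e r ε j : ℂ) * φ j z with hS
  have hSexp : ∀ ε, HasExpansion (S ε) fun k => (binomCoeff m k : ℂ) * c k *
      ((∑' j, switchCoeff e r ε j * realMonom k (r j) : ℝ) : ℂ) := fun ε =>
    hasExpansion_superposition hB hr hφ (summable_switchCoeff he hr ε)
  set T : (ℕ → Bool) → (Fin n → ℂ) → ℂ := fun ε => (polydisc n).indicator (S ε) with hT
  have hTm : ∀ ε, Measurable (T ε) := fun ε => measurable_indicator_polydisc (hSexp ε).mem_Hol
  have hTS : ∀ ε, EqOn (T ε) (S ε) (polydisc n) := fun ε => eqOn_indicator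
  have hTfin : ∀ ε, mixedIntegral t s β (T ε) ≠ ∞ := by
    intro ε
    obtain ⟨h, hhY, hh⟩ := hc _ (hX r hr ε) _ (hasExpansion_superposition_testFun he m hr ε)
    rw [mixedIntegral_congr (hTS ε)]
    -- `S ε` is the image of the superposition of test functions
    have hSh : EqOn (S ε) h (polydisc n) := fun z hz => by
      refine (hSexp ε).eq_of (fun w hw => ?_) hz
      have h1 := hh w hw
      convert h1 using 3 with k
      ring
    rw [mixedIntegral_congr hSh]
    exact hhY.2.ne
  have hlim : ∀ (u : ℕ → ℕ → Bool) (ε : ℕ → Bool), Filter.Tendsto u Filter.atTop (nhds ε) →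
      ∀ z, Filter.Tendsto (fun k => T (u k) z) Filter.atTop (nhds (T ε z)) := by
    intro u ε hu z
    by_cases hz : z ∈ polydisc n
    · simp only [hT, indicator_of_mem hz, hS]
      have hsum : Summable fun j : ℕ => (2⁻¹ : ℝ) ^ j *
          ∑' k, ‖(binomCoeff m k : ℂ) * c k * monom k z‖ :=
        (summable_geometric_of_lt_one (by norm_num) (by norm_num)).mul_right _
      refine tendsto_tsum_of_dominated_convergence hsum (fun j => ?_)
        (Filter.Eventually.of_forall fun k j => ?_)
      · have h1 : Filter.Tendsto (fun k => u k j) Filter.atTop (nhds (ε j)) :=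
          ((continuous_apply j).tendsto ε).comp hu
        have h2 : Continuous fun b : Bool => ((((if b then (1 : ℝ) else 0) *
            ((2⁻¹ : ℝ) ^ j * (weight e (r j)).toReal) : ℝ) : ℂ) * φ j z) :=
          continuous_of_discreteTopology
        exact (h2.tendsto (ε j)).comp h1
      · rw [norm_mul, Complex.norm_real]
        exact mul_le_mul (norm_switchCoeff_le he hr _ j)
          ((hφ j).norm_le_of_dilate hB (hr j) hz) (norm_nonneg _) (by positivity)
    · simp only [hT, indicator_of_notMem hz]
      exact tendsto_const_nhds
  obtain ⟨K, N, hKN⟩ := exists_bound_of_switch (Φ := fun ε => mixedIntegral t s β (T ε))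
    (fun K => IsSeqClosed.isClosed fun u ε hu hlu => by
      exact mixedIntegral_le_of_tendsto β ht hs (fun k => hTm (u k)) (hlim u ε hlu) hu) hTfin
  -- switching one coordinate isolates a single dilate
  have hone : ∀ j ≥ N, (2⁻¹ ^ j * weight e (r j)) ^ s * mixedIntegral t s β (φ j) ≤ K + K := by
    intro j hj
    obtain ⟨ε, ε', hε, hε', h1, h0, hne⟩ := hKN j hj
    have h2 : ∀ z ∈ polydisc n, (switchCoeff e r ε j : ℂ) * φ j z = T ε z - T ε' z := by
      intro z hz
      rw [hTS ε hz, hTS ε' hz]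
      simp only [hS]
      rw [← (summable_superposition hB hr hφ (summable_switchCoeff he hr ε) hz).tsum_sub
        (summable_superposition hB hr hφ (summable_switchCoeff he hr ε') hz), tsum_eq_single j]
      · simp [switchCoeff, h0]
      · intro i hi
        simp [switchCoeff, hne i hi]
    have h3 := mixedIntegral_le_add β ht ht1 hs hst (u := T ε) (v := T ε')
      (w := fun z => (switchCoeff e r ε j : ℂ) * φ j z) (hTm ε) fun z hz => by
        rw [h2 z hz]; exact enorm_sub_le
    rw [mixedIntegral_const_mul β ht hs, enorm_switchCoeff, h1] at h3
    simp only [if_true, one_mul] at h3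
    exact h3.trans (add_le_add hε hε')
  obtain ⟨C, hC, hlow⟩ := exists_intMean_mul_self_le n β ht hs
  set c0 := ENNReal.ofReal ((4 ^ |e + β|) ^ n) with hc0
  have hbound : ∀ j ≥ N, ((2 : ℝ≥0∞) ^ s) ^ j ≤ c0 ^ s * (C * (K + K)) := by
    intro j hj
    -- `1 - r ≤ 1 - r ^ 2 ≤ 2 (1 - r)`
    have hw : weight (e + β) (ρ j) ≤ c0 * weight (e + β) (r j) := by
      have h0 : ∀ i, r j i * r j i = ρ j i := fun i => congrFun (hrr j) i
      refine weight_le_of_comparable (hρ j) (hr j) (fun i => ?_) (fun i => ?_) _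
      · nlinarith [h0 i, (hr j i).1, (hr j i).2]
      · nlinarith [h0 i, (hr j i).1, (hr j i).2]
    have h24 : (2⁻¹ : ℝ≥0∞) ^ j * 4 ^ j = 2 ^ j := by
      rw [← mul_pow]
      congr 1
      rw [show (4 : ℝ≥0∞) = 2 * 2 by norm_num, ← mul_assoc,
        ENNReal.inv_mul_cancel (by norm_num) (by norm_num), one_mul]
    calc ((2 : ℝ≥0∞) ^ s) ^ j = (2⁻¹ ^ j * 4 ^ j) ^ s := by
          rw [h24, ← ENNReal.rpow_natCast, ← ENNReal.rpow_mul, mul_comm, ENNReal.rpow_mul,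
            ENNReal.rpow_natCast]
      _ ≤ (2⁻¹ ^ j * (intMean t G (r j * r j) * (c0 * weight (e + β) (r j)))) ^ s := by
          refine ENNReal.rpow_le_rpow (mul_le_mul' le_rfl ((hbig j).le.trans ?_)) hs.le
          rw [hrr]
          exact mul_le_mul' le_rfl hw
      _ = c0 ^ s * ((2⁻¹ ^ j * weight e (r j)) ^ s *
          (intMean t G (r j * r j) ^ s * weight (β * s) (r j))) := by
          rw [← weight_mul (hr j), ← weight_rpow (hr j),
            ← ENNReal.mul_rpow_of_nonneg _ _ hs.le, ← ENNReal.mul_rpow_of_nonneg _ _ hs.le,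
            ← ENNReal.mul_rpow_of_nonneg _ _ hs.le]
          congr 1
          ring
      _ ≤ c0 ^ s * ((2⁻¹ ^ j * weight e (r j)) ^ s * (C * mixedIntegral t s β (φ j))) :=
          mul_le_mul' le_rfl (mul_le_mul' le_rfl (hlow G hG (r j) (hr j)))
      _ = c0 ^ s * (C * ((2⁻¹ ^ j * weight e (r j)) ^ s * mixedIntegral t s β (φ j))) := by ring
      _ ≤ _ := mul_le_mul' le_rfl (mul_le_mul' le_rfl (hone j hj))
  -- the left side of `hbound` is unbounded
  have htop : Filter.Tendsto (fun j : ℕ => ((2 : ℝ≥0∞) ^ s) ^ j) Filter.atTop (nhds ∞) :=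
    ENNReal.tendsto_pow_atTop_nhds_top_iff.2 (ENNReal.one_lt_rpow (by norm_num) hs)
  have hle : ∞ ≤ c0 ^ s * (C * (K + K)) :=
    le_of_tendsto htop (Filter.eventually_atTop.2 ⟨N, hbound⟩)
  have hc0s : c0 ^ s ≠ ∞ := ENNReal.rpow_ne_top_of_nonneg hs.le ENNReal.ofReal_ne_top
  exact (ENNReal.mul_ne_top hc0s (ENNReal.mul_ne_top hC (by finiteness))) (top_le_iff.1 hle)

/-! ### Superpositions of the test functions -/

lemma measurable_testFun (m : ℕ) (r : Fin n → ℝ) : Measurable (testFun m r) := by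
  unfold testFun
  fun_prop

lemma enorm_superposition_testFun_le (e : ℝ) (m : ℕ) (r : ℕ → Fin n → ℝ) (ε : ℕ → Bool)
    (z : Fin n → ℂ) : ‖∑' j, (switchCoeff e r ε j : ℂ) * testFun m (r j) z‖ₑ ≤
      ∑' j, (2⁻¹ : ℝ≥0∞) ^ j * (weight e (r j) * ‖testFun m (r j) z‖ₑ) := by
  refine enorm_tsum_le_tsum_enorm.trans (ENNReal.tsum_le_tsum fun j => ?_)
  rw [enorm_mul, enorm_switchCoeff]
  split_ifs
  · rw [one_mul, mul_assoc]
  · simp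

/-- The exponent `m + 1 - α - 1/p` is the one that normalizes the test functions in `A^{p,q}_α`. -/
lemma superposition_testFun_mem_mixedSpace {p q α : ℝ} {m : ℕ} (hp : 0 < p) (hq : 0 < q)
    (hα : 0 < α) (hm : α + 1 / p < m + 1) {r : ℕ → Fin n → ℝ} (hr : ∀ j, r j ∈ cube n)
    (ε : ℕ → Bool) : (fun z => ∑' j, (switchCoeff (m + 1 - α - 1 / p) r ε j : ℂ) *
      testFun m (r j) z) ∈ mixedSpace n p q α := by
  set e := (m + 1 - α - 1 / p : ℝ) with he'
  have he : 0 ≤ e := by rw [he']; linarith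
  refine ⟨(hasExpansion_superposition_testFun he m hr ε).mem_Hol, lt_top_iff_ne_top.2 ?_⟩
  obtain ⟨C, hC, htest⟩ := exists_mixedIntegral_testFun_le n m hp hq hα hm
  have h := lintegral_rpow_lintegral_rpow_ne_top
    (μ := (volume : Measure (Fin n → ℝ)).restrict (cube n)) (ν := torusMeasure n)
    (v := fun _ => 1) measurable_const (w := weight (α * q - 1)) (measurable_weight _)
    (P := p) (Q := 1 / p * q) hp (by positivity) (δ := 2⁻¹) (by norm_num)
    (F := fun R θ => ‖∑' j, (switchCoeff e r ε j : ℂ) * testFun m (r j) (torusPoint R θ)‖ₑ)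
    (G := fun j R θ => weight e (r j) * ‖testFun m (r j) (torusPoint R θ)‖ₑ) (fun j => ?_)
    (fun R θ => enorm_superposition_testFun_le e m r ε _) hC fun j => ?_
  · simp only [mul_one, ENNReal.rpow_mul] at h
    exact h
  · exact ((measurable_testFun m (r j)).comp continuous_torusPoint.measurable).enorm.const_mul _
  · have h1 : ∀ R : Fin n → ℝ, (∫⁻ θ, (weight e (r j) * ‖testFun m (r j) (torusPoint R θ)‖ₑ) ^ p * 1
        ∂torusMeasure n) ^ (1 / p * q) =
          weight e (r j) ^ q * intMean p (testFun m (r j)) R ^ q := by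
      intro R
      simp only [mul_one, ENNReal.mul_rpow_of_nonneg _ _ hp.le]
      rw [lintegral_const_mul' _ _ (ENNReal.rpow_ne_top_of_nonneg hp.le (weight_ne_top _)),
        ENNReal.mul_rpow_of_nonneg _ _ (by positivity), ← ENNReal.rpow_mul, ← mul_assoc,
        mul_one_div_cancel hp.ne', one_mul, intMean, ← ENNReal.rpow_mul]
    simp_rw [h1, mul_assoc]
    rw [lintegral_const_mul' _ _ (ENNReal.rpow_ne_top_of_nonneg hq.le (weight_ne_top _))]
    calc _ ≤ weight e (r j) ^ q * (C * weight ((α + 1 / p - (m + 1)) * q) (r j)) :=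
          mul_le_mul' le_rfl (htest (r j) (hr j))
      _ = C * (weight (e * q) (r j) * weight ((α + 1 / p - (m + 1)) * q) (r j)) := by
          rw [weight_rpow (hr j)]; ring
      _ = C := by
          rw [weight_mul (hr j), he', show (m + 1 - α - 1 / p : ℝ) * q +
            (α + 1 / p - (m + 1)) * q = 0 by ring, weight_zero, mul_one]

lemma superposition_testFun_mem_lizorkinTriebelSpace {p q α : ℝ} {m : ℕ} (hp : 0 < p)
    (hq : 0 < q) (hα : 0 < α) (hm : α + 1 / p < m + 1) {r : ℕ → Fin n → ℝ}
    (hr : ∀ j, r j ∈ cube n) (ε : ℕ → Bool) :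
    (fun z => ∑' j, (switchCoeff (m + 1 - α - 1 / p) r ε j : ℂ) * testFun m (r j) z) ∈
      lizorkinTriebelSpace n p q α := by
  set e := (m + 1 - α - 1 / p : ℝ) with he'
  have he : 0 ≤ e := by rw [he']; linarith
  refine ⟨(hasExpansion_superposition_testFun he m hr ε).mem_Hol, lt_top_iff_ne_top.2 ?_⟩
  obtain ⟨C, hC, htest⟩ := exists_triebelIntegral_testFun_le n m hp hq hα hm
  have hpq : 0 ≤ p / q := by positivity
  have h := lintegral_rpow_lintegral_rpow_ne_top
    (μ := torusMeasure n) (ν := (volume : Measure (Fin n → ℝ)).restrict (cube n))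
    (v := weight (α * q - 1)) (measurable_weight _) (w := fun _ => 1) measurable_const
    (P := q) (Q := p / q) hq (by positivity) (δ := 2⁻¹) (by norm_num)
    (F := fun θ R => ‖∑' j, (switchCoeff e r ε j : ℂ) * testFun m (r j) (torusPoint R θ)‖ₑ)
    (G := fun j θ R => weight e (r j) * ‖testFun m (r j) (torusPoint R θ)‖ₑ) (fun j => ?_)
    (fun R θ => enorm_superposition_testFun_le e m r ε _) hC fun j => ?_
  · simp only [mul_one] at h
    exact h
  · have h1 := (((measurable_testFun m (r j)).comp
      continuous_torusPoint.measurable).enorm.const_mul (weight e (r j))).comp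
      (measurable_swap (α := UnitAddTorus (Fin n)) (β := Fin n → ℝ))
    exact h1
  · have h1 : ∀ θ, (∫⁻ R in cube n, (weight e (r j) * ‖testFun m (r j) (torusPoint R θ)‖ₑ) ^ q *
        weight (α * q - 1) R) ^ (p / q) = weight e (r j) ^ p * (∫⁻ R in cube n,
          ‖testFun m (r j) (torusPoint R θ)‖ₑ ^ q * weight (α * q - 1) R) ^ (p / q) := by
      intro θ
      simp only [ENNReal.mul_rpow_of_nonneg _ _ hq.le, mul_assoc]
      rw [lintegral_const_mul' _ _ (ENNReal.rpow_ne_top_of_nonneg hq.le (weight_ne_top _)),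
        ENNReal.mul_rpow_of_nonneg _ _ hpq, ← ENNReal.rpow_mul, mul_div_cancel₀ _ hq.ne']
    simp_rw [h1, mul_one]
    rw [lintegral_const_mul' _ _ (ENNReal.rpow_ne_top_of_nonneg hp.le (weight_ne_top _))]
    calc _ ≤ weight e (r j) ^ p * (C * weight ((α + 1 / p - (m + 1)) * p) (r j)) :=
          mul_le_mul' le_rfl (htest (r j) (hr j))
      _ = C * (weight (e * p) (r j) * weight ((α + 1 / p - (m + 1)) * p) (r j)) := by
          rw [weight_rpow (hr j)]; ring
      _ = C := by
          rw [weight_mul (hr j), he', show (m + 1 - α - 1 / p : ℝ) * p +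
            (α + 1 / p - (m + 1)) * p = 0 by ring, weight_zero, mul_one]

/-! ### Multipliers -/

/-- The form of the sufficiency that serves both scales: under the condition on the means of
`D^m g`, every space `X` that is contained in `A^{t,s}_α`, with `α` as in `hα`, is mapped into
`A^{t,s}_β`. -/
lemma mem_coeffMultipliers_of_bounded {X : Set ((Fin n → ℂ) → ℂ)} {t s β κ α : ℝ} (ht : 0 < t)
    (ht1 : t ≤ 1) (hs : 0 < s) (hst : s ≤ t) (hβ : 0 < β) (hκ : β < κ) {m : ℕ} (hm : 1 ≤ m)
    (hα : α = β - κ + (m + 1) - 1 / t) {G : (Fin n → ℂ) → ℂ} {c : (Fin n → ℕ) → ℂ}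
    (hGc : HasExpansion G fun k => (binomCoeff m k : ℂ) * c k) (hc : ConvergentOnCube c)
    {B : ℝ≥0∞} (hB : B ≠ ∞) (hbd : ∀ r ∈ cube n, intMean t G r * weight κ r ≤ B)
    (hX : ∀ f ∈ X, f ∈ Hol n ∧ mixedIntegral t s α f ≠ ∞) :
    c ∈ coeffMultipliers X (mixedSpace n t s β) := by
  intro f hf a hfa
  obtain ⟨hfH, hfin⟩ := hX f hf
  have hca : ConvergentOnCube fun k => c k * a k :=
    hfa.convergentOnCube.mul fun R hR => hc.bounded hR
  have hef : EqOn ((polydisc n).indicator f) f (polydisc n) := eqOn_indicator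
  have heG : EqOn ((polydisc n).indicator G) G (polydisc n) := eqOn_indicator
  refine ⟨_, ⟨hca.mem_Hol, lt_top_iff_ne_top.2 ?_⟩, hca.hasExpansion⟩
  refine mixedIntegral_ne_top_of_bounded ht ht1 hs hst hβ hκ hm hα
    (G := (polydisc n).indicator G) (f := (polydisc n).indicator f) (a := a) (c := c)
    (measurable_indicator_polydisc hGc.mem_Hol) (measurable_indicator_polydisc hfH)
    (DifferentiableOn.congr hGc.mem_Hol heG) (DifferentiableOn.congr hfH hef)
    (fun z hz => by rw [hef hz]; exact hfa z hz) (fun z hz => by rw [heG hz]; exact hGc z hz)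
    hca.hasExpansion hB (fun r hr => ?_) ?_
  · rw [intMean_congr heG t hr]
    exact hbd r hr
  · rw [mixedIntegral_congr hef]
    exact hfin

lemma mixedIntegral_ne_top_of_mem_mixedSpace {p q t s α : ℝ} (hp : 0 < p) (hq : 0 < q)
    (hpt : p ≤ t) (hqs : q ≤ s) {f : (Fin n → ℂ) → ℂ} (hf : f ∈ mixedSpace n p q α) :
    mixedIntegral t s (α + 1 / p - 1 / t) f ≠ ∞ := by
  have hef : EqOn ((polydisc n).indicator f) f (polydisc n) := eqOn_indicator
  obtain ⟨C, hC, h⟩ := mixedIntegral_le n α hp hq hpt hqs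
  have h1 := h _ (DifferentiableOn.congr hf.1 hef) (measurable_indicator_polydisc hf.1)
  rw [mixedIntegral_congr hef, mixedIntegral_congr hef] at h1
  exact ne_top_of_le_ne_top (ENNReal.mul_ne_top hC
    (ENNReal.rpow_ne_top_of_nonneg (div_nonneg (hq.le.trans hqs) hq.le) hf.2.ne)) h1

/-- `F^{p,q}_α ⊆ A^{p,max(p,q)}_α`. -/
lemma lizorkinTriebelSpace_subset_mixedSpace {p q α : ℝ} (hp : 0 < p) (hq : 0 < q) :
    lizorkinTriebelSpace n p q α ⊆ mixedSpace n p (max p q) α := by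
  intro f hf
  refine ⟨hf.1, lt_top_iff_ne_top.2 ?_⟩
  have hef : EqOn ((polydisc n).indicator f) f (polydisc n) := eqOn_indicator
  have hfm := measurable_indicator_polydisc hf.1
  have hfin : triebelIntegral p q α ((polydisc n).indicator f) ≠ ∞ := by
    rw [triebelIntegral_congr hef]
    exact hf.2.ne
  change mixedIntegral p (max p q) α f ≠ ∞
  rw [← mixedIntegral_congr hef]
  rcases le_total p q with hpq | hqp
  · rw [max_eq_right hpq]
    exact ne_top_of_le_ne_top
      (ENNReal.rpow_ne_top_of_nonneg (by positivity) hfin)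
      (mixedIntegral_le_triebelIntegral hfm α hp hpq)
  · rw [max_eq_left hqp]
    obtain ⟨C, hC, h⟩ := exists_mixedIntegral_le_triebelIntegral n α hq hqp
    exact ne_top_of_le_ne_top (ENNReal.mul_ne_top hC hfin)
      (h _ (DifferentiableOn.congr hf.1 hef) hfm)

end Polydisc

theorem theorem1 (n : ℕ) (hn : 1 ≤ n) (p q s t α β : ℝ) (m : ℕ)
    (hp : 0 < p) (hq : 0 < q) (hα : 0 < α) (hβ : 0 < β)
    (ht : t ≤ 1) (hts : t / 2 < s) (hst : s ≤ t) (hpq : max p q ≤ s)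
    (h₁ : β + 1 / t < α + 1 / p) (h₂ : α + 1 / p < 2 / t) (hm : 2 / t - 1 < (m : ℝ))
    (g : (Fin n → ℂ) → ℂ) (hg : g ∈ Polydisc.Hol n)
    (c : (Fin n → ℕ) → ℂ) (hc : Polydisc.HasExpansion g c) :
    (c ∈ Polydisc.coeffMultipliers (Polydisc.lizorkinTriebelSpace n p q α)
          (Polydisc.mixedSpace n t s β) ↔
      (⨆ r ∈ Polydisc.cube n, Polydisc.intMean t (Polydisc.fracDeriv (m : ℝ) g) r *
          Polydisc.weight ((m : ℝ) + 1 - 1 / p + β - α) r) < ∞) ∧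
    (c ∈ Polydisc.coeffMultipliers (Polydisc.mixedSpace n p q α)
          (Polydisc.mixedSpace n t s β) ↔
      (⨆ r ∈ Polydisc.cube n, Polydisc.intMean t (Polydisc.fracDeriv (m : ℝ) g) r *
          Polydisc.weight ((m : ℝ) + 1 - 1 / p + β - α) r) < ∞) := by
  have hps : p ≤ s := (le_max_left _ _).trans hpq
  have hqs : q ≤ s := (le_max_right _ _).trans hpq
  have hs0 : 0 < s := hp.trans_le hps
  have ht0 : 0 < t := hs0.trans_le hst
  have hpt : p ≤ t := hps.trans hst
  have h2t : (2 : ℝ) ≤ 2 / t := by rw [le_div_iff₀ ht0]; linarith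
  have hm1 : 1 ≤ m := by
    have h : (0 : ℝ) < m := by linarith
    exact_mod_cast h
  have hαm : α + 1 / p < m + 1 := by linarith
  set κ := (m : ℝ) + 1 - 1 / p + β - α with hκ'
  have hκ : β < κ := by rw [hκ']; linarith
  have hα' : α + 1 / p - 1 / t = β - κ + (m + 1) - 1 / t := by rw [hκ']; ring
  have hGc : Polydisc.HasExpansion (Polydisc.fracDeriv (m : ℝ) g)
      fun k => (Polydisc.binomCoeff m k : ℂ) * c k := by
    rw [hc.fracDeriv_eq m]
    exact (hc.convergentOnCube.binomCoeff_mul m).hasExpansion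
  have hsup : ∀ B : ℝ≥0∞, B ≠ ∞ → (∀ r ∈ Polydisc.cube n,
      Polydisc.intMean t (Polydisc.fracDeriv (m : ℝ) g) r * Polydisc.weight κ r ≤ B) →
      (⨆ r ∈ Polydisc.cube n, Polydisc.intMean t (Polydisc.fracDeriv (m : ℝ) g) r *
        Polydisc.weight κ r) < ∞ :=
    fun B hB h => (iSup₂_le h).trans_lt (lt_top_iff_ne_top.2 hB)
  have he : (0 : ℝ) ≤ m + 1 - α - 1 / p := by linarith
  have heκ : (m + 1 - α - 1 / p : ℝ) + β = κ := by rw [hκ']; ring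
  refine ⟨⟨fun h => ?_, fun h => ?_⟩, ⟨fun h => ?_, fun h => ?_⟩⟩
  · obtain ⟨B, hB, hbd⟩ := Polydisc.exists_intMean_bound_of_multiplier ht0 ht hs0 hst he hGc h
      fun r hr ε => Polydisc.superposition_testFun_mem_lizorkinTriebelSpace hp hq hα hαm hr ε
    rw [heκ] at hbd
    exact hsup B hB hbd
  · refine Polydisc.mem_coeffMultipliers_of_bounded ht0 ht hs0 hst hβ hκ hm1 hα' hGc
      hc.convergentOnCube h.ne (fun r hr => le_iSup₂ (f := fun r (_ : r ∈ Polydisc.cube n) =>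
        Polydisc.intMean t (Polydisc.fracDeriv (m : ℝ) g) r * Polydisc.weight κ r) r hr)
      fun f hf => ⟨hf.1, ?_⟩
    -- `F^{p,q}_α ⊆ A^{p,max(p,q)}_α`, and `max(p,q) ≤ s`
    exact Polydisc.mixedIntegral_ne_top_of_mem_mixedSpace hp (lt_max_of_lt_left hp) hpt hpq
      (Polydisc.lizorkinTriebelSpace_subset_mixedSpace hp hq hf)
  · obtain ⟨B, hB, hbd⟩ := Polydisc.exists_intMean_bound_of_multiplier ht0 ht hs0 hst he hGc h
      fun r hr ε => Polydisc.superposition_testFun_mem_mixedSpace hp hq hα hαm hr ε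
    rw [heκ] at hbd
    exact hsup B hB hbd
  · exact Polydisc.mem_coeffMultipliers_of_bounded ht0 ht hs0 hst hβ hκ hm1 hα' hGc
      hc.convergentOnCube h.ne (fun r hr => le_iSup₂ (f := fun r (_ : r ∈ Polydisc.cube n) =>
        Polydisc.intMean t (Polydisc.fracDeriv (m : ℝ) g) r * Polydisc.weight κ r) r hr)
      fun f hf => ⟨hf.1, Polydisc.mixedIntegral_ne_top_of_mem_mixedSpace hp hq hpt hqs hf⟩
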